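/- **Setting.** Let $(X,A,Y)\sim P$ with features $X\in\mathcal X$, attribute $A\in\{0,1\}$ and (fully observed) outcome $Y\in\mathcal Y\subseteq[0,1]$. Let $\mathcal F$ be a class of measurable functions $f:\mathcal X\to[0,1]$ (with the usual measurability of suprema over the class), and let $l:\mathcal Y\times[0,1]\to[0,1]$ be $1$-Lipschitz for the $l_1$-norm, extended by $l(y,u)=l(y,\min\{u,1\})$ for $u>1$. Let $\mathcal E_0,\mathcal E_1$ be events of positive probability determined by $(A,Y)$, and let $\beta_0,\beta_1\in\mathbb R$. Put $\mathrm{loss}(f)=\mathbb E[l(Y,f(X))]$ and $\mathrm{disparity}(f)=\beta_0\mathbb E[f(X)\mid\mathcal E_0]+\beta_1\mathbb E[f(X)\mid\mathcal E_1]$. For a discrete distribution $Q$ on $\mathcal F$ put $\mathrm{loss}(Q)=\sum_f Q(f)\,\mathrm{loss}(f)$ and $\mathrm{disparity}(Q)=\sum_f Q(f)\,\mathrm{disparity}(f)$. Fix a loss tolerance $\epsilon\ge 0$; $Q$ is *feasible* if $\mathrm{loss}(Q)\le\epsilon$. **Discretization.** Let $N\ge1$, $\alpha=1/N$, let $Z$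 be uniform on $\{\alpha,2\alpha,\dots,1\}$ and independent of the data, and put $h_f(x,z)=1\{f(x)\ge z\}$, $\mathcal H=\{h_f:f\in\mathcal F\}$. Fix a finite $\frac\alpha2$-cover of $\mathcal Y$ by points of $\mathcal Y$, let $\underline y$ be its smallest element within $\frac\alpha2$ of $y$, and put $c(y,z)=N\,(l(y,z+\frac\alpha2)-l(y,z-\frac\alpha2))$. From $n$ i.i.d. observations form the sample averages $\widehat{\mathrm{cost}}(h_f)=\hat{\mathbb E}\,\mathbb E_Z[c(\underline Y,Z)h_f(X,Z)]$, $\hat c_0=\hat{\mathbb E}[l(\underline Y,\frac\alpha2)]$ and $\widehat{\mathrm{disparity}}(h_f)=\sum_a\beta_a\hat{\mathbb E}[\mathbb E_Z h_f(X,Z)\mid\mathcal E_a]$, extended linearly to distributions over $\mathcal H$. Let $n_a$ be the number of observations in $\mathcal E_a$ (an empirical average over no observations is read as $0$). **Algorithm.** Let $$L(\xi,Q,\lambda)=\xi+\lambda_+(\widehat{\mathrm{disparity}}(Q)-\xi)+\lambda_-(-\widehat{\mathrm{disparity}}(Q)-\xi)+\lambda_{\mathrm{cost}}(\widehat{\mathrm{cost}}(Q)-\hat\epsilon),$$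 with $\xi\in[0,B_\xi]$, $\lambda\ge0$ and $\lambda_++\lambda_-+\lambda_{\mathrm{cost}}\le B_\lambda$; here $B_\xi>0$ bounds the absolute disparity, i.e. $|\beta_0p+\beta_1q|\le B_\xi$ for all $p,q\in[0,1]$. Start with $\theta_1=0\in\mathbb R^3$. In round $t$ set $\lambda_{t,k}=B_\lambda e^{\theta_{t,k}}/(1+\sum_{k'}e^{\theta_{t,k'}})$; let $h_t$ be an exact best response in $h$ to $\lambda_t$, and $\xi_t=B_\xi$ if $1-\lambda_{t,+}-\lambda_{t,-}<0$, otherwise $\xi_t=0$. Let $\hat\xi_t,\hat Q_t,\hat\lambda_t$ be the averages over the rounds so far, and let $\nu_t$ be the larger of the two gains in $L$ at $(\hat\xi_t,\hat Q_t,\hat\lambda_t)$ that best responses of the $(\xi,Q)$-player to $\hat\lambda_t$ and of the $\lambda$-player to $(\hat\xi_t,\hat Q_t)$ achieve. If $\nu_t\le\nu$, stop, and return $(\hat\xi_t,\hat Q_t,\hat\lambda_t)$ if $\widehat{\mathrm{cost}}(\hat Q_t)\le\hat\epsilon+(B_\xi+2\nu)/B_\lambda$ and $null$ otherwise. If $\nu_t>\nu$,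 add to $\theta_t$ the vector $\eta\,(\widehat{\mathrm{disparity}}(h_t)-\xi_t,\,-\widehat{\mathrm{disparity}}(h_t)-\xi_t,\,\widehat{\mathrm{cost}}(h_t)-\hat\epsilon)$. The learning rate is $\eta=\nu/(2\rho^2B_\lambda)$, where $\rho$ is the supremum over $h\in\mathcal H$ and $\xi\in[0,B_\xi]$ of the largest absolute value of a coordinate of $(\widehat{\mathrm{disparity}}(h)-\xi,\,-\widehat{\mathrm{disparity}}(h)-\xi,\,\widehat{\mathrm{cost}}(h)-\hat\epsilon)$. **Theorem.** Let $0<\phi\le\frac12$, $C>0$, and suppose that the Rademacher complexity satisfies $R_k(\mathcal H)\le Ck^{-\phi}$ for all $k\ge1$. Let $\delta\in(0,1)$ and $$\hat\epsilon=\epsilon-\hat c_0+C'n^{-\phi}-C''n^{-1/2},$$ where $C''\ge\sqrt{-\log(\delta/8)/2}$ is a constant and $C'\ge2C+2+\sqrt{2\ln(8N/\delta)}$ is bounded by a polynomial in $\ln n$ and $\ln(1/\delta)$. Let $\nu=\kappa_\nu n^{-\phi}$, $B_\lambda=\kappa_Bn^{\phi}$ and $\kappa_1n^\phi\le N\le\kappa_2n^\phi$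 with fixed positive constants. Then there is an $\bar n$, depending only on $\delta$, $C''$ and the constants of the problem ($\phi$, $C$, $\beta_0$, $\beta_1$, $B_\xi$, the $\kappa$'s, the polynomial bounding $C'$ and an upper bound for $\epsilon$), such that for all $n\ge\bar n$ the following holds. The algorithm terminates, on every sample, after at most $O(n^{4\phi})$ iterations. With probability at least $1-\delta$, one of the following holds: 1. the output is not $null$, $\mathrm{loss}(\hat Q)\le\epsilon+\tilde O(n^{-\phi})$, and $|\mathrm{disparity}(\hat Q)|\le|\mathrm{disparity}(\tilde Q)|+\tilde O(n_0^{-\phi})+\tilde O(n_1^{-\phi})$ for every feasible $\tilde Q$, where $\hat Q$ is viewed as a distribution over $\mathcal F$; or 2. the output is $null$ and no distribution on $\mathcal F$ is feasible. The constants in $O$ and $\tilde O$ depend only on the constants of the problem, not on $n$, $\delta$, $C''$, $P$ or $\mathcal F$, and $\tilde O$ hides polynomial factors in $\ln n$ and $\ln(1/\delta)$. In the last bound $n_a$ is read as $\max\{n_a,1\}$. -/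

import Mathlib

open MeasureTheory Set

universe u

namespace FairRashomon

/-- The population and the learning problem. An observation is `(x, a, y)`: features, sensitive
attribute in `{0, 1}`, outcome in a set `outcomes ⊆ [0, 1]`. Predictors take values in `[0, 1]`,
the loss is `[0, 1]`-valued and `1`-Lipschitz for the `l₁` norm, and the two conditioning events
are determined by `(a, y)` and have positive probability. -/
structure Setting (𝒳 : Type u) [MeasurableSpace 𝒳] where
  outcomes : Set ℝ
  outcomes_subset : outcomes ⊆ Icc 0 1
  law : Measure (𝒳 × Fin 2 × outcomes)
  law_prob : IsProbabilityMeasure law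
  predictors : Set (𝒳 → unitInterval)
  predictors_measurable : ∀ f ∈ predictors, Measurable f
  lossFn : outcomes → unitInterval → unitInterval
  lossFn_lipschitz : ∀ y y' u u',
    |(lossFn y u : ℝ) - (lossFn y' u' : ℝ)| ≤ |(y : ℝ) - (y' : ℝ)| + |(u : ℝ) - (u' : ℝ)|
  event : Fin 2 → Set (Fin 2 × outcomes)
  event_measurable : ∀ a, MeasurableSet (event a)
  event_pos : ∀ a, law {o | o.2 ∈ event a} ≠ 0

/-- Mean of `g` under a (discrete) distribution `Q` over the index set:
`∑ f, Q(f) g(f)`. -/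
noncomputable def mean {ι : Type*} (Q : PMF ι) (g : ι → ℝ) : ℝ :=
  ∑' f, (Q f).toReal * g f

namespace Setting

variable {𝒳 : Type u} [MeasurableSpace 𝒳] (S : Setting 𝒳)

/-- One observation `(x, a, y)`. -/
abbrev Obs : Type u := 𝒳 × Fin 2 × S.outcomes

/-! ### Population quantities -/

/-- `loss(f) = E[l(Y, f(X))]`. -/
noncomputable def loss (f : S.predictors) : ℝ :=
  ∫ o, (S.lossFn o.2.2 (f.1 o.1) : ℝ) ∂S.law

/-- `disparity(f) = β₀ E[f(X) | 𝓔₀] + β₁ E[f(X) | 𝓔₁]`. -/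
noncomputable def disp (β : Fin 2 → ℝ) (f : S.predictors) : ℝ :=
  ∑ a, β a * ∫ o, (f.1 o.1 : ℝ) ∂(ProbabilityTheory.cond S.law {o | o.2 ∈ S.event a})

/-- `Q` satisfies the loss constraint `loss(Q) ≤ ε` of the population problem
`min |disparity(Q)| s.t. loss(Q) ≤ ε`. -/
def Feasible (ε : ℝ) (Q : PMF S.predictors) : Prop :=
  mean Q S.loss ≤ ε

/-! ### Threshold classifiers and complexity -/

/-- The threshold classifier `h_f(x, z) = 1{f(x) ≥ z}`. -/
noncomputable def thr (f : S.predictors) (x : 𝒳) (z : ℝ) : ℝ :=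
  if z ≤ (f.1 x : ℝ) then 1 else 0

/-- Rademacher complexity `R_m` of the class of threshold classifiers on `𝒳 × [0, 1]`:
`sup_{u₁,…,u_m} E_σ [ sup_f | (1/m) ∑ σᵢ h_f(uᵢ) | ]` with independent uniform signs `σᵢ`. -/
noncomputable def rademacher (m : ℕ) : ℝ :=
  ⨆ v : Fin m → 𝒳 × unitInterval,
    (1 / 2 ^ m : ℝ) * ∑ σ : Fin m → Bool,
      ⨆ f : S.predictors,
        |(1 / (m : ℝ)) * ∑ i, (if σ i then (1 : ℝ) else -1) * S.thr f (v i).1 (v i).2|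

/-- Measurability convention for the class: suprema over the class of absolute values of finite
signed sums of threshold classifiers are measurable (up to null sets) functions of the points.
It holds for instance for every countable class. -/
def SupMeasurable : Prop :=
  ∀ (m : ℕ) (c : Fin m → ℝ) (z : unitInterval),
    AEMeasurable (fun x : Fin m → 𝒳 => ⨆ f : S.predictors, |∑ i, c i * S.thr f (x i) z|)
      (Measure.pi fun _ => S.law.map Prod.fst)

/-! ### Discretization, with grid `{1/N, 2/N, …, 1}` and `α = 1/N` -/

/-- `cover` is a finite `α/2`-cover of the outcome set. -/
def IsCover (N : ℕ) (cover : Finset S.outcomes) : Prop :=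
  ∀ y : S.outcomes, ∃ y' : S.outcomes, y' ∈ cover ∧ |(y : ℝ) - (y' : ℝ)| ≤ 1 / (2 * (N : ℝ))

open Classical in
/-- The smallest element of the cover within `α/2` of `y`. -/
noncomputable def roundOutcome (N : ℕ) (cover : Finset S.outcomes) (y : S.outcomes) :
    S.outcomes :=
  if h : (cover.filter fun y' : S.outcomes => |(y : ℝ) - (y' : ℝ)| ≤ 1 / (2 * (N : ℝ))).Nonempty then
    (cover.filter fun y' : S.outcomes => |(y : ℝ) - (y' : ℝ)| ≤ 1 / (2 * (N : ℝ))).min' h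
  else y

/-- The loss with its second argument truncated to `[0, 1]`; the truncation only matters at the
last grid point, where the shifted argument is `1 + α/2`. -/
noncomputable def lossExt (y : S.outcomes) (v : ℝ) : ℝ :=
  S.lossFn y (projIcc (0 : ℝ) 1 zero_le_one v)

/-- `c(y, z) = N (l(y, z + α/2) - l(y, z - α/2))`. -/
noncomputable def costWeight (N : ℕ) (y : S.outcomes) (z : ℝ) : ℝ :=
  N * (S.lossExt y (z + 1 / (2 * (N : ℝ))) - S.lossExt y (z - 1 / (2 * (N : ℝ))))

/-- Mean over the uniform distribution on the grid `{1/N, …, N/N}`. -/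
noncomputable def gridMean (N : ℕ) (g : ℝ → ℝ) : ℝ :=
  (1 / (N : ℝ)) * ∑ j ∈ Finset.Icc 1 N, g ((j : ℝ) / N)

/-! ### Sample quantities -/

variable {n : ℕ} (s : Fin n → S.Obs)

open Classical in
/-- Number of sample points in the event `𝓔ₐ`. -/
noncomputable def eventCount (a : Fin 2) : ℕ :=
  (Finset.univ.filter fun i => (s i).2 ∈ S.event a).card

open Classical in
/-- Sample version of `disparity(h_f) = ∑ₐ βₐ E[h_f(X, Z) | 𝓔ₐ]`, `Z` uniform on the grid. -/
noncomputable def empDisp (β : Fin 2 → ℝ) (N : ℕ) (f : S.predictors) : ℝ :=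
  ∑ a, β a * ((1 / (S.eventCount s a : ℝ)) *
    ∑ i, if (s i).2 ∈ S.event a then gridMean N (fun z => S.thr f (s i).1 z) else 0)

/-- Sample version of `cost(h_f) = E[c(y̲, Z) h_f(X, Z)]`, with `y̲` the rounded outcome. -/
noncomputable def empCost (N : ℕ) (cover : Finset S.outcomes) (f : S.predictors) : ℝ :=
  (1 / (n : ℝ)) * ∑ i, gridMean N (fun z =>
    S.costWeight N (S.roundOutcome N cover (s i).2.2) z * S.thr f (s i).1 z)

/-- `ĉ₀`, the sample mean of `l(y̲, α/2)`. -/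
noncomputable def empConst (N : ℕ) (cover : Finset S.outcomes) : ℝ :=
  (1 / (n : ℝ)) * ∑ i, S.lossExt (S.roundOutcome N cover (s i).2.2) (1 / (2 * (N : ℝ)))

/-- `ε̂ = ε - ĉ₀ + C' n^{-φ} - C'' n^{-1/2}`. -/
noncomputable def epsHat (N : ℕ) (cover : Finset S.outcomes) (φ ε C' C'' : ℝ) : ℝ :=
  ε - S.empConst s N cover + C' * (n : ℝ) ^ (-φ) - C'' * (n : ℝ) ^ (-(1 / 2) : ℝ)

end Setting

/-! ### The exponentiated gradient algorithm with a slack variable -/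

/-- The three constraint values at `(ξ, Q)`: index `0` is `disp(Q) - ξ`, index `1` is
`-disp(Q) - ξ`, index `2` is `cost(Q) - ε̂`. -/
noncomputable def constraintVec {ι : Type*} (disp cost : ι → ℝ) (epsHat ξ : ℝ) (Q : PMF ι) :
    Fin 3 → ℝ :=
  ![mean Q disp - ξ, -mean Q disp - ξ, mean Q cost - epsHat]

/-- `ρ`: the supremum of the absolute constraint values over all `h` and all `ξ ∈ [0, B_ξ]`
(the norm on `Fin 3 → ℝ` is the sup norm). -/
noncomputable def rho {ι : Type*} (disp cost : ι → ℝ) (epsHat Bξ : ℝ) : ℝ :=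
  ⨆ p : ι × Icc (0 : ℝ) Bξ, ‖constraintVec disp cost epsHat p.2 (PMF.pure p.1)‖

/-- Input of the algorithm: sample disparity and cost of each classifier, empirical loss tolerance,
bounds, accuracy, learning rate, and the procedure for the best response in `h`. -/
structure AlgInput (ι : Type*) where
  disp : ι → ℝ
  cost : ι → ℝ
  epsHat : ℝ
  Bξ : ℝ
  Bl : ℝ
  ν : ℝ
  η : ℝ
  bestH : (Fin 3 → ℝ) → ι

namespace AlgInput

variable {ι : Type*} (g : AlgInput ι)

/-- `bestH` returns a minimizer of the `h`-part of the Lagrangian for all multipliers `λ ≥ 0`. -/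
def IsBestResponse : Prop :=
  ∀ lam : Fin 3 → ℝ, (∀ k, 0 ≤ lam k) → ∀ h : ι,
    (lam 0 - lam 1) * g.disp (g.bestH lam) + lam 2 * (g.cost (g.bestH lam) - g.epsHat) ≤
      (lam 0 - lam 1) * g.disp h + lam 2 * (g.cost h - g.epsHat)

/-- Constraint values. -/
noncomputable def con (ξ : ℝ) (Q : PMF ι) : Fin 3 → ℝ :=
  constraintVec g.disp g.cost g.epsHat ξ Q

/-- The Lagrangian `L(ξ, Q, λ) = ξ + λ₊(disp Q - ξ) + λ₋(-disp Q - ξ) + λ_cost(cost Q - ε̂)`. -/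
noncomputable def lagr (ξ : ℝ) (Q : PMF ι) (lam : Fin 3 → ℝ) : ℝ :=
  ξ + ∑ k, lam k * g.con ξ Q k

/-- Best response in `ξ`. -/
noncomputable def bestXi (lam : Fin 3 → ℝ) : ℝ :=
  if 1 - lam 0 - lam 1 < 0 then g.Bξ else 0

/-- Index of a largest coordinate. -/
noncomputable def maxIndex (v : Fin 3 → ℝ) : Fin 3 :=
  if v 1 ≤ v 0 ∧ v 2 ≤ v 0 then 0 else if v 2 ≤ v 1 then 1 else 2

open Classical in
/-- Best response of the multiplier player: zero if all constraints hold, otherwise all the mass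
`B_λ` on a maximally violated constraint. -/
noncomputable def bestLam (ξ : ℝ) (Q : PMF ι) : Fin 3 → ℝ :=
  if ∀ k, g.con ξ Q k ≤ 0 then 0 else Pi.single (maxIndex (g.con ξ Q)) g.Bl

/-- `λ_k = B_λ exp(θ_k) / (1 + ∑ exp(θ_k'))`. -/
noncomputable def lamOf (θ : Fin 3 → ℝ) : Fin 3 → ℝ :=
  fun k => g.Bl * (Real.exp (θ k) / (1 + ∑ k', Real.exp (θ k')))

/-- The parameter `θ` at round `t + 1` (rounds are counted from `t = 0` here). -/
noncomputable def theta : ℕ → Fin 3 → ℝ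
  | 0 => 0
  | t + 1 => theta t +
      g.η • g.con (g.bestXi (g.lamOf (theta t))) (PMF.pure (g.bestH (g.lamOf (theta t))))

/-- Multipliers played in round `t + 1`. -/
noncomputable def lam (t : ℕ) : Fin 3 → ℝ := g.lamOf (g.theta t)

/-- `Q̂` after round `t + 1`: the uniform mixture of the classifiers of rounds `1, …, t + 1`. -/
noncomputable def Qhat (t : ℕ) : PMF ι :=
  (PMF.uniformOfFintype (Fin (t + 1))).map fun r => g.bestH (g.lam r)

/-- `ξ̂` after round `t + 1`. -/
noncomputable def xiHat (t : ℕ) : ℝ :=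
  (1 / ((t : ℝ) + 1)) * ∑ r ∈ Finset.range (t + 1), g.bestXi (g.lam r)

/-- `λ̂` after round `t + 1`. -/
noncomputable def lamHat (t : ℕ) : Fin 3 → ℝ :=
  (1 / ((t : ℝ) + 1)) • ∑ r ∈ Finset.range (t + 1), g.lam r

/-- The saddle point gap `ν_t` after round `t + 1`. -/
noncomputable def gap (t : ℕ) : ℝ :=
  max
    (g.lagr (g.xiHat t) (g.Qhat t) (g.lamHat t) -
      g.lagr (g.bestXi (g.lamHat t)) (PMF.pure (g.bestH (g.lamHat t))) (g.lamHat t))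
    (g.lagr (g.xiHat t) (g.Qhat t) (g.bestLam (g.xiHat t) (g.Qhat t)) -
      g.lagr (g.xiHat t) (g.Qhat t) (g.lamHat t))

/-- The algorithm stops in round `t + 1`, that is, after exactly `t + 1` iterations. -/
def StopsAt (t : ℕ) : Prop :=
  g.gap t ≤ g.ν ∧ ∀ r < t, g.ν < g.gap r

open Classical in
/-- What is returned if the algorithm stops in round `t + 1`; `none` stands for `null`. -/
noncomputable def output (t : ℕ) : Option (ℝ × PMF ι × (Fin 3 → ℝ)) :=
  if mean (g.Qhat t) g.cost ≤ g.epsHat + (g.Bξ + 2 * g.ν) / g.Bl then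
    some (g.xiHat t, g.Qhat t, g.lamHat t)
  else none

end AlgInput

/-- The polylogarithmic factor `K (1 + ln n + ln(1/δ))^m`. -/
noncomputable def polylog (K : ℝ) (m n : ℕ) (δ : ℝ) : ℝ :=
  K * (1 + Real.log n + Real.log (1 / δ)) ^ m

/-- The algorithm's input for the sample `s`, with learning rate `η = ν / (2 ρ² B_λ)`. -/
noncomputable def Setting.algInput {𝒳 : Type u} [MeasurableSpace 𝒳] (S : Setting 𝒳) {n : ℕ}
    (s : Fin n → S.Obs) (β : Fin 2 → ℝ) (N : ℕ) (cover : Finset S.outcomes)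
    (epsHat Bξ Bl ν : ℝ) (bestH : (Fin 3 → ℝ) → S.predictors) : AlgInput S.predictors where
  disp := S.empDisp s β N
  cost := S.empCost s N cover
  epsHat := epsHat
  Bξ := Bξ
  Bl := Bl
  ν := ν
  η := ν / (2 * rho (S.empDisp s β N) (S.empCost s N cover) epsHat Bξ ^ 2 * Bl)
  bestH := bestH

end FairRashomon

open FairRashomon

/-! The theorem combines a deterministic game argument with uniform concentration.

Game. The Lagrangian is bilinear apart from terms affine in one player's variables. The multiplier
player runs exponentiated gradient with a fourth, dummy coordinate of payoff zero, and the other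
player answers exactly. The regret bound of `regret_le`, with `log 4` for the four coordinates,
bounds the saddle point gap of the averages (`AlgInput.gap_le`). The given `η` makes the gap at most
`ν` once the number of rounds reaches `4 log 4 ρ² B_λ² / ν²`, which is of order `n ^ (4φ)`. At such
an approximate saddle point the averaged distribution nearly meets the empirical cost constraint,
and its empirical disparity is within `2ν` of that of any empirically feasible competitor
(`AlgInput.abs_mean_disp_le`).

Discretization. The weights `c(y, z)` telescope over the grid, so empirical cost plus `ĉ₀` is the
empirical loss at rounded outcomes and predictions, with error at most `1/N`.

Concentration. For each grid point a ghost sample and random signs bound the exponential moments of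
the supremum. The Rademacher hypothesis controls the mean over signs, and weights in `[-1, 1]` do
not increase it. Jensen's inequality passes from single grid points to their average without a union
bound, so the level `τ = √(8 log (8/δ))` does not involve `N`. For the conditional means, given the
set of indices falling in the event, those observations are i.i.d. from the conditional law, and the
bound is summed over all index sets (`measure_subsample_le`).

Assembly. On the good event the loss error is at most `d`, while the empirical tolerance is relaxed
by `γ = C' n^(-φ) - C'' n^(-1/2)`. Since `C'` contains `√(2 log (8N/δ))`, which grows with `n`,
eventually `d ≤ γ`. Every feasible distribution is then empirically feasible, so a null output
certifies infeasibility, and otherwise all error terms have the claimed order. -/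

namespace FairRashomon

/-! ### Means under discrete distributions -/

section Mean

variable {ι : Type*} (Q : PMF ι)

theorem summable_toReal : Summable fun f => (Q f).toReal :=
  ENNReal.summable_toReal (by rw [Q.tsum_coe]; exact ENNReal.one_ne_top)

theorem tsum_toReal : ∑' f, (Q f).toReal = 1 := by
  rw [← ENNReal.tsum_toReal_eq fun f => Q.apply_ne_top f, Q.tsum_coe, ENNReal.toReal_one]

/-- The bounds carried by the lemmas on `mean` serve only to provide summability; a divergent series
would have the default value `0`. -/
theorem summable_mean {g : ι → ℝ} {B : ℝ} (hg : ∀ f, |g f| ≤ B) :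
    Summable fun f => (Q f).toReal * g f := by
  refine Summable.of_norm_bounded ((summable_toReal Q).mul_right B) fun f => ?_
  rw [Real.norm_eq_abs, abs_mul, abs_of_nonneg ENNReal.toReal_nonneg]
  exact mul_le_mul_of_nonneg_left (hg f) ENNReal.toReal_nonneg

theorem mean_const (c : ℝ) : mean Q (fun _ => c) = c := by
  rw [mean, tsum_mul_right, tsum_toReal, one_mul]

theorem mean_add {g g' : ι → ℝ} {B B' : ℝ} (hg : ∀ f, |g f| ≤ B) (hg' : ∀ f, |g' f| ≤ B') :
    mean Q (fun f => g f + g' f) = mean Q g + mean Q g' := by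
  rw [mean, mean, mean, ← (summable_mean Q hg).tsum_add (summable_mean Q hg')]
  simp only [mul_add]

theorem mean_const_mul (c : ℝ) (g : ι → ℝ) : mean Q (fun f => c * g f) = c * mean Q g := by
  rw [mean, mean, ← tsum_mul_left]
  exact tsum_congr fun f => by ring

theorem mean_mono {g g' : ι → ℝ} {B B' : ℝ} (hg : ∀ f, |g f| ≤ B) (hg' : ∀ f, |g' f| ≤ B')
    (h : ∀ f, g f ≤ g' f) : mean Q g ≤ mean Q g' :=
  (summable_mean Q hg).tsum_le_tsum
    (fun f => mul_le_mul_of_nonneg_left (h f) ENNReal.toReal_nonneg) (summable_mean Q hg')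

theorem mean_add_const {g : ι → ℝ} {B : ℝ} (hg : ∀ f, |g f| ≤ B) (c : ℝ) :
    mean Q (fun f => g f + c) = mean Q g + c := by
  rw [mean_add Q hg (fun _ => le_refl |c|), mean_const]

theorem mean_le_add {g g' : ι → ℝ} {B B' d : ℝ} (hg : ∀ f, |g f| ≤ B) (hg' : ∀ f, |g' f| ≤ B')
    (h : ∀ f, g f ≤ g' f + d) : mean Q g ≤ mean Q g' + d := by
  rw [← mean_add_const Q hg']
  exact mean_mono Q hg (B' := B' + |d|)
    (fun f => (abs_add_le _ _).trans (add_le_add_left (hg' f) _)) h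

theorem abs_mean_sub_le {g g' : ι → ℝ} {B B' d : ℝ} (hg : ∀ f, |g f| ≤ B)
    (hg' : ∀ f, |g' f| ≤ B') (h : ∀ f, |g f - g' f| ≤ d) : |mean Q g - mean Q g'| ≤ d := by
  rw [abs_le]
  have h1 := mean_le_add Q hg hg' (d := d) fun f => by linarith [(abs_le.1 (h f)).2]
  have h2 := mean_le_add Q hg' hg (d := d) fun f => by linarith [(abs_le.1 (h f)).1]
  constructor <;> linarith

theorem abs_mean_le {g : ι → ℝ} {B : ℝ} (hg : ∀ f, |g f| ≤ B) : |mean Q g| ≤ B := by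
  have h := abs_mean_sub_le Q hg (g' := fun _ => 0) (B' := 0) (by simp) (d := B) (by simpa using hg)
  rwa [mean_const, sub_zero] at h

theorem mean_pure (a : ι) (g : ι → ℝ) : mean (PMF.pure a) g = g a := by
  rw [mean, tsum_eq_single a]
  · simp
  · intro b hb
    simp [PMF.pure_apply, hb]

theorem mean_map_uniform (T : ℕ) (h : Fin (T + 1) → ι) (g : ι → ℝ) :
    mean ((PMF.uniformOfFintype (Fin (T + 1))).map h) g =
      (1 / ((T : ℝ) + 1)) * ∑ r, g (h r) := by
  classical
  have key : ∀ f, (((PMF.uniformOfFintype (Fin (T + 1))).map h) f).toReal * g f =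
      ∑ r, if f = h r then (1 / ((T : ℝ) + 1)) * g (h r) else 0 := by
    intro f
    rw [PMF.map_apply, tsum_fintype, ENNReal.toReal_sum, Finset.sum_mul]
    · refine Finset.sum_congr rfl fun r _ => ?_
      split_ifs with hf
      · subst hf
        have : (((T : ENNReal) + 1)⁻¹).toReal = ((T : ℝ) + 1)⁻¹ := by
          rw [ENNReal.toReal_inv, ENNReal.toReal_add (by simp) (by simp)]
          simp
        simp [PMF.uniformOfFintype_apply, this]
      · simp
    · intro r _
      split_ifs
      · simp [PMF.uniformOfFintype_apply]
      · simp
  rw [mean, tsum_congr key, Summable.tsum_finsetSum, Finset.mul_sum]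
  · exact Finset.sum_congr rfl fun r _ => tsum_ite_eq (h r) _
  · intro r _
    exact (hasSum_ite_eq (h r) _).summable

end Mean

/-! ### Regret of exponentiated gradient updates -/

/-- `p₀` is the mass of the dummy coordinate with payoff zero. The estimate is `e^x ≤ 1 + x + x²`
for `|x| ≤ 1`, averaged, followed by `1 + y ≤ e^y`. -/
theorem exp_step_le {η ρ : ℝ} {p v : Fin 3 → ℝ} {p₀ : ℝ} (hp₀ : 0 ≤ p₀) (hp : ∀ k, 0 ≤ p k)
    (hsum : p₀ + ∑ k, p k = 1) (hη : 0 ≤ η) (hv : ∀ k, |v k| ≤ ρ) (hηρ : η * ρ ≤ 1) :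
    p₀ + ∑ k, p k * Real.exp (η * v k) ≤
      Real.exp (η * ∑ k, p k * v k + (η * ρ) ^ 2) := by
  have hx : ∀ k, |η * v k| ≤ η * ρ := fun k => by
    rw [abs_mul, abs_of_nonneg hη]
    exact mul_le_mul_of_nonneg_left (hv k) hη
  have h1 : ∀ k, p k * Real.exp (η * v k) ≤ p k * (1 + η * v k + (η * ρ) ^ 2) := fun k => by
    refine mul_le_mul_of_nonneg_left ?_ (hp k)
    have h := (abs_le.1 (Real.abs_exp_sub_one_sub_id_le ((hx k).trans hηρ))).2
    have h2 : (η * v k) ^ 2 ≤ (η * ρ) ^ 2 := sq_le_sq' (abs_le.1 (hx k)).1 (abs_le.1 (hx k)).2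
    linarith
  have h2 := Finset.sum_le_sum fun k (_ : k ∈ Finset.univ) => h1 k
  have h3 : ∑ k, p k * (1 + η * v k + (η * ρ) ^ 2) =
      (∑ k, p k) * (1 + (η * ρ) ^ 2) + η * ∑ k, p k * v k := by
    rw [Finset.sum_mul, Finset.mul_sum, ← Finset.sum_add_distrib]
    exact Finset.sum_congr rfl fun k _ => by ring
  have h4 : ∑ k, p k = 1 - p₀ := by linarith
  rw [h3, h4] at h2
  have h5 := Real.add_one_le_exp (η * ∑ k, p k * v k + (η * ρ) ^ 2)
  nlinarith [mul_nonneg hp₀ (sq_nonneg (η * ρ))]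

/-- The log-partition function is the potential, and `exp_step_le` bounds its increment in each
round. It starts at `log 4`: three coordinates plus the dummy one. -/
theorem log_potential_le {η ρ : ℝ} {v θ : ℕ → Fin 3 → ℝ} (hθ0 : θ 0 = 0)
    (hθ : ∀ t, θ (t + 1) = θ t + η • v t) (hη : 0 ≤ η) (hv : ∀ t k, |v t k| ≤ ρ)
    (hηρ : η * ρ ≤ 1) (T : ℕ) :
    Real.log (1 + ∑ k, Real.exp (θ T k)) ≤ Real.log 4 + ∑ t ∈ Finset.range T,
      (η * ∑ k, (Real.exp (θ t k) / (1 + ∑ k', Real.exp (θ t k'))) * v t k + (η * ρ) ^ 2) := by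
  have hpos : ∀ t, 0 < 1 + ∑ k, Real.exp (θ t k) := fun t =>
    add_pos_of_pos_of_nonneg one_pos (Finset.sum_nonneg fun k _ => (Real.exp_pos _).le)
  induction T with
  | zero =>
    have : (1 : ℝ) + 3 = 4 := by norm_num
    simp [hθ0, this]
  | succ T ih =>
    rw [Finset.sum_range_succ, ← add_assoc]
    refine le_trans ?_ (add_le_add_left ih _)
    rw [← sub_le_iff_le_add', ← Real.log_div (hpos _).ne' (hpos _).ne',
      Real.log_le_iff_le_exp (div_pos (hpos _) (hpos _))]
    have h := exp_step_le (η := η) (ρ := ρ) (v := v T) (p₀ := 1 / (1 + ∑ k, Real.exp (θ T k)))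
      (p := fun k => Real.exp (θ T k) / (1 + ∑ k', Real.exp (θ T k')))
      (div_nonneg zero_le_one (hpos T).le)
      (fun k => div_nonneg (Real.exp_pos _).le (hpos T).le)
      (by rw [← Finset.sum_div, ← add_div, div_self (hpos T).ne']) hη (hv T) hηρ
    refine le_trans (le_of_eq ?_) h
    rw [add_div, Finset.sum_div, hθ]
    congr 1
    refine Finset.sum_congr rfl fun k _ => ?_
    rw [Pi.add_apply, Real.exp_add, Pi.smul_apply, smul_eq_mul]
    ring

theorem iterate_eq_sum {η : ℝ} {v θ : ℕ → Fin 3 → ℝ} (hθ0 : θ 0 = 0)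
    (hθ : ∀ t, θ (t + 1) = θ t + η • v t) (T : ℕ) (k : Fin 3) :
    θ T k = η * ∑ t ∈ Finset.range T, v t k := by
  induction T with
  | zero => simp [hθ0]
  | succ T ih => rw [hθ, Pi.add_apply, ih, Finset.sum_range_succ, mul_add]; simp

/-- The potential dominates every `θ T k` and also `0`, hence every average with total mass at most
one; the missing mass sits on the dummy coordinate. -/
theorem regret_le {η ρ : ℝ} {v θ : ℕ → Fin 3 → ℝ} (hθ0 : θ 0 = 0)
    (hθ : ∀ t, θ (t + 1) = θ t + η • v t) (hη : 0 ≤ η) (hv : ∀ t k, |v t k| ≤ ρ)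
    (hηρ : η * ρ ≤ 1) (T : ℕ) {q : Fin 3 → ℝ} (hq : ∀ k, 0 ≤ q k) (hq1 : ∑ k, q k ≤ 1) :
    η * ∑ k, q k * ∑ t ∈ Finset.range T, v t k ≤ Real.log 4 + ∑ t ∈ Finset.range T,
      (η * ∑ k, (Real.exp (θ t k) / (1 + ∑ k', Real.exp (θ t k'))) * v t k + (η * ρ) ^ 2) := by
  refine le_trans ?_ (log_potential_le hθ0 hθ hη hv hηρ T)
  have hnn : 0 ≤ ∑ k, Real.exp (θ T k) := Finset.sum_nonneg fun k _ => (Real.exp_pos _).le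
  have h0 : 0 ≤ Real.log (1 + ∑ k, Real.exp (θ T k)) := Real.log_nonneg (by linarith)
  have h1 : ∀ k, θ T k ≤ Real.log (1 + ∑ k, Real.exp (θ T k)) := fun k => by
    rw [Real.le_log_iff_exp_le (by linarith)]
    have := Finset.single_le_sum (f := fun k => Real.exp (θ T k))
      (fun k _ => (Real.exp_pos _).le) (Finset.mem_univ k)
    linarith
  calc η * ∑ k, q k * ∑ t ∈ Finset.range T, v t k = ∑ k, q k * θ T k := by
        rw [Finset.mul_sum]
        refine Finset.sum_congr rfl fun k _ => ?_
        rw [iterate_eq_sum hθ0 hθ]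
        ring
    _ ≤ ∑ k, q k * Real.log (1 + ∑ k, Real.exp (θ T k)) :=
        Finset.sum_le_sum fun k _ => mul_le_mul_of_nonneg_left (h1 k) (hq k)
    _ = (∑ k, q k) * Real.log (1 + ∑ k, Real.exp (θ T k)) := by rw [Finset.sum_mul]
    _ ≤ Real.log (1 + ∑ k, Real.exp (θ T k)) := mul_le_of_le_one_left h0 hq1

/-! ### The saddle point algorithm -/

namespace AlgInput

variable {ι : Type*} (g : AlgInput ι)

/-- This grouping decouples `ξ` from `Q`, so the two halves of a best response can be checked
separately. -/
theorem lagr_eq (ξ : ℝ) (Q : PMF ι) (lam : Fin 3 → ℝ) :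
    g.lagr ξ Q lam = ξ * (1 - lam 0 - lam 1) +
      ((lam 0 - lam 1) * mean Q g.disp + lam 2 * (mean Q g.cost - g.epsHat)) := by
  simp only [lagr, con, constraintVec, Fin.sum_univ_three, Matrix.cons_val_zero,
    Matrix.cons_val_one, Matrix.cons_val]
  ring

theorem lagr_best_le {g : AlgInput ι} (hbest : g.IsBestResponse) {Bd Bc : ℝ}
    (hd : ∀ i, |g.disp i| ≤ Bd) (hc : ∀ i, |g.cost i| ≤ Bc) {lam : Fin 3 → ℝ}
    (hlam : ∀ k, 0 ≤ lam k) {ξ : ℝ} (hξ0 : 0 ≤ ξ) (hξ : ξ ≤ g.Bξ) (Q : PMF ι) :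
    g.lagr (g.bestXi lam) (PMF.pure (g.bestH lam)) lam ≤ g.lagr ξ Q lam := by
  rw [lagr_eq, lagr_eq, mean_pure, mean_pure]
  refine add_le_add ?_ ?_
  · unfold bestXi
    split_ifs with h
    · nlinarith
    · nlinarith
  · have h := mean_mono Q (g := fun _ => (lam 0 - lam 1) * g.disp (g.bestH lam) +
        lam 2 * (g.cost (g.bestH lam) - g.epsHat))
      (g' := fun h => (lam 0 - lam 1) * g.disp h + (lam 2 * g.cost h + -(lam 2 * g.epsHat)))
      (B := |(lam 0 - lam 1) * g.disp (g.bestH lam) +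
        lam 2 * (g.cost (g.bestH lam) - g.epsHat)|)
      (B' := |lam 0 - lam 1| * Bd + (|lam 2| * Bc + |-(lam 2 * g.epsHat)|))
      (fun _ => le_rfl) (fun i => ?_) (fun i => ?_)
    · rw [mean_const, mean_add Q (B := |lam 0 - lam 1| * Bd)
        (B' := |lam 2| * Bc + |-(lam 2 * g.epsHat)|), mean_const_mul,
        mean_add_const Q (B := |lam 2| * Bc), mean_const_mul] at h
      · linarith
      · intro i
        rw [abs_mul]; exact mul_le_mul_of_nonneg_left (hc i) (abs_nonneg _)
      · intro i
        rw [abs_mul]; exact mul_le_mul_of_nonneg_left (hd i) (abs_nonneg _)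
      · intro i
        refine (abs_add_le _ _).trans (add_le_add_left ?_ _)
        rw [abs_mul]; exact mul_le_mul_of_nonneg_left (hc i) (abs_nonneg _)
    · refine (abs_add_le _ _).trans (add_le_add ?_ ?_)
      · rw [abs_mul]; exact mul_le_mul_of_nonneg_left (hd i) (abs_nonneg _)
      · refine (abs_add_le _ _).trans (add_le_add_left ?_ _)
        rw [abs_mul]; exact mul_le_mul_of_nonneg_left (hc i) (abs_nonneg _)
    · have := hbest lam hlam i
      linarith

theorem maxIndex_spec (v : Fin 3 → ℝ) (k : Fin 3) : v k ≤ v (maxIndex v) := by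
  unfold maxIndex
  split_ifs with h1 h2
  · fin_cases k
    · exact le_rfl
    · exact h1.1
    · exact h1.2
  · fin_cases k
    · rw [not_and_or, not_le, not_le] at h1
      rcases h1 with h | h
      · exact h.le
      · exact h.le.trans h2
    · exact le_rfl
    · exact h2
  · rw [not_le] at h2
    fin_cases k
    · rw [not_and_or, not_le, not_le] at h1
      rcases h1 with h | h
      · exact h.le.trans h2.le
      · exact h.le
    · exact h2.le
    · exact le_rfl

theorem bestLam_value (hB : 0 ≤ g.Bl) (ξ : ℝ) (Q : PMF ι) :
    0 ≤ ∑ k, g.bestLam ξ Q k * g.con ξ Q k ∧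
      (∀ k, g.Bl * g.con ξ Q k ≤ ∑ k, g.bestLam ξ Q k * g.con ξ Q k) ∧
      (∀ k, 0 ≤ g.bestLam ξ Q k) ∧ ∑ k, g.bestLam ξ Q k ≤ g.Bl := by
  unfold bestLam
  split_ifs with h
  · refine ⟨by simp, fun k => ?_, by simp, by simpa using hB⟩
    simpa using mul_nonpos_of_nonneg_of_nonpos hB (h k)
  · have hs : ∑ k, (Pi.single (maxIndex (g.con ξ Q)) g.Bl : Fin 3 → ℝ) k * g.con ξ Q k =
        g.Bl * g.con ξ Q (maxIndex (g.con ξ Q)) := by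
      rw [Finset.sum_eq_single (maxIndex (g.con ξ Q))]
      · simp
      · intro b _ hb; simp [hb]
      · simp
    rw [hs]
    refine ⟨?_, fun k => mul_le_mul_of_nonneg_left (maxIndex_spec _ k) hB, fun k => ?_, ?_⟩
    · push Not at h
      obtain ⟨k, hk⟩ := h
      exact mul_nonneg hB (hk.le.trans (maxIndex_spec _ k))
    · by_cases hk : k = maxIndex (g.con ξ Q)
      · subst hk; simpa using hB
      · simp [hk]
    · simp

theorem sum_mul_con_le_bestLam (hB : 0 ≤ g.Bl) (ξ : ℝ) (Q : PMF ι) {lam : Fin 3 → ℝ}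
    (hlam : ∀ k, 0 ≤ lam k) (hsum : ∑ k, lam k ≤ g.Bl) :
    ∑ k, lam k * g.con ξ Q k ≤ ∑ k, g.bestLam ξ Q k * g.con ξ Q k := by
  obtain ⟨h0, h1, -, -⟩ := g.bestLam_value hB ξ Q
  set W := ∑ k, g.bestLam ξ Q k * g.con ξ Q k with hW
  rcases hB.eq_or_lt with hB0 | hB0
  · have : ∀ k, lam k = 0 := fun k => le_antisymm
      ((Finset.single_le_sum (fun k _ => hlam k) (Finset.mem_univ k)).trans (hsum.trans hB0.ge))
      (hlam k)
    simpa [this] using h0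
  · have h2 : ∀ k, g.con ξ Q k ≤ W / g.Bl := fun k => by
      rw [le_div_iff₀ hB0, mul_comm]; exact h1 k
    calc ∑ k, lam k * g.con ξ Q k ≤ ∑ k, lam k * (W / g.Bl) :=
          Finset.sum_le_sum fun k _ => mul_le_mul_of_nonneg_left (h2 k) (hlam k)
      _ = (∑ k, lam k) * (W / g.Bl) := by rw [Finset.sum_mul]
      _ ≤ g.Bl * (W / g.Bl) := mul_le_mul_of_nonneg_right hsum (div_nonneg h0 hB)
      _ = W := mul_div_cancel₀ W hB0.ne'

theorem lamOf_nonneg (hB : 0 ≤ g.Bl) (θ : Fin 3 → ℝ) (k : Fin 3) : 0 ≤ g.lamOf θ k :=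
  mul_nonneg hB (div_nonneg (Real.exp_pos _).le
    (add_nonneg zero_le_one (Finset.sum_nonneg fun _ _ => (Real.exp_pos _).le)))

theorem sum_lamOf_le (hB : 0 ≤ g.Bl) (θ : Fin 3 → ℝ) : ∑ k, g.lamOf θ k ≤ g.Bl := by
  have h : 0 ≤ ∑ k, Real.exp (θ k) := Finset.sum_nonneg fun _ _ => (Real.exp_pos _).le
  simp only [lamOf]
  rw [← Finset.mul_sum, ← Finset.sum_div]
  exact mul_le_of_le_one_right hB (div_le_one_of_le₀ (by linarith) (by linarith))

theorem lamHat_nonneg (hB : 0 ≤ g.Bl) (t : ℕ) (k : Fin 3) : 0 ≤ g.lamHat t k := by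
  simp only [lamHat, Pi.smul_apply, Finset.sum_apply, smul_eq_mul]
  exact mul_nonneg (by positivity) (Finset.sum_nonneg fun r _ => g.lamOf_nonneg hB _ k)

theorem sum_lamHat_le (hB : 0 ≤ g.Bl) (t : ℕ) : ∑ k, g.lamHat t k ≤ g.Bl := by
  simp only [lamHat, Pi.smul_apply, Finset.sum_apply, smul_eq_mul]
  rw [← Finset.mul_sum, Finset.sum_comm]
  have h : ∑ r ∈ Finset.range (t + 1), ∑ k, g.lam r k ≤ ∑ r ∈ Finset.range (t + 1), g.Bl :=
    Finset.sum_le_sum fun r _ => g.sum_lamOf_le hB _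
  rw [Finset.sum_const, Finset.card_range, nsmul_eq_mul] at h
  push_cast at h
  rw [one_div, inv_mul_le_iff₀ (by positivity)]
  exact h

theorem bestXi_mem (hBξ : 0 ≤ g.Bξ) (lam : Fin 3 → ℝ) : g.bestXi lam ∈ Icc 0 g.Bξ := by
  unfold bestXi
  split_ifs
  · exact ⟨hBξ, le_rfl⟩
  · exact ⟨le_rfl, hBξ⟩

theorem xiHat_mem (hBξ : 0 ≤ g.Bξ) (t : ℕ) : g.xiHat t ∈ Icc 0 g.Bξ := by
  unfold xiHat
  constructor
  · exact mul_nonneg (by positivity)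
      (Finset.sum_nonneg fun r _ => (g.bestXi_mem hBξ _).1)
  · have h : ∑ r ∈ Finset.range (t + 1), g.bestXi (g.lam r) ≤
        ∑ r ∈ Finset.range (t + 1), g.Bξ := Finset.sum_le_sum fun r _ => (g.bestXi_mem hBξ _).2
    rw [Finset.sum_const, Finset.card_range, nsmul_eq_mul] at h
    push_cast at h
    rw [one_div, inv_mul_le_iff₀ (by positivity)]
    exact h

/-- Constraint values in round `t + 1`. -/
noncomputable def roundCon (t : ℕ) : Fin 3 → ℝ :=
  g.con (g.bestXi (g.lam t)) (PMF.pure (g.bestH (g.lam t)))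

theorem mean_Qhat (t : ℕ) (f : ι → ℝ) :
    mean (g.Qhat t) f = (1 / ((t : ℝ) + 1)) * ∑ r ∈ Finset.range (t + 1), f (g.bestH (g.lam r)) := by
  have h : g.Qhat t = (PMF.uniformOfFintype (Fin (t + 1))).map
      fun r : Fin (t + 1) => g.bestH (g.lam r) :=
    PMF.map_comp (fun r : Fin (t + 1) => (r : ℕ)) (PMF.uniformOfFintype (Fin (t + 1)))
      fun r => g.bestH (g.lam r)
  rw [h, mean_map_uniform, Fin.sum_univ_eq_sum_range (fun r => f (g.bestH (g.lam r)))]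

theorem lagr_hat (t : ℕ) (lam : Fin 3 → ℝ) :
    g.lagr (g.xiHat t) (g.Qhat t) lam = (1 / ((t : ℝ) + 1)) * ∑ r ∈ Finset.range (t + 1),
      g.lagr (g.bestXi (g.lam r)) (PMF.pure (g.bestH (g.lam r))) lam := by
  have ht : (1 / ((t : ℝ) + 1)) * ∑ r ∈ Finset.range (t + 1), g.epsHat = g.epsHat := by
    rw [Finset.sum_const, Finset.card_range, nsmul_eq_mul]
    push_cast
    field_simp
  simp only [lagr_eq, mean_Qhat, mean_pure, xiHat]
  simp only [Finset.sum_add_distrib, ← Finset.mul_sum, ← Finset.sum_mul, Finset.sum_sub_distrib]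
  linear_combination lam 2 * ht

theorem sum_lagr_lamHat (t : ℕ) (ξ : ℝ) (Q : PMF ι) :
    g.lagr ξ Q (g.lamHat t) =
      (1 / ((t : ℝ) + 1)) * ∑ r ∈ Finset.range (t + 1), g.lagr ξ Q (g.lam r) := by
  have ht : (1 / ((t : ℝ) + 1)) * ∑ r ∈ Finset.range (t + 1), ξ = ξ := by
    rw [Finset.sum_const, Finset.card_range, nsmul_eq_mul]
    push_cast
    field_simp
  simp only [lagr]
  rw [Finset.sum_add_distrib, mul_add, ht]
  congr 1
  simp only [lamHat, Pi.smul_apply, Finset.sum_apply, smul_eq_mul]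
  rw [Finset.sum_comm, Finset.mul_sum]
  refine Finset.sum_congr rfl fun k _ => ?_
  rw [← Finset.sum_mul, mul_assoc]

/-- The explicit bound on the family makes the supremum `rho` meaningful, and later it limits the
number of rounds. -/
theorem abs_con_pure_le_rho {Bd Bc : ℝ} (hd : ∀ i, |g.disp i| ≤ Bd)
    (hc : ∀ i, |g.cost i - g.epsHat| ≤ Bc) {ξ : ℝ} (hξ : ξ ∈ Icc 0 g.Bξ) (i : ι) (k : Fin 3) :
    |g.con ξ (PMF.pure i) k| ≤ rho g.disp g.cost g.epsHat g.Bξ ∧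
      rho g.disp g.cost g.epsHat g.Bξ ≤ Bd + g.Bξ + Bc := by
  have hbd : ∀ p : ι × Icc (0 : ℝ) g.Bξ,
      ‖constraintVec g.disp g.cost g.epsHat p.2 (PMF.pure p.1)‖ ≤ Bd + g.Bξ + Bc := by
    rintro ⟨j, x, hx0, hx1⟩
    have h1 := abs_le.1 (hd j)
    have h2 := abs_le.1 (hc j)
    have h3 := (abs_nonneg _).trans (hd j)
    have h4 := (abs_nonneg _).trans (hc j)
    refine (pi_norm_le_iff_of_nonneg (by linarith)).2 fun k => ?_
    rw [Real.norm_eq_abs, abs_le]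
    fin_cases k <;> simp only [constraintVec, mean_pure] <;> simp <;> constructor <;> linarith
  have : Nonempty (ι × Icc (0 : ℝ) g.Bξ) := ⟨(i, ⟨ξ, hξ⟩)⟩
  refine ⟨?_, ciSup_le hbd⟩
  refine le_trans ?_ (le_ciSup (f := fun p : ι × Icc (0 : ℝ) g.Bξ =>
    ‖constraintVec g.disp g.cost g.epsHat p.2 (PMF.pure p.1)‖) ⟨_, forall_mem_range.2 hbd⟩
    (i, ⟨ξ, hξ⟩))
  exact norm_le_pi_norm (constraintVec g.disp g.cost g.epsHat ξ (PMF.pure i)) k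

/-- At `ξ = 0` and `ξ = B_ξ` the same constraint takes values differing by `B_ξ`, so one of them is
at least half of that in absolute value. This keeps `rho` away from zero in the learning rate. -/
theorem half_le_rho {Bd Bc : ℝ} (hd : ∀ i, |g.disp i| ≤ Bd)
    (hc : ∀ i, |g.cost i - g.epsHat| ≤ Bc) (hBξ : 0 ≤ g.Bξ) (i : ι) :
    g.Bξ / 2 ≤ rho g.disp g.cost g.epsHat g.Bξ := by
  have h0 := (abs_le.1 (g.abs_con_pure_le_rho hd hc (ξ := 0) ⟨le_rfl, hBξ⟩ i 0).1).2
  have h1 := (abs_le.1 (g.abs_con_pure_le_rho hd hc (ξ := g.Bξ) ⟨hBξ, le_rfl⟩ i 0).1).1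
  simp [con, constraintVec, mean_pure] at h0 h1
  linarith

/-- Gap of the averaged iterates after `t + 1` rounds. -/
theorem gap_le {g : AlgInput ι} (hbest : g.IsBestResponse) {Bd Bc : ℝ}
    (hd : ∀ i, |g.disp i| ≤ Bd) (hc : ∀ i, |g.cost i| ≤ Bc) (hBξ : 0 ≤ g.Bξ) (hB : 0 ≤ g.Bl)
    (hη : 0 < g.η) (hηρ : g.η * rho g.disp g.cost g.epsHat g.Bξ ≤ 1) (t : ℕ) :
    g.gap t ≤ g.Bl * (Real.log 4 / (g.η * (t + 1)) +
      g.η * rho g.disp g.cost g.epsHat g.Bξ ^ 2) := by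
  set ρ := rho g.disp g.cost g.epsHat g.Bξ with hρ
  have hc' : ∀ i, |g.cost i - g.epsHat| ≤ Bc + |g.epsHat| := fun i =>
    (abs_sub _ _).trans (add_le_add_left (hc i) _)
  obtain ⟨-, -, hb0, hb1⟩ := g.bestLam_value hB (g.xiHat t) (g.Qhat t)
  set lb := g.bestLam (g.xiHat t) (g.Qhat t) with hlb
  set lo := g.lagr (g.bestXi (g.lamHat t)) (PMF.pure (g.bestH (g.lamHat t))) (g.lamHat t) with hlo
  set hi := g.lagr (g.xiHat t) (g.Qhat t) lb with hhi
  set mid := g.lagr (g.xiHat t) (g.Qhat t) (g.lamHat t) with hmid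
  have h1 : lo ≤ mid := lagr_best_le hbest hd hc (g.lamHat_nonneg hB t)
    (g.xiHat_mem hBξ t).1 (g.xiHat_mem hBξ t).2 _
  have h2 : mid ≤ hi := by
    rw [hmid, hhi, lagr, lagr]
    exact add_le_add_right (g.sum_mul_con_le_bestLam hB _ _ (g.lamHat_nonneg hB t)
      (g.sum_lamHat_le hB t)) _
  have hT : (0 : ℝ) < (t : ℝ) + 1 := by positivity
  set A := (1 / ((t : ℝ) + 1)) * ∑ r ∈ Finset.range (t + 1),
      g.lagr (g.bestXi (g.lam r)) (PMF.pure (g.bestH (g.lam r))) (g.lam r) with hA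
  have h3 : A ≤ lo := by
    rw [hlo, sum_lagr_lamHat, hA]
    refine mul_le_mul_of_nonneg_left (Finset.sum_le_sum fun r _ => ?_) (by positivity)
    exact lagr_best_le hbest hd hc (g.lamOf_nonneg hB _) (g.bestXi_mem hBξ _).1
      (g.bestXi_mem hBξ _).2 _
  have h4 : hi - A ≤ g.Bl * (Real.log 4 / (g.η * (t + 1)) + g.η * ρ ^ 2) := by
    rcases hB.eq_or_lt with hB0 | hB0
    · have e1 : ∀ k, lb k = 0 := fun k => le_antisymm
        ((Finset.single_le_sum (fun k _ => hb0 k) (Finset.mem_univ k)).trans (hb1.trans hB0.ge))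
        (hb0 k)
      have e2 : ∀ r k, g.lam r k = 0 := fun r k => by simp [lam, lamOf, ← hB0]
      rw [← hB0, zero_mul, hhi, lagr_hat, hA]
      simp [lagr, e1, e2]
    -- The comparator is the best multiplier in hindsight, divided by `B_λ` to have mass at most
    -- one.
    have hreg := regret_le (η := g.η) (ρ := ρ) (v := g.roundCon) (θ := g.theta) rfl
      (fun _ => rfl) hη.le (fun r k => (g.abs_con_pure_le_rho hd hc' (g.bestXi_mem hBξ _) _ k).1)
      hηρ (t + 1) (q := fun k => lb k / g.Bl) (fun k => div_nonneg (hb0 k) hB)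
      (by rw [← Finset.sum_div]; exact div_le_one_of_le₀ hb1 hB)
    have e1 : hi - A = (1 / ((t : ℝ) + 1)) * (∑ k, lb k * ∑ r ∈ Finset.range (t + 1),
        g.roundCon r k - ∑ r ∈ Finset.range (t + 1), ∑ k, g.lam r k * g.roundCon r k) := by
      rw [hhi, lagr_hat, hA, ← mul_sub, ← Finset.sum_sub_distrib]
      simp only [Finset.mul_sum]
      rw [Finset.sum_comm, ← Finset.sum_sub_distrib, Finset.mul_sum]
      refine Finset.sum_congr rfl fun r _ => ?_
      simp only [lagr, roundCon]
      ring
    have e2 : ∑ k, lb k / g.Bl * ∑ r ∈ Finset.range (t + 1), g.roundCon r k =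
        (∑ k, lb k * ∑ r ∈ Finset.range (t + 1), g.roundCon r k) / g.Bl := by
      rw [Finset.sum_div]
      exact Finset.sum_congr rfl fun k _ => by ring
    have e3 : ∑ r ∈ Finset.range (t + 1), (g.η * ∑ k, (Real.exp (g.theta r k) /
        (1 + ∑ k', Real.exp (g.theta r k'))) * g.roundCon r k + (g.η * ρ) ^ 2) =
        g.η * (∑ r ∈ Finset.range (t + 1), ∑ k, g.lam r k * g.roundCon r k) / g.Bl +
          (t + 1) * (g.η * ρ) ^ 2 := by
      rw [Finset.sum_add_distrib, Finset.sum_const, Finset.card_range, nsmul_eq_mul]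
      push_cast
      congr 1
      rw [← Finset.mul_sum, mul_div_assoc]
      congr 1
      rw [Finset.sum_div]
      refine Finset.sum_congr rfl fun r _ => ?_
      rw [Finset.sum_div]
      refine Finset.sum_congr rfl fun k _ => ?_
      simp only [lam, lamOf]
      field_simp
    rw [e2, e3] at hreg
    rw [e1]
    set X := ∑ k, lb k * ∑ r ∈ Finset.range (t + 1), g.roundCon r k
    set Y := ∑ r ∈ Finset.range (t + 1), ∑ k, g.lam r k * g.roundCon r k
    have e4 : g.η * (X - Y) / g.Bl ≤ Real.log 4 + (t + 1) * (g.η * ρ) ^ 2 := by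
      have : g.η * (X - Y) / g.Bl = g.η * (X / g.Bl) - g.η * Y / g.Bl := by ring
      linarith
    rw [div_le_iff₀ hB0] at e4
    have e5 : (1 / ((t : ℝ) + 1)) * (X - Y) = g.η * (X - Y) * (1 / (g.η * (t + 1))) := by
      field_simp
    rw [e5]
    refine (mul_le_mul_of_nonneg_right e4 (by positivity)).trans (le_of_eq ?_)
    field_simp
  unfold gap
  refine max_le ?_ ?_ <;> simp only [← hlo, ← hmid, ← hlb, ← hhi] <;> linarith

/-- The learning rate makes the term `B_λ η ρ²` of `gap_le` equal to `ν/2`, and the logarithmic term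
falls below `ν/2` once the number of rounds reaches `x`. The condition `ν ≤ B_ξ B_λ`, with `ρ ≥
B_ξ/2`, gives the step size restriction `η ρ ≤ 1`. -/
theorem exists_stopsAt {g : AlgInput ι} (hbest : g.IsBestResponse) {Bd Bc : ℝ}
    (hd : ∀ i, |g.disp i| ≤ Bd) (hc : ∀ i, |g.cost i| ≤ Bc) (hBξ : 0 < g.Bξ) (hB : 0 < g.Bl)
    (hν : 0 < g.ν) (hνB : g.ν ≤ g.Bξ * g.Bl)
    (hη : g.η = g.ν / (2 * rho g.disp g.cost g.epsHat g.Bξ ^ 2 * g.Bl)) :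
    ∃ t, g.StopsAt t ∧ ((t + 1 : ℕ) : ℝ) ≤
      4 * Real.log 4 * rho g.disp g.cost g.epsHat g.Bξ ^ 2 * g.Bl ^ 2 / g.ν ^ 2 + 1 := by
  have hc' : ∀ i, |g.cost i - g.epsHat| ≤ Bc + |g.epsHat| := fun i =>
    (abs_sub _ _).trans (add_le_add_left (hc i) _)
  set ρ := rho g.disp g.cost g.epsHat g.Bξ with hρ
  have hρ0 : g.Bξ / 2 ≤ ρ := g.half_le_rho hd hc' hBξ.le (g.bestH 0)
  have hρ1 : 0 < ρ := by linarith
  have hη0 : 0 < g.η := by rw [hη]; positivity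
  have hηρ : g.η * ρ ≤ 1 := by
    rw [hη]
    have : g.ν / (2 * ρ ^ 2 * g.Bl) * ρ = g.ν / (2 * ρ * g.Bl) := by field_simp
    rw [this]
    refine div_le_one_of_le₀ ?_ (by positivity)
    nlinarith
  set x := 4 * Real.log 4 * ρ ^ 2 * g.Bl ^ 2 / g.ν ^ 2 with hx
  have hlog : 0 < Real.log 4 := Real.log_pos (by norm_num)
  have hx0 : 0 ≤ x := by positivity
  have hgap : g.gap ⌊x⌋₊ ≤ g.ν := by
    refine (gap_le hbest hd hc hBξ.le hB.le hη0 hηρ _).trans ?_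
    rw [← hρ]
    have hx1 : x ≤ (⌊x⌋₊ : ℝ) + 1 := (Nat.lt_floor_add_one x).le
    have h1 : g.Bl * (g.η * ρ ^ 2) = g.ν / 2 := by rw [hη]; field_simp
    have h2 : g.Bl * (Real.log 4 / (g.η * ((⌊x⌋₊ : ℝ) + 1))) ≤ g.ν / 2 := by
      have h3 : g.Bl * (Real.log 4 / (g.η * ((⌊x⌋₊ : ℝ) + 1))) =
          (x * (g.ν / 2)) / ((⌊x⌋₊ : ℝ) + 1) := by
        rw [hη, hx]; field_simp; ring
      rw [h3, div_le_iff₀ (by positivity), mul_comm]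
      exact mul_le_mul_of_nonneg_left hx1 (by positivity)
    rw [mul_add]
    linarith
  classical
  have hex : ∃ t, g.gap t ≤ g.ν := ⟨_, hgap⟩
  refine ⟨Nat.find hex, ⟨Nat.find_spec hex, fun r hr => not_le.1 (Nat.find_min hex hr)⟩, ?_⟩
  have h1 : ((Nat.find hex : ℕ) : ℝ) ≤ x :=
    (Nat.cast_le.2 (Nat.find_min' hex hgap)).trans (Nat.floor_le hx0)
  push_cast
  linarith

/-- With slack `ξ = |disp Q|` the competitor satisfies all three constraints, so its Lagrangian is
at most `|disp Q|`. Adding the two gains yields `ξ̂ + W ≤ |disp Q| + 2ν`, where `W` is the best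
multiplier's payoff. Since `W ≥ B_λ · con k`, this bounds each violation. -/
theorem abs_mean_disp_le {g : AlgInput ι} (hbest : g.IsBestResponse) {Bc : ℝ}
    (hd : ∀ i, |g.disp i| ≤ g.Bξ) (hc : ∀ i, |g.cost i| ≤ Bc) (hBξ : 0 ≤ g.Bξ) (hB : 1 ≤ g.Bl)
    {t : ℕ} (ht : g.gap t ≤ g.ν) {Q : PMF ι} (hQ : mean Q g.cost ≤ g.epsHat) :
    mean (g.Qhat t) g.cost ≤ g.epsHat + (g.Bξ + 2 * g.ν) / g.Bl ∧
      |mean (g.Qhat t) g.disp| ≤ |mean Q g.disp| + 2 * g.ν := by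
  have hB0 : 0 < g.Bl := by linarith
  obtain ⟨hb0, hb1, -, -⟩ := g.bestLam_value hB0.le (g.xiHat t) (g.Qhat t)
  obtain ⟨hg1, hg2⟩ := max_le_iff.1 (show max _ _ ≤ _ from ht)
  have hQd : |mean Q g.disp| ≤ g.Bξ := abs_mean_le Q hd
  have h1 := lagr_best_le hbest hd hc (g.lamHat_nonneg hB0.le t) (abs_nonneg (mean Q g.disp)) hQd Q
  have h2 : g.lagr |mean Q g.disp| Q (g.lamHat t) ≤ |mean Q g.disp| := by
    have hl := g.lamHat_nonneg hB0.le t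
    simp only [lagr, con, constraintVec, Fin.sum_univ_three, Matrix.cons_val_zero,
      Matrix.cons_val_one, Matrix.cons_val]
    have a0 := mul_nonneg (hl 0) (sub_nonneg.2 (le_abs_self (mean Q g.disp)))
    have a1 := mul_nonneg (hl 1) (sub_nonneg.2 (neg_le_abs (mean Q g.disp)))
    have a2 := mul_nonneg (hl 2) (sub_nonneg.2 hQ)
    nlinarith
  set W := ∑ k, g.bestLam (g.xiHat t) (g.Qhat t) k * g.con (g.xiHat t) (g.Qhat t) k with hW
  have h3 : g.xiHat t + W ≤ |mean Q g.disp| + 2 * g.ν := by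
    have : g.lagr (g.xiHat t) (g.Qhat t) (g.bestLam (g.xiHat t) (g.Qhat t)) = g.xiHat t + W := rfl
    linarith
  have hξ := g.xiHat_mem hBξ t
  have e0 : g.con (g.xiHat t) (g.Qhat t) 0 = mean (g.Qhat t) g.disp - g.xiHat t := rfl
  have e1 : g.con (g.xiHat t) (g.Qhat t) 1 = -mean (g.Qhat t) g.disp - g.xiHat t := rfl
  have e2 : g.con (g.xiHat t) (g.Qhat t) 2 = mean (g.Qhat t) g.cost - g.epsHat := rfl
  constructor
  · have := hb1 2
    rw [e2] at this
    have h4 : mean (g.Qhat t) g.cost - g.epsHat ≤ (g.Bξ + 2 * g.ν) / g.Bl := by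
      rw [le_div_iff₀ hB0]
      linarith [hξ.1]
    linarith
  -- Because `B_λ ≥ 1`, a positive violation is at most `B_λ` times itself. Comparing with `W`
  -- itself, and not with `B_ξ / B_λ`, leaves only the error `2ν`.
  · have hle : ∀ k, g.con (g.xiHat t) (g.Qhat t) k ≤ W := fun k => by
      rcases le_or_gt (g.con (g.xiHat t) (g.Qhat t) k) 0 with h | h
      · exact h.trans hb0
      · exact le_trans (by nlinarith) (hb1 k)
    have i0 := hle 0
    have i1 := hle 1
    rw [e0] at i0
    rw [e1] at i1
    rw [abs_le]
    constructor <;> linarith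

end AlgInput

/-! ### Averages over signs -/

/-- The sign encoded by a Boolean. -/
noncomputable def sgn (b : Bool) : ℝ := if b then 1 else -1

theorem abs_sgn (b : Bool) : |sgn b| = 1 := by cases b <;> simp [sgn]

section SupSum

variable {ι T : Type*} [Fintype ι]

/-- Supremum of the absolute signed sums `|∑ σᵢ aᵢ|` over a class. -/
noncomputable def supSum (a : T → ι → ℝ) : ℝ := ⨆ f, |∑ i, a f i|

theorem abs_sum_le_card {a : ι → ℝ} {c : ℝ} (h : ∀ i, |a i| ≤ c) :
    |∑ i, a i| ≤ Fintype.card ι * c := by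
  refine (Finset.abs_sum_le_sum_abs _ _).trans ((Finset.sum_le_sum fun i _ => h i).trans ?_)
  rw [Finset.sum_const, Finset.card_univ, nsmul_eq_mul]

theorem le_supSum {a : T → ι → ℝ} {c : ℝ} (h : ∀ f i, |a f i| ≤ c) (f : T) :
    |∑ i, a f i| ≤ supSum a :=
  le_ciSup (f := fun f => |∑ i, a f i|)
    ⟨_, forall_mem_range.2 fun f => abs_sum_le_card (h f)⟩ f

theorem supSum_nonneg (a : T → ι → ℝ) : 0 ≤ supSum a := Real.iSup_nonneg fun _ => abs_nonneg _

theorem supSum_le_card [Nonempty T] {a : T → ι → ℝ} {c : ℝ} (h : ∀ f i, |a f i| ≤ c) :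
    supSum a ≤ Fintype.card ι * c := ciSup_le fun f => abs_sum_le_card (h f)

theorem supSum_add_le [Nonempty T] {a b : T → ι → ℝ} {c c' : ℝ} (ha : ∀ f i, |a f i| ≤ c)
    (hb : ∀ f i, |b f i| ≤ c') : supSum (fun f i => a f i + b f i) ≤ supSum a + supSum b := by
  refine ciSup_le fun f => ?_
  rw [Finset.sum_add_distrib]
  exact (abs_add_le _ _).trans (add_le_add (le_supSum ha f) (le_supSum hb f))

theorem supSum_const_mul {c : ℝ} (hc : 0 ≤ c) (a : T → ι → ℝ) :
    supSum (fun f i => c * a f i) = c * supSum a := by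
  simp only [supSum, ← Finset.mul_sum, abs_mul, abs_of_nonneg hc]
  rw [Real.mul_iSup_of_nonneg hc]

end SupSum

section Signs

variable {ι κ : Type*} [Fintype ι] [DecidableEq ι] [Fintype κ] [DecidableEq κ]

/-- Expectation over independent uniform signs. -/
noncomputable def signAvg (G : (ι → Bool) → ℝ) : ℝ :=
  (1 / 2 ^ Fintype.card ι : ℝ) * ∑ σ, G σ

theorem signAvg_mono {G G' : (ι → Bool) → ℝ} (h : ∀ σ, G σ ≤ G' σ) : signAvg G ≤ signAvg G' :=
  mul_le_mul_of_nonneg_left (Finset.sum_le_sum fun σ _ => h σ) (by positivity)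

theorem signAvg_add (G G' : (ι → Bool) → ℝ) :
    signAvg (fun σ => G σ + G' σ) = signAvg G + signAvg G' := by
  rw [signAvg, Finset.sum_add_distrib, mul_add, signAvg, signAvg]

theorem signAvg_const_mul (c : ℝ) (G : (ι → Bool) → ℝ) :
    signAvg (fun σ => c * G σ) = c * signAvg G := by
  rw [signAvg, ← Finset.mul_sum, signAvg]
  ring

theorem signAvg_const (c : ℝ) : signAvg (fun _ : ι → Bool => c) = c := by
  rw [signAvg, Finset.sum_const, Finset.card_univ, Fintype.card_fun, Fintype.card_bool,
    nsmul_eq_mul]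
  push_cast
  field_simp

theorem signAvg_equiv (e : (ι → Bool) ≃ (ι → Bool)) (G : (ι → Bool) → ℝ) :
    signAvg (fun σ => G (e σ)) = signAvg G := by
  rw [signAvg, Equiv.sum_comp e, signAvg]

theorem signAvg_reindex (e : κ ≃ ι) (G : (ι → Bool) → ℝ) :
    signAvg (fun σ : κ → Bool => G fun i => σ (e.symm i)) = signAvg G := by
  rw [signAvg, signAvg, Fintype.card_congr e]
  congr 1
  exact Equiv.sum_comp (Equiv.arrowCongr e (Equiv.refl Bool)) G

theorem signAvg_succ {n : ℕ} (G : (Fin (n + 1) → Bool) → ℝ) :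
    signAvg G = (1 / 2) * (signAvg (fun σ : Fin n → Bool => G (Fin.cons true σ)) +
      signAvg (fun σ : Fin n → Bool => G (Fin.cons false σ))) := by
  simp only [signAvg, Fintype.card_fin]
  rw [← Equiv.sum_comp (Fin.consEquiv fun _ => Bool), Fintype.sum_prod_type, Fintype.sum_bool,
    pow_succ]
  simp only [Fin.consEquiv, Equiv.coe_fn_mk]
  field_simp

/-- After factoring out the midpoint, what remains is `cosh x ≤ exp (x² / 2)`. -/
theorem two_point_mgf_le {a b c : ℝ} (h : |a - b| ≤ 2 * c) :
    (1 / 2) * (Real.exp a + Real.exp b) ≤ Real.exp ((1 / 2) * (a + b) + c ^ 2 / 2) := by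
  have h1 : (1 / 2) * (Real.exp a + Real.exp b) =
      Real.exp ((1 / 2) * (a + b)) * Real.cosh ((a - b) / 2) := by
    have ha : a = (1 / 2) * (a + b) + (a - b) / 2 := by ring
    have hb : b = (1 / 2) * (a + b) + -((a - b) / 2) := by ring
    have ha' := congrArg Real.exp ha
    have hb' := congrArg Real.exp hb
    rw [Real.exp_add] at ha' hb'
    rw [Real.cosh_eq, ha', hb']
    ring
  rw [h1, Real.exp_add]
  refine mul_le_mul_of_nonneg_left ((Real.cosh_le_exp_half_sq _).trans ?_) (Real.exp_pos _).le
  rw [Real.exp_le_exp]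
  have h2 : ((a - b) / 2) ^ 2 ≤ c ^ 2 := by
    have := abs_le.1 h
    exact sq_le_sq' (by linarith) (by linarith)
  linarith

/-- Induction on the first sign: the averages over the remaining signs for its two values differ by
at most `2c`, so `two_point_mgf_le` adds one more `c² / 2`. -/
theorem signAvg_exp_le_fin (n : ℕ) {c : ℝ} (G : (Fin n → Bool) → ℝ)
    (hG : ∀ σ i b, |G (Function.update σ i b) - G σ| ≤ 2 * c) :
    signAvg (fun σ => Real.exp (G σ)) ≤ Real.exp (signAvg G + n * (c ^ 2 / 2)) := by
  induction n with
  | zero => simp [signAvg]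
  | succ n ih =>
    have hG' : ∀ b, signAvg (fun σ : Fin n → Bool => Real.exp (G (Fin.cons b σ))) ≤
        Real.exp (signAvg (fun σ : Fin n → Bool => G (Fin.cons b σ)) + n * (c ^ 2 / 2)) :=
      fun b => ih (fun σ => G (Fin.cons b σ)) fun σ i b' => by
        rw [Fin.cons_update]; exact hG _ _ _
    have hd : |signAvg (fun σ : Fin n → Bool => G (Fin.cons true σ)) -
        signAvg (fun σ : Fin n → Bool => G (Fin.cons false σ))| ≤ 2 * c := by
      have h1 : ∀ σ : Fin n → Bool, |G (Fin.cons true σ) - G (Fin.cons false σ)| ≤ 2 * c :=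
        fun σ => by
          have := hG (Fin.cons false σ) 0 true
          rwa [Fin.update_cons_zero] at this
      have h2 := signAvg_mono fun σ : Fin n → Bool =>
        (show G (Fin.cons true σ) ≤ G (Fin.cons false σ) + 2 * c by
          linarith [(abs_le.1 (h1 σ)).2])
      have h3 := signAvg_mono fun σ : Fin n → Bool =>
        (show G (Fin.cons false σ) ≤ G (Fin.cons true σ) + 2 * c by
          linarith [(abs_le.1 (h1 σ)).1])
      rw [signAvg_add, signAvg_const] at h2 h3
      rw [abs_le]
      constructor <;> linarith
    rw [signAvg_succ, signAvg_succ G]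
    refine (mul_le_mul_of_nonneg_left (add_le_add (hG' true) (hG' false)) (by norm_num)).trans ?_
    refine (two_point_mgf_le (c := c) (by simpa using hd)).trans ?_
    rw [Real.exp_le_exp]
    push_cast
    linarith

/-- Bounded differences bound for the moment generating function of a function of signs. -/
theorem signAvg_exp_le {c : ℝ} (G : (ι → Bool) → ℝ)
    (hG : ∀ σ i b, |G (Function.update σ i b) - G σ| ≤ 2 * c) :
    signAvg (fun σ => Real.exp (G σ)) ≤ Real.exp (signAvg G + Fintype.card ι * (c ^ 2 / 2)) := by
  have e := (Fintype.equivFin ι).symm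
  rw [← signAvg_reindex e, ← signAvg_reindex e G]
  refine signAvg_exp_le_fin _ (fun σ : Fin (Fintype.card ι) → Bool => G fun i => σ (e.symm i))
    fun σ i b => ?_
  have h : (fun j => Function.update σ i b (e.symm j)) =
      Function.update (fun j => σ (e.symm j)) (e i) b := by
    ext j
    simp only [Function.update_apply, Equiv.symm_apply_eq]
  rw [h]
  exact hG _ _ _

variable {T : Type*}

/-- Unnormalized Rademacher average of a class of vectors. -/
noncomputable def radAvg (a : T → ι → ℝ) : ℝ :=
  signAvg fun σ => supSum fun f i => sgn (σ i) * a f i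

theorem abs_sgn_mul (b : Bool) (x : ℝ) : |sgn b * x| = |x| := by rw [abs_mul, abs_sgn, one_mul]

theorem radAvg_add_le [Nonempty T] {a b : T → ι → ℝ} {c c' : ℝ} (ha : ∀ f i, |a f i| ≤ c)
    (hb : ∀ f i, |b f i| ≤ c') : radAvg (fun f i => a f i + b f i) ≤ radAvg a + radAvg b := by
  rw [radAvg, radAvg, radAvg, ← signAvg_add]
  refine signAvg_mono fun σ => ?_
  simp only [mul_add]
  exact supSum_add_le (c := c) (c' := c') (fun f i => by rw [abs_sgn_mul]; exact ha f i)
    (fun f i => by rw [abs_sgn_mul]; exact hb f i)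

theorem radAvg_const_mul {c : ℝ} (hc : 0 ≤ c) (a : T → ι → ℝ) :
    radAvg (fun f i => c * a f i) = c * radAvg a := by
  rw [radAvg, radAvg, ← signAvg_const_mul]
  simp only [← supSum_const_mul hc]
  congr! 5
  ring

/-- Changing signs does not change the Rademacher average. -/
theorem radAvg_sgn_mul (τ : ι → Bool) (a : T → ι → ℝ) :
    radAvg (fun f i => sgn (τ i) * a f i) = radAvg a := by
  have e : Function.Involutive fun (σ : ι → Bool) i => σ i == τ i := fun σ => by
    ext i; simp only; cases σ i <;> cases τ i <;> rfl
  rw [radAvg, radAvg, ← signAvg_equiv e.toPerm]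
  congr! 5 with σ f i
  rw [← mul_assoc]
  congr 1
  simp only [Function.Involutive.coe_toPerm]
  cases σ i <;> cases τ i <;> simp [sgn]

/-- Multiplication by coefficients in `[-1, 1]` does not increase the Rademacher average. -/
theorem radAvg_mul_le [Nonempty T] {a : T → ι → ℝ} {B : ℝ} (ha : ∀ f i, |a f i| ≤ B) {c : ι → ℝ}
    (hc : ∀ i, |c i| ≤ 1) : radAvg (fun f i => c i * a f i) ≤ radAvg a := by
  -- A convex function at a point of the cube is dominated by its value at some vertex, and at a
  -- vertex the coefficients are signs, which leave `radAvg` unchanged.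
  have hconv : ConvexOn ℝ univ fun c : ι → ℝ => radAvg fun f i => c i * a f i := by
    refine ⟨convex_univ, fun x _ y _ p q hp hq _ => ?_⟩
    have hb : ∀ z : ι → ℝ, ∀ f i, |z i * a f i| ≤ ‖z‖ * B := fun z f i => by
      rw [abs_mul]
      exact mul_le_mul (norm_le_pi_norm z i) (ha f i) (abs_nonneg _) (norm_nonneg _)
    have hb' : ∀ r : ℝ, ∀ z : ι → ℝ, ∀ f i, |r * (z i * a f i)| ≤ |r| * (‖z‖ * B) :=
      fun r z f i => by rw [abs_mul]; exact mul_le_mul_of_nonneg_left (hb z f i) (abs_nonneg _)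
    simp only [smul_eq_mul, Pi.add_apply, Pi.smul_apply]
    rw [← radAvg_const_mul hp, ← radAvg_const_mul hq]
    refine le_trans (le_of_eq ?_) (radAvg_add_le (hb' p x) (hb' q y))
    congr! 3
    ring
  have hmem : c ∈ convexHull ℝ (univ.pi fun _ : ι => ({-1, 1} : Set ℝ)) := by
    refine mem_convexHull_pi fun i _ => ?_
    rw [convexHull_pair, segment_eq_Icc (by norm_num)]
    exact abs_le.1 (hc i)
  obtain ⟨y, hy, hle⟩ := hconv.exists_ge_of_mem_convexHull (subset_univ _) hmem
  refine hle.trans (le_of_eq ?_)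
  have hy' : ∀ i, y i = sgn (decide (y i = 1)) := fun i => by
    rcases hy i (mem_univ i) with h | h
    · rw [h]; norm_num [sgn]
    · rw [mem_singleton_iff.1 h]; simp [sgn]
  rw [← radAvg_sgn_mul (fun i => decide (y i = 1)) a]
  refine congrArg radAvg (funext₂ fun f i => ?_)
  rw [← hy' i]

/-- Flipping one sign moves each signed sum, hence the supremum, by at most `2c`, so the bounded
differences bound applies. -/
theorem signAvg_exp_supSum_le [Nonempty T] {a : T → ι → ℝ} {c : ℝ} (ha : ∀ f i, |a f i| ≤ c) {lam : ℝ}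
    (hlam : 0 ≤ lam) :
    signAvg (fun σ => Real.exp (lam * supSum fun f i => sgn (σ i) * a f i)) ≤
      Real.exp (lam * radAvg a + Fintype.card ι * ((lam * c) ^ 2 / 2)) := by
  rw [radAvg, ← signAvg_const_mul]
  refine signAvg_exp_le _ fun σ j b => ?_
  have key : ∀ σ τ : ι → Bool, (∀ i ≠ j, σ i = τ i) →
      (supSum fun f i => sgn (σ i) * a f i) ≤ (supSum fun f i => sgn (τ i) * a f i) + 2 * c := by
    intro σ τ h
    refine ciSup_le fun f => ?_
    have h1 : ∑ i, sgn (σ i) * a f i =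
        ∑ i, sgn (τ i) * a f i + (sgn (σ j) * a f j - sgn (τ j) * a f j) := by
      rw [← sub_eq_iff_eq_add', ← Finset.sum_sub_distrib, Finset.sum_eq_single j]
      · intro i _ hi; rw [h i hi, sub_self]
      · simp
    rw [h1]
    have h2 : |∑ i, sgn (τ i) * a f i| ≤ supSum fun f i => sgn (τ i) * a f i :=
      le_supSum (a := fun f i => sgn (τ i) * a f i) (c := c)
        (fun f i => by rw [abs_sgn_mul]; exact ha f i) f
    have h3 := abs_sub (sgn (σ j) * a f j) (sgn (τ j) * a f j)
    rw [abs_sgn_mul, abs_sgn_mul] at h3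
    linarith [ha f j, abs_add_le (∑ i, sgn (τ i) * a f i) (sgn (σ j) * a f j - sgn (τ j) * a f j)]
  have k1 := key (Function.update σ j b) σ fun i hi => Function.update_of_ne hi _ _
  have k2 := key σ (Function.update σ j b) fun i hi => (Function.update_of_ne hi _ _).symm
  rw [← mul_sub, abs_mul, abs_of_nonneg hlam]
  have : |(supSum fun f i => sgn (Function.update σ j b i) * a f i) -
      supSum fun f i => sgn (σ i) * a f i| ≤ 2 * c := by
    rw [abs_le]; constructor <;> linarith
  linarith [mul_le_mul_of_nonneg_left this hlam]

end Signs

/-! ### Uniform convergence by symmetrization -/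

section Symmetrization

variable {Ω ι T : Type*} {g : T → Ω → ℝ}

theorem abs_ghost_le (hb : ∀ f ω, |g f ω| ≤ 1) (u : ι → Ω × Ω) (f : T) (i : ι) :
    |g f (u i).1 - g f (u i).2| ≤ 2 := by
  refine (abs_sub _ _).trans ?_
  linarith [hb f (u i).1, hb f (u i).2]

/-- Exchange of sample and ghost sample at the coordinates where `σ` is `false`. -/
def swapBy (σ : ι → Bool) (u : ι → Ω × Ω) : ι → Ω × Ω :=
  fun i => if σ i then u i else (u i).swap

variable [Fintype ι]

/-- Supremum over the class of the differences of the sums over a sample and a ghost sample. -/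
noncomputable def ghostSup (g : T → Ω → ℝ) (u : ι → Ω × Ω) : ℝ :=
  supSum fun f i => g f (u i).1 - g f (u i).2

theorem abs_ghostSup_le [Nonempty T] (hb : ∀ f ω, |g f ω| ≤ 1) (u : ι → Ω × Ω) :
    |ghostSup g u| ≤ Fintype.card ι * 2 := by
  rw [ghostSup, abs_of_nonneg (supSum_nonneg _)]
  exact supSum_le_card (abs_ghost_le hb u)

theorem integrable_exp_mul_of_bounded {α : Type*} [MeasurableSpace α] {μ : Measure α}
    [IsFiniteMeasure μ] {F : α → ℝ} (hF : AEMeasurable F μ) {B : ℝ} (hFB : ∀ x, |F x| ≤ B)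
    (lam : ℝ) : Integrable (fun x => Real.exp (lam * F x)) μ := by
  refine Integrable.of_bound (C := Real.exp (|lam| * B))
    (Real.measurable_exp.comp_aemeasurable (hF.const_mul lam)).aestronglyMeasurable
    (ae_of_all _ fun x => ?_)
  rw [Real.norm_eq_abs, Real.abs_exp, Real.exp_le_exp]
  refine (le_abs_self _).trans ?_
  rw [abs_mul]
  exact mul_le_mul_of_nonneg_left (hFB x) (abs_nonneg _)

theorem ghostSup_swapBy (σ : ι → Bool) (u : ι → Ω × Ω) :
    ghostSup g (swapBy σ u) = supSum fun f i => sgn (σ i) * (g f (u i).1 - g f (u i).2) := by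
  unfold ghostSup swapBy
  congr! 3 with f i
  cases σ i <;> simp [sgn]

variable [MeasurableSpace Ω] {P : Measure Ω} [IsProbabilityMeasure P]

theorem measurePreserving_swapBy (σ : ι → Bool) :
    MeasurePreserving (swapBy (Ω := Ω) σ) (Measure.pi fun _ => P.prod P)
      (Measure.pi fun _ => P.prod P) :=
  measurePreserving_pi (fun _ => P.prod P) (fun _ => P.prod P)
    (f := fun i (p : Ω × Ω) => if σ i then p else p.swap) fun i => by
      cases σ i
      · simpa using Measure.measurePreserving_swap
      · simpa using! MeasurePreserving.id (P.prod P)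

variable [DecidableEq ι] [Nonempty T]

/-- Symmetrization: swapping the entries of a pair preserves the product law, so the integrand may
be replaced by its average over signs. That average is bounded at every fixed double sample;
differences bounded by `2` give the term `2 k lam²`, with `k` the sample size. -/
theorem integral_exp_ghostSup_le (hb : ∀ f ω, |g f ω| ≤ 1)
    (hmeas : AEMeasurable (ghostSup (ι := ι) g) (Measure.pi fun _ => P.prod P)) {A : ℝ}
    (hrad : ∀ s : ι → Ω, radAvg (fun f i => g f (s i)) ≤ A) {lam : ℝ} (hlam : 0 ≤ lam) :
    ∫ u, Real.exp (lam * ghostSup g u) ∂(Measure.pi fun _ : ι => P.prod P) ≤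
      Real.exp (lam * (2 * A) + 2 * Fintype.card ι * lam ^ 2) := by
  set μ := Measure.pi fun _ : ι => P.prod P
  have hgb : ∀ u : ι → Ω × Ω, |ghostSup g u| ≤ Fintype.card ι * 2 := abs_ghostSup_le hb
  have hσ : ∀ σ : ι → Bool, ∫ u, Real.exp (lam * ghostSup g (swapBy σ u)) ∂μ =
      ∫ u, Real.exp (lam * ghostSup g u) ∂μ := fun σ => by
    have hp := measurePreserving_swapBy (P := P) σ
    have hi := (integrable_exp_mul_of_bounded hmeas hgb lam).aestronglyMeasurable
    have h := integral_map (f := fun u => Real.exp (lam * ghostSup g u))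
      hp.measurable.aemeasurable (by rw [hp.map_eq]; exact hi)
    rw [hp.map_eq] at h
    exact h.symm
  have hint : ∀ σ : ι → Bool,
      Integrable (fun u => Real.exp (lam * ghostSup g (swapBy σ u))) μ := fun σ =>
    integrable_exp_mul_of_bounded
      (hmeas.comp_quasiMeasurePreserving (measurePreserving_swapBy σ).quasiMeasurePreserving)
      (fun u => hgb _) lam
  have h1 : ∫ u, Real.exp (lam * ghostSup g u) ∂μ =
      ∫ u, signAvg (fun σ => Real.exp (lam * ghostSup g (swapBy σ u))) ∂μ := by
    simp only [signAvg]
    rw [integral_const_mul, integral_finsetSum _ fun σ _ => hint σ]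
    simp only [hσ]
    exact (signAvg_const _).symm
  rw [h1]
  have h2 : ∀ u : ι → Ω × Ω, signAvg (fun σ => Real.exp (lam * ghostSup g (swapBy σ u))) ≤
      Real.exp (lam * (2 * A) + 2 * Fintype.card ι * lam ^ 2) := fun u => by
    simp only [ghostSup_swapBy]
    refine (signAvg_exp_supSum_le (abs_ghost_le hb u) hlam).trans ?_
    rw [Real.exp_le_exp]
    have h3 : radAvg (fun f i => g f (u i).1 - g f (u i).2) ≤ 2 * A := by
      have h4 : radAvg (fun f i => -g f (u i).2) ≤ A := by
        rw [← radAvg_sgn_mul fun _ => false]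
        simpa [sgn] using hrad fun i => (u i).2
      have h5 := radAvg_add_le (a := fun f i => g f (u i).1) (b := fun f i => -g f (u i).2)
        (c := 1) (c' := 1) (fun f i => hb f _) (fun f i => by rw [abs_neg]; exact hb f _)
      simp only [← sub_eq_add_neg] at h5
      linarith [hrad fun i => (u i).1]
    have := mul_le_mul_of_nonneg_left h3 hlam
    nlinarith
  have h3 := integral_mono (μ := μ) (g := fun _ =>
    Real.exp (lam * (2 * A) + 2 * Fintype.card ι * lam ^ 2)) ?_ (integrable_const _) h2
  · simpa using h3
  · exact (integrable_finsetSum _ fun σ _ => hint σ).const_mul _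

/-- The expected deviation from a ghost sample dominates the deviation from the mean, and has
sub-Gaussian exponential moments. -/
theorem exists_deviation_bound (hg : ∀ f, Measurable (g f)) (hb : ∀ f ω, |g f ω| ≤ 1)
    (hmeas : AEMeasurable (ghostSup (ι := ι) g) (Measure.pi fun _ => P.prod P)) {A : ℝ}
    (hrad : ∀ s : ι → Ω, radAvg (fun f i => g f (s i)) ≤ A) :
    ∃ H : (ι → Ω) → ℝ, AEMeasurable H (Measure.pi fun _ => P) ∧
      (∀ s, |H s| ≤ Fintype.card ι * 2) ∧
      (∀ᵐ s ∂(Measure.pi fun _ => P), ∀ f,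
        |∑ i, g f (s i) - Fintype.card ι * ∫ ω, g f ω ∂P| ≤ H s) ∧
      ∀ lam : ℝ, 0 ≤ lam → ∫ s, Real.exp (lam * H s) ∂(Measure.pi fun _ => P) ≤
        Real.exp (lam * (2 * A) + 2 * Fintype.card ι * lam ^ 2) := by
  set μ := Measure.pi fun _ : ι => P with hμ
  set F : (ι → Ω) × (ι → Ω) → ℝ := fun p => ghostSup g fun i => (p.1 i, p.2 i) with hF
  have he := measurePreserving_arrowProdEquivProdArrow Ω Ω ι (fun _ => P) (fun _ => P)
  have hFb : ∀ p, |F p| ≤ Fintype.card ι * 2 := fun p => abs_ghostSup_le hb _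
  have hFm : AEMeasurable F (μ.prod μ) :=
    hmeas.comp_quasiMeasurePreserving (he.symm _).quasiMeasurePreserving
  have hFi : Integrable F (μ.prod μ) :=
    Integrable.of_bound hFm.aestronglyMeasurable _ (ae_of_all _ hFb)
  have hexp : ∀ lam, Integrable (fun p => Real.exp (lam * F p)) (μ.prod μ) :=
    integrable_exp_mul_of_bounded hFm hFb
  have hHb : ∀ s, |∫ s', F (s, s') ∂μ| ≤ Fintype.card ι * 2 := fun s => by
    have := norm_integral_le_of_norm_le_const (μ := μ) (f := fun s' => F (s, s'))
      (ae_of_all _ fun s' => hFb (s, s'))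
    simpa using this
  have hHm : AEMeasurable (fun s => ∫ s', F (s, s') ∂μ) μ :=
    hFi.aestronglyMeasurable.integral_prod_right'.aemeasurable
  -- Integrating out the ghost sample gives an a.e. measurable majorant; the supremum of deviations
  -- from the means is not assumed measurable.
  refine ⟨fun s => ∫ s', F (s, s') ∂μ, hHm, hHb, ?_, fun lam hlam => ?_⟩
  · filter_upwards [hFi.prod_right_ae] with s hs f
    have hgi' : ∀ i : ι, Integrable (fun s' : ι → Ω => g f (s' i)) μ := fun i =>
      Integrable.of_bound
        (((hg f).comp (measurable_pi_apply i)).aestronglyMeasurable (f := fun s' : ι → Ω => g f (s' i))) _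
        (ae_of_all _ fun s' => hb f (s' i))
    have h1 : ∀ i : ι, ∫ s' : ι → Ω, g f (s' i) ∂μ = ∫ ω, g f ω ∂P := fun i => by
      have hp := measurePreserving_eval (fun _ : ι => P) i
      conv_rhs => rw [← hp.map_eq]
      exact (integral_map hp.measurable.aemeasurable (hg f).aestronglyMeasurable).symm
    have h2 : ∑ i, g f (s i) - Fintype.card ι * ∫ ω, g f ω ∂P =
        ∫ s', ∑ i, (g f (s i) - g f (s' i)) ∂μ := by
      rw [integral_finsetSum (f := fun i (s' : ι → Ω) => g f (s i) - g f (s' i)) _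
        fun i _ => (integrable_const _).sub (hgi' i)]
      have h3 : ∀ i, ∫ s', (g f (s i) - g f (s' i)) ∂μ = g f (s i) - ∫ ω, g f ω ∂P := fun i => by
        rw [integral_sub (integrable_const _) (hgi' i), h1 i]
        simp
      simp only [h3]
      rw [Finset.sum_sub_distrib, Finset.sum_const, Finset.card_univ, nsmul_eq_mul]
    rw [h2]
    refine abs_integral_le_integral_abs.trans (integral_mono_of_nonneg
      (ae_of_all _ fun _ => abs_nonneg _) hs (ae_of_all _ fun s' => ?_))
    exact le_supSum (abs_ghost_le hb fun i => (s i, s' i)) f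
  -- Jensen's inequality for the exponential moves the ghost integral outside, leaving the moment
  -- over the double sample.
  · have h1 : ∀ᵐ s ∂μ, Real.exp (lam * ∫ s', F (s, s') ∂μ) ≤
        ∫ s', Real.exp (lam * F (s, s')) ∂μ := by
      filter_upwards [hFi.prod_right_ae, (hexp lam).prod_right_ae] with s hs hs'
      rw [← integral_const_mul]
      exact convexOn_exp.map_integral_le Real.continuous_exp.continuousOn isClosed_univ
        (ae_of_all _ fun _ => mem_univ _) (hs.const_mul lam) hs'
    have h2 := integral_mono_ae
      (integrable_exp_mul_of_bounded hHm hHb lam) (hexp lam).integral_prod_left h1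
    refine h2.trans ?_
    rw [← integral_prod _ (hexp lam)]
    refine le_trans (le_of_eq ?_) (integral_exp_ghostSup_le hb hmeas hrad hlam)
    exact (he.integral_comp' fun p => Real.exp (lam * F p)).symm

/-- Uniform deviation bound for averages over a finite family of classes. -/
theorem uniform_deviation [Nonempty ι] {κ : Type*} {J : Finset κ} (hJ : J.Nonempty)
    {g : κ → T → Ω → ℝ} (hg : ∀ j f, Measurable (g j f)) (hb : ∀ j f ω, |g j f ω| ≤ 1)
    (hmeas : ∀ j ∈ J, AEMeasurable (ghostSup (ι := ι) (g j)) (Measure.pi fun _ => P.prod P)) {A : ℝ}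
    (hrad : ∀ j ∈ J, ∀ s : ι → Ω, radAvg (fun f i => g j f (s i)) ≤ A) {τ : ℝ} (hτ : 0 ≤ τ) :
    (Measure.pi fun _ : ι => P) {s | ¬ ∀ f,
      |∑ i, (1 / (J.card : ℝ)) * ∑ j ∈ J, g j f (s i) -
        Fintype.card ι * ((1 / (J.card : ℝ)) * ∑ j ∈ J, ∫ ω, g j f ω ∂P)| ≤ 2 * A + τ} ≤
      ENNReal.ofReal (Real.exp (-τ ^ 2 / (8 * Fintype.card ι))) := by
  have hex : ∀ j : J, ∃ H : (ι → Ω) → ℝ, AEMeasurable H (Measure.pi fun _ => P) ∧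
      (∀ s, |H s| ≤ Fintype.card ι * 2) ∧
      (∀ᵐ s ∂(Measure.pi fun _ => P), ∀ f,
        |∑ i, g j f (s i) - Fintype.card ι * ∫ ω, g j f ω ∂P| ≤ H s) ∧
      ∀ lam : ℝ, 0 ≤ lam → ∫ s, Real.exp (lam * H s) ∂(Measure.pi fun _ => P) ≤
        Real.exp (lam * (2 * A) + 2 * Fintype.card ι * lam ^ 2) := fun j =>
    exists_deviation_bound (hg j) (hb j) (hmeas j j.2) (hrad j j.2)
  choose H hHm hHb hHd hHe using hex
  set μ := Measure.pi fun _ : ι => P with hμ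
  have hc : (0 : ℝ) < J.card := by exact_mod_cast hJ.card_pos
  set w : ℝ := 1 / (J.card : ℝ) with hw
  have hw0 : 0 ≤ w := by positivity
  have hw1 : ∑ j : J, w = 1 := by
    rw [Finset.sum_const, Finset.card_univ, Fintype.card_coe, nsmul_eq_mul, hw]
    field_simp
  set Hm : (ι → Ω) → ℝ := fun s => ∑ j : J, w * H j s with hHm'
  have hm : AEMeasurable Hm μ := Finset.aemeasurable_fun_sum _ fun j _ => (hHm j).const_mul w
  have hbd : ∀ s, |Hm s| ≤ Fintype.card ι * 2 := fun s => by
    refine (Finset.abs_sum_le_sum_abs _ _).trans ?_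
    calc ∑ j : J, |w * H j s| ≤ ∑ j : J, w * (Fintype.card ι * 2) :=
          Finset.sum_le_sum fun j _ => by
            rw [abs_mul, abs_of_nonneg hw0]
            exact mul_le_mul_of_nonneg_left (hHb j s) hw0
      _ = Fintype.card ι * 2 := by rw [← Finset.sum_mul, hw1, one_mul]
  have hk : (0 : ℝ) < Fintype.card ι := by exact_mod_cast Fintype.card_pos
  -- With `k = card ι`, this minimizes the Chernoff exponent `-lam τ + 2 k lam²`; the value is `-τ²
  -- / (8k)`.
  set lam := τ / (4 * Fintype.card ι) with hlam
  have hlam0 : 0 ≤ lam := by positivity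
  have hmgf : ∫ s, Real.exp (lam * Hm s) ∂μ ≤
      Real.exp (lam * (2 * A) + 2 * Fintype.card ι * lam ^ 2) := by
    -- Convexity replaces a union bound over `J`: the averaged majorant has the same exponential
    -- moment bound as each single one, so the size of `J` does not enter.
    have h1 : ∀ s, Real.exp (lam * Hm s) ≤ ∑ j : J, w * Real.exp (lam * H j s) := fun s => by
      have := convexOn_exp.map_sum_le (t := Finset.univ) (w := fun _ : J => w)
        (p := fun j => lam * H j s) (fun _ _ => hw0) hw1 fun _ _ => mem_univ _
      simp only [smul_eq_mul] at this
      refine le_trans (le_of_eq ?_) this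
      rw [hHm', Finset.mul_sum]
      exact congrArg _ (Finset.sum_congr rfl fun j _ => by ring)
    have hi : ∀ j ∈ (Finset.univ : Finset J),
        Integrable (fun s => w * Real.exp (lam * H j s)) μ := fun j _ =>
      (integrable_exp_mul_of_bounded (hHm j) (hHb j) lam).const_mul w
    refine (integral_mono (integrable_exp_mul_of_bounded hm hbd lam)
      (integrable_finsetSum _ hi) h1).trans ?_
    rw [integral_finsetSum _ hi]
    calc ∑ j : J, ∫ s, w * Real.exp (lam * H j s) ∂μ
        ≤ ∑ j : J, w * Real.exp (lam * (2 * A) + 2 * Fintype.card ι * lam ^ 2) :=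
          Finset.sum_le_sum fun j _ => by
            rw [integral_const_mul]
            exact mul_le_mul_of_nonneg_left (hHe j lam hlam0) hw0
      _ = _ := by rw [← Finset.sum_mul, hw1, one_mul]
  have htail : μ.real {s | 2 * A + τ ≤ Hm s} ≤ Real.exp (-τ ^ 2 / (8 * Fintype.card ι)) := by
    refine (ProbabilityTheory.measure_ge_le_exp_mul_mgf (2 * A + τ) hlam0
      (integrable_exp_mul_of_bounded hm hbd lam)).trans ?_
    refine (mul_le_mul_of_nonneg_left hmgf (Real.exp_pos _).le).trans (le_of_eq ?_)
    rw [← Real.exp_add, hlam]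
    congr 1
    field_simp
    ring
  have hsub : ∀ᵐ s ∂μ, (¬ ∀ f, |∑ i, w * ∑ j ∈ J, g j f (s i) -
        Fintype.card ι * (w * ∑ j ∈ J, ∫ ω, g j f ω ∂P)| ≤ 2 * A + τ) → 2 * A + τ ≤ Hm s := by
    filter_upwards [ae_all_iff.2 hHd] with s hs hn
    push Not at hn
    obtain ⟨f, hf⟩ := hn
    refine hf.le.trans ?_
    have h1 : ∑ i, w * ∑ j ∈ J, g j f (s i) -
        Fintype.card ι * (w * ∑ j ∈ J, ∫ ω, g j f ω ∂P) =
        ∑ j : J, w * (∑ i, g j f (s i) - Fintype.card ι * ∫ ω, g j f ω ∂P) := by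
      rw [← Finset.mul_sum, Finset.sum_comm, ← Finset.mul_sum, Finset.sum_sub_distrib,
        ← Finset.mul_sum, Finset.sum_coe_sort J fun j => ∑ i, g j f (s i),
        Finset.sum_coe_sort J fun j => ∫ ω, g j f ω ∂P]
      ring
    rw [h1]
    refine (Finset.abs_sum_le_sum_abs _ _).trans (Finset.sum_le_sum fun j _ => ?_)
    rw [abs_mul, abs_of_nonneg hw0]
    exact mul_le_mul_of_nonneg_left (hs j f) hw0
  calc μ {s | ¬ ∀ f, |∑ i, w * ∑ j ∈ J, g j f (s i) -
        Fintype.card ι * (w * ∑ j ∈ J, ∫ ω, g j f ω ∂P)| ≤ 2 * A + τ}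
      ≤ μ {s | 2 * A + τ ≤ Hm s} := measure_mono_ae hsub
    _ = ENNReal.ofReal (μ.real {s | 2 * A + τ ≤ Hm s}) := (ofReal_measureReal).symm
    _ ≤ _ := ENNReal.ofReal_le_ofReal htail

end Symmetrization

/-! ### Product measures and conditioning -/

section Conditioning

variable {Ω ι : Type*} [MeasurableSpace Ω] [Fintype ι] {P : Measure Ω} [IsProbabilityMeasure P]

theorem pi_cond {E : Set Ω} (hE : MeasurableSet E) (hP : P E ≠ 0) :
    (Measure.pi fun _ : ι => ProbabilityTheory.cond P E) =
      ProbabilityTheory.cond (Measure.pi fun _ : ι => P) (univ.pi fun _ => E) := by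
  have := ProbabilityTheory.cond_isProbabilityMeasure hP
  refine Measure.pi_eq fun s _ => ?_
  have hbox : MeasurableSet (univ.pi fun _ : ι => E) := MeasurableSet.univ_pi fun _ => hE
  rw [ProbabilityTheory.cond_apply hbox, ← pi_inter_distrib, Measure.pi_pi, Measure.pi_pi]
  simp only [ProbabilityTheory.cond_apply hE]
  rw [Finset.prod_mul_distrib, ENNReal.prod_inv_distrib]
  intro i _ j _ _
  exact Or.inl hP

theorem pi_inter_box_le {E : Set Ω} (hE : MeasurableSet E) (hP : P E ≠ 0)
    {B : Set (ι → Ω)} {q : ENNReal}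
    (hq : (Measure.pi fun _ : ι => ProbabilityTheory.cond P E) B ≤ q) :
    (Measure.pi fun _ : ι => P) ((univ.pi fun _ => E) ∩ B) ≤
      (Measure.pi fun _ : ι => P) (univ.pi fun _ => E) * q := by
  have hbox : MeasurableSet (univ.pi fun _ : ι => E) := MeasurableSet.univ_pi fun _ => hE
  rw [pi_cond hE hP] at hq
  rw [← ProbabilityTheory.cond_mul_eq_inter hbox, mul_comm]
  gcongr

open Classical in
/-- Coordinates of a sample that lie in `E`. -/
noncomputable def hits (E : Set Ω) (s : ι → Ω) : Finset ι := Finset.univ.filter fun i => s i ∈ E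

/-- An event about the subsample falling in `E` that is unlikely under the conditional law for
every possible set of coordinates of the subsample is unlikely. -/
theorem measure_subsample_le {E : Set Ω} (hE : MeasurableSet E) (hP : P E ≠ 0)
    (B : ∀ I : Finset ι, Set (I → Ω)) {q : ENNReal}
    (hq : ∀ I : Finset ι, (Measure.pi fun _ : I => ProbabilityTheory.cond P E) (B I) ≤ q) :
    (Measure.pi fun _ : ι => P) {s | (fun i : hits E s => s i) ∈ B (hits E s)} ≤ q := by
  classical
  set μ := Measure.pi fun _ : ι => P with hμ
  have hpat : ∀ I : Finset ι, MeasurableSet {s : ι → Ω | hits E s = I} := fun I => by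
    have : {s : ι → Ω | hits E s = I} = ⋂ i, {s | s i ∈ E ↔ i ∈ I} := by
      ext s
      simp [hits, Finset.ext_iff]
    rw [this]
    refine MeasurableSet.iInter fun i => ?_
    have hm : MeasurableSet {s : ι → Ω | s i ∈ E} := measurable_pi_apply i hE
    by_cases hi : i ∈ I
    · simpa only [hi, iff_true] using hm
    · simpa only [hi, iff_false] using! hm.compl
  have key : ∀ I : Finset ι, μ ({s | hits E s = I} ∩ {s | (fun i : I => s i) ∈ B I}) ≤
      μ {s | hits E s = I} * q := fun I => by
    have hmp := measurePreserving_piEquivPiSubtypeProd (fun _ : ι => P) (· ∈ I)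
    set C : Set ({i // i ∉ I} → Ω) := univ.pi fun _ => Eᶜ with hC
    set D : Set (I → Ω) := univ.pi fun _ => E with hD
    have hCm : MeasurableSet C := MeasurableSet.univ_pi fun _ => hE.compl
    have hDm : MeasurableSet D := MeasurableSet.univ_pi fun _ => hE
    -- A fixed hit pattern is a box: coordinates in `I` lie in `E`, the others in its complement.
    -- The two blocks are independent, so only the block indexed by `I` needs conditioning.
    have h1 : {s | hits E s = I} =
        MeasurableEquiv.piEquivPiSubtypeProd (fun _ => Ω) (· ∈ I) ⁻¹' (D ×ˢ C) := by
      ext s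
      simp only [hits, Finset.ext_iff, Finset.mem_filter, Finset.mem_univ, true_and, mem_ofPred_eq,
        mem_preimage, mem_prod, hD, hC, mem_univ_pi, mem_compl_iff, Subtype.forall]
      constructor
      · intro h
        exact ⟨fun i hi => (h i).2 hi, fun i hi hs => hi ((h i).1 hs)⟩
      · rintro ⟨h, h'⟩ i
        exact ⟨fun hs => by_contra fun hi => h' i hi hs, fun hi => h i hi⟩
    -- `B I` need not be measurable; its measurable hull has the same conditional measure.
    have h2 : {s | hits E s = I} ∩ {s | (fun i : I => s i) ∈ B I} ⊆
        MeasurableEquiv.piEquivPiSubtypeProd (fun _ => Ω) (· ∈ I) ⁻¹'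
          ((D ∩ toMeasurable (Measure.pi fun _ : I => ProbabilityTheory.cond P E) (B I)) ×ˢ C) := by
      rintro s ⟨hs, hs'⟩
      rw [h1] at hs
      exact ⟨⟨hs.1, subset_toMeasurable _ _ hs'⟩, hs.2⟩
    refine (measure_mono h2).trans ?_
    rw [h1, hmp.measure_preimage_equiv, hmp.measure_preimage_equiv, Measure.prod_prod,
      Measure.prod_prod]
    have h3 := pi_inter_box_le (ι := I) hE hP
      (B := toMeasurable (Measure.pi fun _ : I => ProbabilityTheory.cond P E) (B I)) (q := q)
      (by rw [measure_toMeasurable]; exact hq I)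
    rw [mul_right_comm]
    refine mul_le_mul' ?_ le_rfl
    convert h3
    rfl
  have hsub : {s : ι → Ω | (fun i : hits E s => s i) ∈ B (hits E s)} ⊆
      ⋃ I ∈ (Finset.univ : Finset (Finset ι)),
        ({s | hits E s = I} ∩ {s | (fun i : I => s i) ∈ B I}) := by
    intro s hs
    simp only [Finset.mem_univ, iUnion_true, mem_iUnion]
    exact ⟨hits E s, rfl, hs⟩
  have htot : ∑ I : Finset ι, μ {s | hits E s = I} = 1 := by
    have := sum_measure_preimage_singleton (μ := μ) (Finset.univ : Finset (Finset ι))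
      (f := hits E) fun I _ => hpat I
    simpa [preimage] using! this
  calc _ ≤ _ := measure_mono hsub
    _ ≤ _ := measure_biUnion_finset_le _ _
    _ ≤ ∑ I : Finset ι, μ {s | hits E s = I} * q := Finset.sum_le_sum fun I _ => key I
    _ = q := by rw [← Finset.sum_mul, htot, one_mul]

end Conditioning

/-! ### Hoeffding's inequality for sample means -/

theorem measure_sum_sub_mean_gt_le {Ω ι : Type*} [MeasurableSpace Ω] [Fintype ι] {P : Measure Ω}
    [IsProbabilityMeasure P] {h : Ω → ℝ} (hm : Measurable h) (h01 : ∀ ω, h ω ∈ Icc (0 : ℝ) 1)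
    {τ : ℝ} (hτ : 0 ≤ τ) :
    (Measure.pi fun _ : ι => P) {s | ¬ |∑ i, h (s i) - Fintype.card ι * ∫ ω, h ω ∂P| ≤ τ} ≤
      ENNReal.ofReal (2 * Real.exp (-2 * τ ^ 2 / Fintype.card ι)) := by
  set μ := Measure.pi fun _ : ι => P with hμ
  have tail : ∀ (k : Ω → ℝ) (a b : ℝ), Measurable k → (∀ ω, k ω ∈ Icc a b) → b - a = 1 →
      μ.real {s | τ ≤ ∑ i, (k (s i) - ∫ ω, k ω ∂P)} ≤ Real.exp (-2 * τ ^ 2 / Fintype.card ι) := by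
    intro k a b hk hkab hba
    have hind : ProbabilityTheory.iIndepFun (fun (i : ι) (s : ι → Ω) => k (s i) - ∫ ω, k ω ∂P) μ :=
      ProbabilityTheory.iIndepFun_pi (X := fun _ ω => k ω - ∫ ω, k ω ∂P)
        fun i => (hk.sub_const _).aemeasurable
    have hsub : ∀ i ∈ (Finset.univ : Finset ι), ProbabilityTheory.HasSubgaussianMGF
        (fun s : ι → Ω => k (s i) - ∫ ω, k ω ∂P) ((‖b - a‖₊ / 2) ^ 2) μ := fun i _ => by
      have hp := measurePreserving_eval (fun _ : ι => P) i
      have h1 := ProbabilityTheory.hasSubgaussianMGF_of_mem_Icc (μ := μ) (a := a) (b := b)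
        (X := fun s : ι → Ω => k (s i)) (hk.comp (measurable_pi_apply i)).aemeasurable
        (ae_of_all _ fun s => hkab (s i))
      have h2 : ∫ s : ι → Ω, k (s i) ∂μ = ∫ ω, k ω ∂P := by
        conv_rhs => rw [← hp.map_eq]
        exact (integral_map hp.measurable.aemeasurable hk.aestronglyMeasurable).symm
      rwa [h2] at h1
    have := ProbabilityTheory.HasSubgaussianMGF.measure_sum_ge_le_of_iIndepFun hind hsub hτ
    refine this.trans (le_of_eq ?_)
    rw [hba]
    simp only [nnnorm_one, Finset.sum_const, Finset.card_univ, nsmul_eq_mul]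
    push_cast
    congr 1
    -- For an empty sample both exponents are `0`, as quotients by zero.
    rcases eq_or_ne (Fintype.card ι : ℝ) 0 with h0 | h0
    · simp [h0]
    · field_simp
  have t1 := tail h 0 1 hm h01 (by norm_num)
  have t2 := tail (fun ω => -h ω) (-1) 0 hm.neg
    (fun ω => ⟨by linarith [(h01 ω).2], by linarith [(h01 ω).1]⟩) (by norm_num)
  have hsub : {s : ι → Ω | ¬ |∑ i, h (s i) - Fintype.card ι * ∫ ω, h ω ∂P| ≤ τ} ⊆
      {s | τ ≤ ∑ i, (h (s i) - ∫ ω, h ω ∂P)} ∪ {s | τ ≤ ∑ i, (-h (s i) - ∫ ω, -h ω ∂P)} := by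
    intro s hs
    simp only [mem_ofPred_eq, not_le, lt_abs] at hs
    simp only [mem_union, mem_ofPred_eq, Finset.sum_sub_distrib, Finset.sum_neg_distrib,
      Finset.sum_const, Finset.card_univ, nsmul_eq_mul, integral_neg]
    rcases hs with hs | hs
    · left; linarith
    · right; linarith
  calc μ _ ≤ _ := measure_mono hsub
    _ ≤ _ := measure_union_le _ _
    _ = ENNReal.ofReal (μ.real {s | τ ≤ ∑ i, (h (s i) - ∫ ω, h ω ∂P)}) +
        ENNReal.ofReal (μ.real {s | τ ≤ ∑ i, (-h (s i) - ∫ ω, -h ω ∂P)}) := by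
      rw [ofReal_measureReal, ofReal_measureReal]
    _ ≤ ENNReal.ofReal (Real.exp (-2 * τ ^ 2 / Fintype.card ι)) +
        ENNReal.ofReal (Real.exp (-2 * τ ^ 2 / Fintype.card ι)) :=
      add_le_add (ENNReal.ofReal_le_ofReal t1) (ENNReal.ofReal_le_ofReal t2)
    _ = _ := by rw [← ENNReal.ofReal_add (Real.exp_pos _).le (Real.exp_pos _).le, two_mul]

/-- A ghost difference is a signed sum over the doubled sample, with coefficient `1` on one copy and
`-1` on the other. -/
theorem aemeasurable_ghostSup {Ω ι T : Type*} [MeasurableSpace Ω] {P : Measure Ω}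
    [IsProbabilityMeasure P] [Fintype ι] {g : T → Ω → ℝ}
    (h : AEMeasurable (fun v : ι ⊕ ι → Ω => supSum fun f j =>
      (Sum.elim (fun _ => 1) (fun _ => -1) j : ℝ) * g f (v j)) (Measure.pi fun _ => P)) :
    AEMeasurable (ghostSup (ι := ι) g) (Measure.pi fun _ => P.prod P) := by
  have h1 := measurePreserving_arrowProdEquivProdArrow Ω Ω ι (fun _ => P) (fun _ => P)
  have h2 := measurePreserving_sumPiEquivProdPi_symm (X := fun _ : ι ⊕ ι => Ω) (fun _ => P)
  have h3 := h.comp_quasiMeasurePreserving (h2.comp h1).quasiMeasurePreserving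
  refine h3.congr (ae_of_all _ fun u => ?_)
  simp only [Function.comp_apply, ghostSup, supSum, Fintype.sum_sum_type, Sum.elim_inl,
    Sum.elim_inr, one_mul, neg_one_mul, sub_eq_add_neg, Finset.sum_add_distrib]
  rfl

namespace Setting

variable {𝒳 : Type u} [MeasurableSpace 𝒳] (S : Setting 𝒳)

/-! ### Threshold classifiers -/

theorem abs_thr_le_one (f : S.predictors) (x : 𝒳) (z : ℝ) : |S.thr f x z| ≤ 1 := by
  unfold thr
  split_ifs <;> simp

theorem measurable_thr (f : S.predictors) (z : ℝ) :
    Measurable fun o : S.Obs => S.thr f o.1 z := by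
  have hf : Measurable fun o : S.Obs => (f.1 o.1 : ℝ) :=
    measurable_subtype_coe.comp ((S.predictors_measurable f.1 f.2).comp measurable_fst)
  exact Measurable.ite (measurableSet_le measurable_const hf) measurable_const measurable_const

/-- `SupMeasurable` concerns constant coefficients. A weight with finite range cuts the sample space
into finitely many measurable cells on which it is constant and can be absorbed into `c`. -/
theorem aemeasurable_supSum {S : Setting 𝒳} (hS : S.SupMeasurable) {κ : Type*} [Fintype κ]
    (z : unitInterval) (c : κ → ℝ) {w : S.Obs → ℝ} (hw : Measurable w) (hfin : (range w).Finite) :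
    AEMeasurable (fun v : κ → S.Obs => supSum fun (f : S.predictors) j =>
      c j * (w (v j) * S.thr f (v j).1 z)) (Measure.pi fun _ => S.law) := by
  have := S.law_prob
  have : Finite (range w) := hfin
  set e := Fintype.equivFin κ with he
  have hmp : MeasurePreserving (fun (v : κ → S.Obs) i => (v (e.symm i)).1)
      (Measure.pi fun _ => S.law) (Measure.pi fun _ => S.law.map Prod.fst) := by
    have : IsProbabilityMeasure (S.law.map Prod.fst) :=
      Measure.isProbabilityMeasure_map measurable_fst.aemeasurable
    have h1 := measurePreserving_arrowCongr' (fun _ : κ => S.law)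
      (fun _ : Fin (Fintype.card κ) => S.law) e (MeasurableEquiv.refl _)
      fun _ => MeasurePreserving.id _
    have h2 := measurePreserving_pi (fun _ : Fin (Fintype.card κ) => S.law)
      (fun _ => S.law.map Prod.fst) (f := fun _ => Prod.fst)
      fun _ => ⟨measurable_fst, rfl⟩
    exact h2.comp h1
  have hcover : (⋃ p : κ → range w, {v : κ → S.Obs | ∀ j, w (v j) = p j}) = univ :=
    eq_univ_of_forall fun v => mem_iUnion.2 ⟨fun j => ⟨w (v j), mem_range_self _⟩, fun _ => rfl⟩
  rw [← Measure.restrict_univ (μ := Measure.pi fun _ : κ => S.law), ← hcover]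
  refine aemeasurable_iUnion_iff.2 fun p => ?_
  have hpm : MeasurableSet {v : κ → S.Obs | ∀ j, w (v j) = p j} := by
    rw [ofPred_forall]
    exact MeasurableSet.iInter fun j =>
      (hw.comp (measurable_pi_apply j)) (measurableSet_singleton (p j : ℝ))
  have h1 := (hS (Fintype.card κ) (fun i => c (e.symm i) * p (e.symm i))
    z).comp_quasiMeasurePreserving hmp.quasiMeasurePreserving
  refine (h1.mono_measure Measure.restrict_le_self).congr ?_
  filter_upwards [ae_restrict_mem hpm] with v hv
  have hv' : ∀ j, w (v j) = p j := hv
  simp only [Function.comp_apply, supSum]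
  refine iSup_congr fun f => ?_
  rw [← Equiv.sum_comp e.symm fun j => c j * (w (v j) * S.thr f (v j).1 z)]
  simp only [hv', mul_assoc]

/-- The supremum in `rademacher` ranges over points of `𝒳 × [0, 1]`, so a common threshold `z` is a
special case. The factor `card ι` undoes the normalization. -/
theorem radAvg_thr_le {S : Setting 𝒳} [Nonempty S.predictors] {φ C : ℝ}
    (hR : ∀ k : ℕ, 1 ≤ k → S.rademacher k ≤ C * (k : ℝ) ^ (-φ)) {ι : Type*} [Fintype ι]
    [DecidableEq ι] [Nonempty ι] (z : unitInterval) (x : ι → 𝒳) :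
    radAvg (fun (f : S.predictors) i => S.thr f (x i) z) ≤
      Fintype.card ι * (C * (Fintype.card ι : ℝ) ^ (-φ)) := by
  set k := Fintype.card ι with hk
  have hk1 : 1 ≤ k := Fintype.card_pos
  have hk0 : (0 : ℝ) < k := by exact_mod_cast hk1
  set e := (Fintype.equivFin ι).symm
  have h1 : radAvg (fun (f : S.predictors) i => S.thr f (x i) z) =
      signAvg fun σ : Fin k → Bool => supSum fun (f : S.predictors) i =>
        sgn (σ i) * S.thr f (x (e i)) z := by
    rw [radAvg, ← signAvg_reindex e]
    congr! 2 with σ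
    unfold supSum
    refine iSup_congr fun f => ?_
    rw [← Equiv.sum_comp e]
    simp
    rfl
  have h2 : ∀ v : Fin k → 𝒳 × unitInterval, (1 / 2 ^ k : ℝ) * ∑ σ : Fin k → Bool,
      (⨆ f : S.predictors, |(1 / (k : ℝ)) * ∑ i,
        (if σ i then (1 : ℝ) else -1) * S.thr f (v i).1 (v i).2|) =
      (1 / (k : ℝ)) * signAvg fun σ : Fin k → Bool => supSum fun (f : S.predictors) i =>
        sgn (σ i) * S.thr f (v i).1 (v i).2 := fun v => by
    rw [← signAvg_const_mul, signAvg, Fintype.card_fin]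
    congr! 3 with σ
    rw [← supSum_const_mul (by positivity)]
    simp only [supSum, ← Finset.mul_sum]
    rfl
  have h3 : (1 / (k : ℝ)) * radAvg (fun (f : S.predictors) i => S.thr f (x i) z) ≤
      S.rademacher k := by
    rw [h1, ← h2 fun i => (x (e i), z)]
    refine le_ciSup (f := fun v : Fin k → 𝒳 × unitInterval => (1 / 2 ^ k : ℝ) *
      ∑ σ : Fin k → Bool, (⨆ f : S.predictors, |(1 / (k : ℝ)) * ∑ i,
        (if σ i then (1 : ℝ) else -1) * S.thr f (v i).1 (v i).2|)) ⟨1, ?_⟩ _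
    rintro _ ⟨v, rfl⟩
    simp only [h2]
    have h4 : signAvg (fun σ : Fin k → Bool => supSum fun (f : S.predictors) i =>
        sgn (σ i) * S.thr f (v i).1 (v i).2) ≤ k := by
      rw [← signAvg_const (ι := Fin k) (k : ℝ)]
      refine signAvg_mono fun σ => ?_
      refine (supSum_le_card (c := 1) fun f i => ?_).trans (by simp)
      rw [abs_sgn_mul]
      exact S.abs_thr_le_one _ _ _
    rw [one_div, inv_mul_le_iff₀ hk0, mul_one]
    exact h4
  have h4 := h3.trans (hR k hk1)
  rwa [one_div, inv_mul_le_iff₀ hk0] at h4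

/-! ### Discretization -/

theorem sum_grid_mul_ite (N : ℕ) (a : ℕ → ℝ) {v : ℝ} (hv0 : 0 ≤ v) (hv1 : v ≤ 1) :
    ∑ j ∈ Finset.Icc 1 N, a j * (if (j : ℝ) / N ≤ v then 1 else 0) =
      ∑ j ∈ Finset.Icc 1 ⌊(N : ℝ) * v⌋₊, a j := by
  have hJ : ⌊(N : ℝ) * v⌋₊ ≤ N := by
    rw [← Nat.floor_natCast (R := ℝ) N]
    refine Nat.floor_le_floor ?_
    rw [Nat.floor_natCast]
    exact mul_le_of_le_one_right (Nat.cast_nonneg N) hv1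
  simp only [mul_ite, mul_one, mul_zero]
  rw [← Finset.sum_filter]
  refine Finset.sum_congr ?_ fun _ _ => rfl
  ext j
  simp only [Finset.mem_filter, Finset.mem_Icc]
  constructor
  · rintro ⟨⟨h1, h2⟩, h3⟩
    have hN : (0 : ℝ) < N := by exact_mod_cast (by omega : 0 < N)
    rw [div_le_iff₀ hN] at h3
    exact ⟨h1, Nat.le_floor (by linarith)⟩
  · rintro ⟨h1, h2⟩
    have hN : (0 : ℝ) < N := by exact_mod_cast (by omega : 0 < N)
    have h3 := (Nat.le_floor_iff (by positivity)).1 h2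
    exact ⟨⟨h1, h2.trans hJ⟩, by rw [div_le_iff₀ hN]; linarith⟩

theorem gridMean_thr (N : ℕ) (f : S.predictors) (x : 𝒳) :
    gridMean N (fun z => S.thr f x z) = ⌊(N : ℝ) * (f.1 x : ℝ)⌋₊ / (N : ℝ) := by
  have h := sum_grid_mul_ite N (fun _ => 1) (f.1 x).2.1 (f.1 x).2.2
  simp only [one_mul] at h
  simp only [gridMean, thr, h]
  simp
  ring

theorem floor_div_bounds {N : ℕ} (hN : 0 < N) {v : ℝ} (hv : 0 ≤ v) :
    (⌊(N : ℝ) * v⌋₊ : ℝ) / N ≤ v ∧ v ≤ (⌊(N : ℝ) * v⌋₊ : ℝ) / N + 1 / N := by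
  have hN' : (0 : ℝ) < N := by exact_mod_cast hN
  have h1 := Nat.floor_le (mul_nonneg hN'.le hv)
  have h2 := (Nat.lt_floor_add_one ((N : ℝ) * v)).le
  constructor
  · rw [div_le_iff₀ hN']; linarith
  · rw [← add_div, le_div_iff₀ hN']; linarith

theorem abs_gridMean_thr_sub_le {N : ℕ} (hN : 0 < N) (f : S.predictors) (x : 𝒳) :
    |gridMean N (fun z => S.thr f x z) - (f.1 x : ℝ)| ≤ 1 / N := by
  obtain ⟨h1, h2⟩ := floor_div_bounds hN (f.1 x).2.1
  have h3 : (0 : ℝ) ≤ 1 / N := by positivity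
  rw [gridMean_thr, abs_le]
  constructor <;> linarith

theorem gridMean_thr_mem (N : ℕ) (f : S.predictors) (x : 𝒳) :
    gridMean N (fun z => S.thr f x z) ∈ Icc (0 : ℝ) 1 := by
  rcases Nat.eq_zero_or_pos N with rfl | hN
  · simp [gridMean]
  · rw [gridMean_thr]
    exact ⟨by positivity, (floor_div_bounds hN (f.1 x).2.1).1.trans (f.1 x).2.2⟩

theorem abs_lossExt_sub_le (y y' : S.outcomes) (v v' : ℝ) :
    |S.lossExt y v - S.lossExt y' v'| ≤ |(y : ℝ) - y'| + |v - v'| :=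
  (S.lossFn_lipschitz _ _ _ _).trans
    (add_le_add_right (abs_projIcc_sub_projIcc (zero_le_one' ℝ)) _)

theorem lossExt_coe (y : S.outcomes) (v : unitInterval) : S.lossExt y v = S.lossFn y v := by
  rw [lossExt, projIcc_val]

theorem lossExt_mem (y : S.outcomes) (v : ℝ) : S.lossExt y v ∈ Icc (0 : ℝ) 1 :=
  (S.lossFn y _).2

theorem abs_costWeight_le_one (N : ℕ) (y : S.outcomes) (z : ℝ) : |S.costWeight N y z| ≤ 1 := by
  rcases Nat.eq_zero_or_pos N with rfl | hN
  · simp [costWeight]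
  · have hN' : (0 : ℝ) < N := by exact_mod_cast hN
    have h := S.abs_lossExt_sub_le y y (z + 1 / (2 * (N : ℝ))) (z - 1 / (2 * (N : ℝ)))
    have h2 : z + 1 / (2 * (N : ℝ)) - (z - 1 / (2 * (N : ℝ))) = 1 / N := by field_simp; ring
    rw [sub_self, abs_zero, zero_add, h2, abs_of_pos (show (0 : ℝ) < 1 / N by positivity)] at h
    rw [costWeight, abs_mul, abs_of_pos hN']
    calc _ ≤ (N : ℝ) * (1 / N) := mul_le_mul_of_nonneg_left h hN'.le
      _ = 1 := by field_simp

/-- The classifier selects the first `⌊N f(x)⌋` grid points, over which the loss increments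
telescope. -/
theorem gridMean_cost {N : ℕ} (hN : 0 < N) (y : S.outcomes) (f : S.predictors) (x : 𝒳) :
    gridMean N (fun z => S.costWeight N y z * S.thr f x z) =
      S.lossExt y (⌊(N : ℝ) * (f.1 x : ℝ)⌋₊ / (N : ℝ) + 1 / (2 * (N : ℝ))) -
        S.lossExt y (1 / (2 * (N : ℝ))) := by
  have hN' : (0 : ℝ) < N := by exact_mod_cast hN
  have h := sum_grid_mul_ite N (fun j => S.costWeight N y ((j : ℝ) / N)) (f.1 x).2.1 (f.1 x).2.2
  simp only [gridMean, thr, h]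
  generalize ⌊(N : ℝ) * (f.1 x : ℝ)⌋₊ = J
  rw [one_div, inv_mul_eq_iff_eq_mul₀ hN'.ne']
  induction J with
  | zero => simp
  | succ J ih =>
    rw [Finset.sum_Icc_succ_top (by omega), ih, costWeight, ← mul_add]
    congr 1
    have : ((J + 1 : ℕ) : ℝ) / N - 1 / (2 * (N : ℝ)) = (J : ℝ) / N + 1 / (2 * (N : ℝ)) := by
      push_cast; field_simp; ring
    rw [this]
    ring

/-! ### Rounded outcomes -/

variable {S} in
theorem roundOutcome_spec {N : ℕ} {cover : Finset S.outcomes} (hc : S.IsCover N cover)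
    (y : S.outcomes) : S.roundOutcome N cover y ∈ cover ∧
      |(y : ℝ) - S.roundOutcome N cover y| ≤ 1 / (2 * (N : ℝ)) ∧
      ∀ c ∈ cover, |(y : ℝ) - (c : ℝ)| ≤ 1 / (2 * (N : ℝ)) → S.roundOutcome N cover y ≤ c := by
  classical
  obtain ⟨y', hy', hyy'⟩ := hc y
  have hne : (cover.filter fun y' : S.outcomes =>
      |(y : ℝ) - (y' : ℝ)| ≤ 1 / (2 * (N : ℝ))).Nonempty :=
    ⟨y', Finset.mem_filter.2 ⟨hy', hyy'⟩⟩
  have hr : S.roundOutcome N cover y = (cover.filter fun y' : S.outcomes =>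
      |(y : ℝ) - (y' : ℝ)| ≤ 1 / (2 * (N : ℝ))).min' hne := by
    rw [roundOutcome]
    convert dif_pos hne
  have hm := Finset.mem_filter.1 (Finset.min'_mem _ hne)
  rw [hr]
  exact ⟨hm.1, hm.2, fun c hc hc' => Finset.min'_le _ _ (Finset.mem_filter.2 ⟨hc, hc'⟩)⟩

variable {S} in
theorem measurable_comp_roundOutcome {N : ℕ} {cover : Finset S.outcomes} (hc : S.IsCover N cover)
    (h : S.outcomes → ℝ) : Measurable fun o : S.Obs => h (S.roundOutcome N cover o.2.2) := by
  have hy : Measurable fun o : S.Obs => (o.2.2 : ℝ) :=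
    measurable_subtype_coe.comp (measurable_snd.comp measurable_snd)
  have hn : ∀ c : S.outcomes,
      MeasurableSet {o : S.Obs | |(o.2.2 : ℝ) - (c : ℝ)| ≤ 1 / (2 * (N : ℝ))} := fun c =>
    measurableSet_le (hy.sub_const _).abs measurable_const
  have hpt : ∀ c : S.outcomes, MeasurableSet {o : S.Obs | S.roundOutcome N cover o.2.2 = c} := by
    intro c
    by_cases hcc : c ∈ cover
    -- Rounding gives `c` exactly when `c` is close enough and no smaller cover point is; these are
    -- finitely many measurable conditions.
    · have : {o : S.Obs | S.roundOutcome N cover o.2.2 = c} =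
          {o : S.Obs | |(o.2.2 : ℝ) - (c : ℝ)| ≤ 1 / (2 * (N : ℝ))} ∩
            ⋂ c' ∈ {c' ∈ cover | c' < c},
              {o : S.Obs | |(o.2.2 : ℝ) - (c' : ℝ)| ≤ 1 / (2 * (N : ℝ))}ᶜ := by
        ext o
        obtain ⟨h1, h2, h3⟩ := roundOutcome_spec hc o.2.2
        simp only [mem_ofPred_eq, mem_inter_iff, mem_iInter, mem_compl_iff, Finset.mem_filter]
        constructor
        · rintro rfl
          exact ⟨h2, fun c' hc' hle => not_lt.2 (h3 c' hc'.1 hle) hc'.2⟩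
        · rintro ⟨h4, h5⟩
          refine le_antisymm (h3 c hcc h4) (not_lt.1 fun hlt => ?_)
          exact h5 _ ⟨h1, hlt⟩ h2
      rw [this]
      exact (hn c).inter (Finset.measurableSet_biInter _ fun c' _ => (hn c').compl)
    · convert MeasurableSet.empty
      ext o
      simp only [mem_ofPred_eq, mem_empty_iff_false, iff_false]
      rintro rfl
      exact hcc (roundOutcome_spec hc o.2.2).1
  intro t _
  have : (fun o : S.Obs => h (S.roundOutcome N cover o.2.2)) ⁻¹' t =
      ⋃ c ∈ (cover : Set S.outcomes) ∩ h ⁻¹' t, {o : S.Obs | S.roundOutcome N cover o.2.2 = c} := by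
    ext o
    simp only [mem_preimage, mem_iUnion, mem_inter_iff, Finset.mem_coe, mem_ofPred_eq]
    constructor
    · intro ho
      exact ⟨_, ⟨(roundOutcome_spec hc o.2.2).1, ho⟩, rfl⟩
    · rintro ⟨c, ⟨-, hc'⟩, rfl⟩
      exact hc'
  rw [this]
  exact MeasurableSet.biUnion ((cover.finite_toSet.inter_of_left _).countable) fun c _ => hpt c

theorem finite_range_comp_roundOutcome {S : Setting 𝒳} {N : ℕ} {cover : Finset S.outcomes}
    (hc : S.IsCover N cover) (h : S.outcomes → ℝ) :
    (range fun o : S.Obs => h (S.roundOutcome N cover o.2.2)).Finite := by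
  refine (cover.finite_toSet.image h).subset ?_
  rintro _ ⟨o, rfl⟩
  exact ⟨_, (roundOutcome_spec hc o.2.2).1, rfl⟩

theorem measurable_loss (f : S.predictors) :
    Measurable fun o : S.Obs => (S.lossFn o.2.2 (f.1 o.1) : ℝ) := by
  have hcont : Continuous fun p : S.outcomes × unitInterval => (S.lossFn p.1 p.2 : ℝ) := by
    refine (LipschitzWith.of_dist_le_mul (K := 2) fun p q => ?_).continuous
    rw [Real.dist_eq]
    refine (S.lossFn_lipschitz _ _ _ _).trans ?_
    have h1 : |(p.1 : ℝ) - q.1| ≤ dist p q := le_max_left (dist p.1 q.1) (dist p.2 q.2)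
    have h2 : |(p.2 : ℝ) - q.2| ≤ dist p q := le_max_right (dist p.1 q.1) (dist p.2 q.2)
    push_cast
    linarith
  have hm : Measurable fun o : S.Obs => (o.2.2, f.1 o.1) :=
    (measurable_snd.comp measurable_snd).prodMk
      ((S.predictors_measurable f.1 f.2).comp measurable_fst)
  exact hcont.measurable.comp hm

end Setting

/-- This is where `φ ≤ 1/2` matters: fluctuations of order `k ^ (-1/2)` are absorbed by the
Rademacher rate `k ^ (-φ)`. -/
theorem sqrt_le_mul_rpow {k : ℕ} (hk : 1 ≤ k) {φ : ℝ} (hφ : φ ≤ 1 / 2) :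
    √(k : ℝ) ≤ k * (k : ℝ) ^ (-φ) := by
  have hk1 : (1 : ℝ) ≤ k := by exact_mod_cast hk
  have hk0 : (0 : ℝ) < k := by linarith
  rw [Real.sqrt_eq_rpow]
  calc (k : ℝ) ^ ((1 : ℝ) / 2) ≤ (k : ℝ) ^ (1 + -φ) :=
        Real.rpow_le_rpow_of_exponent_le hk1 (by linarith)
    _ = k * (k : ℝ) ^ (-φ) := by rw [Real.rpow_add hk0, Real.rpow_one]

theorem abs_mean_sub_le_of_sum {k : ℕ} (hk : 1 ≤ k) {φ X m B τ : ℝ} (hφ : φ ≤ 1 / 2) (hτ : 0 ≤ τ)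
    (h : |X - k * m| ≤ k * (B * (k : ℝ) ^ (-φ)) + τ * √k) :
    |(1 / (k : ℝ)) * X - m| ≤ (B + τ) * (k : ℝ) ^ (-φ) := by
  have hk0 : (0 : ℝ) < k := by exact_mod_cast hk
  have h1 : (1 / (k : ℝ)) * X - m = (X - k * m) / k := by field_simp
  rw [h1, abs_div, abs_of_pos hk0, div_le_iff₀ hk0]
  have := mul_le_mul_of_nonneg_left (sqrt_le_mul_rpow hk hφ) hτ
  linarith

/-! ### Uniform deviation of the loss and of the conditional means. -/

namespace Setting

variable {𝒳 : Type u} [MeasurableSpace 𝒳] {S : Setting 𝒳} {φ C : ℝ}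

/-- A point of the grid `{1/N, …, N/N}`. -/
noncomputable def gridPoint {N j : ℕ} (hj : j ∈ Finset.Icc 1 N) : unitInterval :=
  ⟨(j : ℝ) / N, div_nonneg (Nat.cast_nonneg _) (Nat.cast_nonneg _),
    div_le_one_of_le₀ (Nat.cast_le.2 (Finset.mem_Icc.1 hj).2) (Nat.cast_nonneg _)⟩

theorem card_grid (N : ℕ) : ((Finset.Icc 1 N).card : ℝ) = N := by simp

/-- The weighted threshold classifier at grid point `j / N`. -/
noncomputable def gridCost (S : Setting 𝒳) (N : ℕ) (cover : Finset S.outcomes) (j : ℕ)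
    (f : S.predictors) (o : S.Obs) : ℝ :=
  S.costWeight N (S.roundOutcome N cover o.2.2) ((j : ℝ) / N) * S.thr f o.1 ((j : ℝ) / N)

/-- The loss of the rounded outcome at `1 / (2 N)`. -/
noncomputable def baseLoss (S : Setting 𝒳) (N : ℕ) (cover : Finset S.outcomes) (o : S.Obs) : ℝ :=
  S.lossExt (S.roundOutcome N cover o.2.2) (1 / (2 * (N : ℝ)))

theorem baseLoss_mem (N : ℕ) (cover : Finset S.outcomes) (o : S.Obs) :
    S.baseLoss N cover o ∈ Icc (0 : ℝ) 1 := S.lossExt_mem _ _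

theorem abs_gridCost_le_one (N : ℕ) (cover : Finset S.outcomes) (j : ℕ) (f : S.predictors)
    (o : S.Obs) : |S.gridCost N cover j f o| ≤ 1 := by
  rw [gridCost, abs_mul]
  exact mul_le_one₀ (S.abs_costWeight_le_one _ _ _) (abs_nonneg _) (S.abs_thr_le_one _ _ _)

theorem measurable_weight {N : ℕ} {cover : Finset S.outcomes} (hc : S.IsCover N cover) (z : ℝ) :
    Measurable fun o : S.Obs => S.costWeight N (S.roundOutcome N cover o.2.2) z :=
  measurable_comp_roundOutcome hc fun y => S.costWeight N y z

theorem measurable_gridCost {N : ℕ} {cover : Finset S.outcomes} (hc : S.IsCover N cover) (j : ℕ)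
    (f : S.predictors) : Measurable (S.gridCost N cover j f) :=
  (measurable_weight hc _).mul (S.measurable_thr f _)

theorem measurable_baseLoss {N : ℕ} {cover : Finset S.outcomes} (hc : S.IsCover N cover) :
    Measurable (S.baseLoss N cover) :=
  measurable_comp_roundOutcome hc fun y => S.lossExt y (1 / (2 * (N : ℝ)))

theorem integrable_of_mem_Icc {α : Type*} [MeasurableSpace α] {μ : Measure α} [IsFiniteMeasure μ]
    {h : α → ℝ} (hm : Measurable h) (h01 : ∀ x, h x ∈ Icc (0 : ℝ) 1) : Integrable h μ :=
  Integrable.of_bound (C := 1) hm.aestronglyMeasurable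
    (ae_of_all _ fun x => by rw [Real.norm_eq_abs, abs_of_nonneg (h01 x).1]; exact (h01 x).2)

/-- Rounding the outcome costs at most `1/(2N)`. The midpoint of the grid cell of `f(x)` is within
`1/(2N)` of `f(x)`; this is what the half-step shifts in `costWeight` are for. -/
theorem abs_gridMean_cost_add_sub_loss_le {N : ℕ} (hN : 0 < N) {cover : Finset S.outcomes}
    (hc : S.IsCover N cover) (f : S.predictors) (o : S.Obs) :
    |(1 / (N : ℝ)) * ∑ j ∈ Finset.Icc 1 N, S.gridCost N cover j f o + S.baseLoss N cover o -
      S.lossFn o.2.2 (f.1 o.1)| ≤ 1 / N := by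
  have hN0 : (0 : ℝ) < N := by exact_mod_cast hN
  have h5 : (1 / (N : ℝ)) * ∑ j ∈ Finset.Icc 1 N, S.gridCost N cover j f o = _ :=
    S.gridMean_cost hN (S.roundOutcome N cover o.2.2) f o.1
  rw [h5, baseLoss, sub_add_cancel, ← lossExt_coe]
  refine (S.abs_lossExt_sub_le _ _ _ _).trans ?_
  obtain ⟨b1, b2⟩ := floor_div_bounds hN (f.1 o.1).2.1
  have b3 := (roundOutcome_spec hc o.2.2).2.1
  rw [abs_sub_comm] at b3
  have b4 : (1 : ℝ) / N = 1 / (2 * (N : ℝ)) + 1 / (2 * (N : ℝ)) := by field_simp; ring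
  rw [b4] at b2 ⊢
  refine add_le_add b3 (abs_le.2 ⟨?_, ?_⟩) <;> linarith

theorem abs_mean_cost_add_sub_loss_le {N : ℕ} (hN : 0 < N) {cover : Finset S.outcomes}
    (hc : S.IsCover N cover) (f : S.predictors) :
    |(1 / (N : ℝ)) * ∑ j ∈ Finset.Icc 1 N, ∫ o, S.gridCost N cover j f o ∂S.law +
      ∫ o, S.baseLoss N cover o ∂S.law - S.loss f| ≤ 1 / N := by
  have := S.law_prob
  have hgi : ∀ j ∈ Finset.Icc 1 N, Integrable (S.gridCost N cover j f) S.law := fun j _ =>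
    Integrable.of_bound (measurable_gridCost hc j f).aestronglyMeasurable _
      (ae_of_all _ (abs_gridCost_le_one N cover j f))
  have hci : Integrable (S.baseLoss N cover) S.law :=
    integrable_of_mem_Icc (measurable_baseLoss hc) (baseLoss_mem N cover)
  have hli : Integrable (fun o : S.Obs => (S.lossFn o.2.2 (f.1 o.1) : ℝ)) S.law :=
    integrable_of_mem_Icc (S.measurable_loss f) fun o => (S.lossFn o.2.2 (f.1 o.1)).2
  have hsum : Integrable (fun o => (1 / (N : ℝ)) * ∑ j ∈ Finset.Icc 1 N,
      S.gridCost N cover j f o) S.law := (integrable_finsetSum _ hgi).const_mul _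
  have hsub := integral_sub (hsum.add hci) hli
  simp only [Pi.add_apply] at hsub
  rw [loss, ← integral_finsetSum _ hgi, ← integral_const_mul, ← integral_add hsum hci, ← hsub,
    ← Real.norm_eq_abs]
  refine (norm_integral_le_of_norm_le_const (C := 1 / (N : ℝ)) (ae_of_all _ fun o =>
    abs_gridMean_cost_add_sub_loss_le hN hc f o)).trans (le_of_eq ?_)
  rw [probReal_univ, mul_one]

/-- At each grid point the Rademacher bound passes from thresholds to weighted thresholds by
`radAvg_mul_le`. Scaling the level by `√n` removes `n` from the tail. -/
theorem measure_cost_deviation_le [Nonempty S.predictors] (hS : S.SupMeasurable)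
    (hR : ∀ k : ℕ, 1 ≤ k → S.rademacher k ≤ C * (k : ℝ) ^ (-φ))
    {n N : ℕ} (hn : 1 ≤ n) (hN : 0 < N) {cover : Finset S.outcomes} (hc : S.IsCover N cover)
    {τ : ℝ} (hτ : 0 ≤ τ) :
    (Measure.pi fun _ : Fin n => S.law) {s | ¬ ∀ f,
      |∑ i, (1 / (N : ℝ)) * ∑ j ∈ Finset.Icc 1 N, S.gridCost N cover j f (s i) -
        n * ((1 / (N : ℝ)) * ∑ j ∈ Finset.Icc 1 N, ∫ o, S.gridCost N cover j f o ∂S.law)| ≤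
        2 * (n * (C * (n : ℝ) ^ (-φ))) + τ * √n} ≤ ENNReal.ofReal (Real.exp (-τ ^ 2 / 8)) := by
  have := S.law_prob
  have : Nonempty (Fin n) := ⟨⟨0, hn⟩⟩
  have hn0 : (0 : ℝ) < n := by exact_mod_cast hn
  have hmeas : ∀ j ∈ Finset.Icc 1 N, AEMeasurable (ghostSup (ι := Fin n) (S.gridCost N cover j))
      (Measure.pi fun _ => S.law.prod S.law) := by
    intro j hj
    have h1 := aemeasurable_supSum (κ := Fin n ⊕ Fin n) hS (gridPoint hj)
      (Sum.elim (fun _ => 1) (fun _ => -1)) (measurable_weight hc ((j : ℝ) / N))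
      (finite_range_comp_roundOutcome hc fun y => S.costWeight N y ((j : ℝ) / N))
    exact aemeasurable_ghostSup h1
  have hrad : ∀ j ∈ Finset.Icc 1 N, ∀ s : Fin n → S.Obs,
      radAvg (fun f i => S.gridCost N cover j f (s i)) ≤ n * (C * (n : ℝ) ^ (-φ)) := by
    intro j hj s
    have h1 := radAvg_thr_le hR (gridPoint hj) fun i => (s i).1
    rw [Fintype.card_fin] at h1
    exact (radAvg_mul_le (fun (f : S.predictors) i => S.abs_thr_le_one f (s i).1 _)
      (c := fun i => S.costWeight N (S.roundOutcome N cover (s i).2.2) ((j : ℝ) / N))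
      fun i => S.abs_costWeight_le_one _ _ _).trans h1
  have h := uniform_deviation (P := S.law) (ι := Fin n) (Finset.nonempty_Icc.2 hN)
    (measurable_gridCost hc) (abs_gridCost_le_one N cover) hmeas hrad (τ := τ * √n) (by positivity)
  rw [card_grid, Fintype.card_fin, mul_pow, Real.sq_sqrt hn0.le] at h
  have e1 : -(τ ^ 2 * n) / (8 * (n : ℝ)) = -τ ^ 2 / 8 := by field_simp
  rwa [e1] at h

theorem measure_baseLoss_deviation_le {n N : ℕ} (hn : 1 ≤ n) {cover : Finset S.outcomes}
    (hc : S.IsCover N cover) {τ : ℝ} (hτ : 0 ≤ τ) :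
    (Measure.pi fun _ : Fin n => S.law) {s | ¬ |∑ i, S.baseLoss N cover (s i) -
      n * ∫ o, S.baseLoss N cover o ∂S.law| ≤ τ * √n} ≤
      ENNReal.ofReal (2 * Real.exp (-2 * τ ^ 2)) := by
  have := S.law_prob
  have hn0 : (0 : ℝ) < n := by exact_mod_cast hn
  have h := measure_sum_sub_mean_gt_le (ι := Fin n) (P := S.law) (measurable_baseLoss hc)
    (baseLoss_mem N cover) (τ := τ * √n) (by positivity)
  rw [Fintype.card_fin, mul_pow, Real.sq_sqrt hn0.le] at h
  have e2 : -2 * (τ ^ 2 * n) / (n : ℝ) = -2 * τ ^ 2 := by field_simp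
  rwa [e2] at h

/-- Sample and population loss are uniformly close. -/
theorem measure_loss_deviation_le [Nonempty S.predictors] (hS : S.SupMeasurable)
    (hR : ∀ k : ℕ, 1 ≤ k → S.rademacher k ≤ C * (k : ℝ) ^ (-φ)) (hφ : φ ≤ 1 / 2)
    {n N : ℕ} (hn : 1 ≤ n) (hN : 0 < N) {cover : Finset S.outcomes} (hc : S.IsCover N cover)
    {τ : ℝ} (hτ : 0 ≤ τ) :
    (Measure.pi fun _ : Fin n => S.law) {s | ¬ ∀ f,
      |S.empCost s N cover f + S.empConst s N cover - S.loss f| ≤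
        (2 * C + 2 * τ) * (n : ℝ) ^ (-φ) + 1 / N} ≤
      ENNReal.ofReal (Real.exp (-τ ^ 2 / 8)) + ENNReal.ofReal (2 * Real.exp (-2 * τ ^ 2)) := by
  refine le_trans (measure_mono ?_) ((measure_union_le _ _).trans (add_le_add
    (measure_cost_deviation_le hS hR hn hN hc hτ) (measure_baseLoss_deviation_le hn hc hτ)))
  intro s hs
  by_contra hnot
  simp only [mem_union, mem_ofPred_eq, not_or, not_not] at hnot
  obtain ⟨h1, h2⟩ := hnot
  refine hs fun f => ?_
  have h1' := abs_mean_sub_le_of_sum hn (B := 2 * C) hφ hτ ((h1 f).trans (le_of_eq (by ring)))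
  have h2' := abs_mean_sub_le_of_sum hn (B := 0) hφ hτ (h2.trans (le_of_eq (by ring)))
  have hpop := abs_mean_cost_add_sub_loss_le hN hc f
  have e4 : S.empCost s N cover f = (1 / (n : ℝ)) * ∑ i, (1 / (N : ℝ)) *
      ∑ j ∈ Finset.Icc 1 N, S.gridCost N cover j f (s i) := rfl
  have e5 : S.empConst s N cover = (1 / (n : ℝ)) * ∑ i, S.baseLoss N cover (s i) := rfl
  rw [e4, e5]
  rw [abs_le] at h1' h2' hpop ⊢
  constructor <;> linarith [h1'.1, h1'.2, h2'.1, h2'.2, hpop.1, hpop.2]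

/-- The observations that lie in the `a`-th conditioning event. -/
def eventObs (S : Setting 𝒳) (a : Fin 2) : Set S.Obs := {o | o.2 ∈ S.event a}

open Classical in
/-- Sample version of `E[h_f(X, Z) | 𝓔ₐ]`. -/
noncomputable def empCondMean (S : Setting 𝒳) {n : ℕ} (s : Fin n → S.Obs) (N : ℕ)
    (f : S.predictors) (a : Fin 2) : ℝ :=
  (1 / (S.eventCount s a : ℝ)) *
    ∑ i, if (s i).2 ∈ S.event a then gridMean N (fun z => S.thr f (s i).1 z) else 0

/-- `E[f(X) | 𝓔ₐ]`. -/
noncomputable def condMean (S : Setting 𝒳) (f : S.predictors) (a : Fin 2) : ℝ :=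
  ∫ o, (f.1 o.1 : ℝ) ∂(ProbabilityTheory.cond S.law (S.eventObs a))

theorem empDisp_eq {n : ℕ} (s : Fin n → S.Obs) (β : Fin 2 → ℝ) (N : ℕ) (f : S.predictors) :
    S.empDisp s β N f = ∑ a, β a * S.empCondMean s N f a := rfl

theorem disp_eq (β : Fin 2 → ℝ) (f : S.predictors) :
    S.disp β f = ∑ a, β a * S.condMean f a := rfl

theorem measurable_predictor (f : S.predictors) : Measurable fun o : S.Obs => (f.1 o.1 : ℝ) :=
  measurable_subtype_coe.comp ((S.predictors_measurable f.1 f.2).comp measurable_fst)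

theorem condMean_mem (f : S.predictors) (a : Fin 2) : S.condMean f a ∈ Icc (0 : ℝ) 1 := by
  have := S.law_prob
  have : IsProbabilityMeasure (ProbabilityTheory.cond S.law (S.eventObs a)) :=
    ProbabilityTheory.cond_isProbabilityMeasure (S.event_pos a)
  refine ⟨integral_nonneg fun o => (f.1 o.1).2.1, ?_⟩
  have h := norm_integral_le_of_norm_le_const (C := 1)
    (μ := ProbabilityTheory.cond S.law (S.eventObs a)) (f := fun o => (f.1 o.1 : ℝ))
    (ae_of_all _ fun o => by
      rw [Real.norm_eq_abs, abs_of_nonneg (f.1 o.1).2.1]; exact (f.1 o.1).2.2)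
  rw [Real.norm_eq_abs, probReal_univ, mul_one] at h
  exact (le_abs_self _).trans h

theorem empCondMean_mem {n : ℕ} (s : Fin n → S.Obs) (N : ℕ) (f : S.predictors) (a : Fin 2) :
    S.empCondMean s N f a ∈ Icc (0 : ℝ) 1 := by
  classical
  unfold empCondMean
  constructor
  · refine mul_nonneg (by positivity) (Finset.sum_nonneg fun i _ => ?_)
    split_ifs
    · exact (S.gridMean_thr_mem N f _).1
    · exact le_rfl
  · rw [one_div, inv_mul_eq_div]
    refine div_le_one_of_le₀ ?_ (Nat.cast_nonneg _)
    rw [← Finset.sum_filter]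
    refine (Finset.sum_le_sum fun i _ => (S.gridMean_thr_mem N f (s i).1).2).trans ?_
    rw [Finset.sum_const, nsmul_eq_mul, mul_one]
    unfold eventCount
    exact le_of_eq (by congr!)

/-- Sample and population conditional means are uniformly close, at a rate governed by the number
of observations in the conditioning event. -/
theorem measure_condMean_deviation_le [Nonempty S.predictors] (hS : S.SupMeasurable)
    (hR : ∀ k : ℕ, 1 ≤ k → S.rademacher k ≤ C * (k : ℝ) ^ (-φ)) (hC : 0 ≤ C) (hφ : φ ≤ 1 / 2)
    {n N : ℕ} (hN : 0 < N) (a : Fin 2) {τ : ℝ} (hτ : 1 ≤ τ) :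
    (Measure.pi fun _ : Fin n => S.law) {s | ¬ ∀ f,
      |S.empCondMean s N f a - S.condMean f a| ≤
        (2 * C + τ) * (max 1 (S.eventCount s a) : ℝ) ^ (-φ) + 1 / N} ≤
      ENNReal.ofReal (Real.exp (-τ ^ 2 / 8)) := by
  classical
  have := S.law_prob
  set E := S.eventObs a with hE
  have hEm : MeasurableSet E := measurable_snd (S.event_measurable a)
  have hEp : S.law E ≠ 0 := S.event_pos a
  set P := ProbabilityTheory.cond S.law E with hP
  have : IsProbabilityMeasure P := ProbabilityTheory.cond_isProbabilityMeasure hEp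
  have hτ0 : 0 ≤ τ := zero_le_one.trans hτ
  have hN0 : (0 : ℝ) < N := by exact_mod_cast hN
  set g : ℕ → S.predictors → S.Obs → ℝ := fun j f o => S.thr f o.1 ((j : ℝ) / N) with hg
  set B : ∀ I : Finset (Fin n), Set (I → S.Obs) := fun I => {u | ¬ ∀ f,
      |∑ i, (1 / (N : ℝ)) * ∑ j ∈ Finset.Icc 1 N, g j f (u i) -
        I.card * ((1 / (N : ℝ)) * ∑ j ∈ Finset.Icc 1 N, ∫ o, g j f o ∂P)| ≤
      2 * (I.card * (C * (I.card : ℝ) ^ (-φ))) + τ * √I.card} with hB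
  have hBle : ∀ I : Finset (Fin n), (Measure.pi fun _ : I => P) (B I) ≤
      ENNReal.ofReal (Real.exp (-τ ^ 2 / 8)) := fun I => by
    -- For empty `I` both sides of the deviation inequality vanish, so the bad set is empty.
    rcases I.eq_empty_or_nonempty with rfl | hI
    · have : B ∅ = ∅ := by simp [hB]
      rw [this, measure_empty]
      exact zero_le
    · have : Nonempty I := hI.to_subtype
      have hI0 : (0 : ℝ) < I.card := by exact_mod_cast hI.card_pos
      have h := uniform_deviation (P := P) (ι := I) (g := g) (Finset.nonempty_Icc.2 hN)
        (fun j f => S.measurable_thr f _) (fun j f o => S.abs_thr_le_one f _ _)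
        (A := I.card * (C * (I.card : ℝ) ^ (-φ))) (τ := τ * √I.card)
        (fun j hj => aemeasurable_ghostSup (by
          -- Measurability is assumed for the unconditional product law. The product of conditional
          -- laws is that law conditioned on a box, hence absolutely continuous with respect to it.
          rw [hP, pi_cond hEm hEp]
          have h1 := aemeasurable_supSum (κ := I ⊕ I) hS (gridPoint hj)
            (Sum.elim (fun _ => 1) (fun _ => -1)) (w := fun _ => 1) measurable_const
            (finite_range_const)
          simp only [one_mul] at h1
          exact h1.mono_ac ProbabilityTheory.cond_absolutelyContinuous))
        (fun j hj s => by
          have h1 := radAvg_thr_le hR (gridPoint hj) fun i => (s i).1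
          rwa [Fintype.card_coe] at h1)
        (by positivity)
      rw [card_grid, Fintype.card_coe, mul_pow, Real.sq_sqrt hI0.le] at h
      have e1 : -(τ ^ 2 * I.card) / (8 * (I.card : ℝ)) = -τ ^ 2 / 8 := by field_simp
      rwa [e1] at h
  refine le_trans (measure_mono ?_) (measure_subsample_le hEm hEp B hBle)
  intro s hs
  by_contra hnot
  refine hs fun f => ?_
  have hcard : S.eventCount s a = (hits E s).card := rfl
  -- With no observation in the event the empirical mean is `0`; the error is then at most `1`,
  -- which `τ ≥ 1` covers.
  rcases Nat.eq_zero_or_pos (hits E s).card with h0 | hpos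
  · have hz : S.empCondMean s N f a = 0 := by
      unfold empCondMean
      rw [hcard, h0]
      simp
    rw [hz, hcard, h0, zero_sub, abs_neg, abs_of_nonneg (S.condMean_mem f a).1]
    have h1 : (0 : ℝ) ≤ 1 / N := by positivity
    have h2 : (max 1 ((0 : ℕ) : ℝ)) ^ (-φ) = 1 := by simp
    rw [h2]
    linarith [(S.condMean_mem f a).2]
  · simp only [hB, mem_ofPred_eq, not_not] at hnot
    have h1 := abs_mean_sub_le_of_sum hpos (B := 2 * C) hφ hτ0
      ((hnot f).trans (le_of_eq (by ring)))
    have h2 : (max 1 (S.eventCount s a : ℝ)) = (hits E s).card := by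
      rw [hcard]
      exact max_eq_right (by exact_mod_cast hpos)
    have h3 : S.empCondMean s N f a = (1 / ((hits E s).card : ℝ)) * ∑ i : hits E s,
        (1 / (N : ℝ)) * ∑ j ∈ Finset.Icc 1 N, g j f (s i) := by
      unfold empCondMean
      rw [hcard]
      congr 1
      rw [Finset.sum_coe_sort (hits E s) fun i =>
        (1 / (N : ℝ)) * ∑ j ∈ Finset.Icc 1 N, g j f (s i), hits, Finset.sum_filter]
      exact Finset.sum_congr rfl fun i _ => by congr!
    have hgi : ∀ j, Integrable (g j f) P := fun j =>
      Integrable.of_bound (S.measurable_thr f _).aestronglyMeasurable _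
        (ae_of_all _ fun o => S.abs_thr_le_one f o.1 _)
    have hfi : Integrable (fun o : S.Obs => (f.1 o.1 : ℝ)) P :=
      Integrable.of_bound (C := 1) (measurable_predictor f).aestronglyMeasurable
        (ae_of_all _ fun o => by
          rw [Real.norm_eq_abs, abs_of_nonneg (f.1 o.1).2.1]; exact (f.1 o.1).2.2)
    have h4 : |(1 / (N : ℝ)) * ∑ j ∈ Finset.Icc 1 N, ∫ o, g j f o ∂P - S.condMean f a| ≤ 1 / N := by
      have e3 : (1 / (N : ℝ)) * ∑ j ∈ Finset.Icc 1 N, ∫ o, g j f o ∂P - S.condMean f a =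
          ∫ o, ((1 / (N : ℝ)) * ∑ j ∈ Finset.Icc 1 N, g j f o - (f.1 o.1 : ℝ)) ∂P := by
        rw [integral_sub ((integrable_finsetSum _ fun j _ => hgi j).const_mul _) hfi,
          integral_const_mul, integral_finsetSum _ fun j _ => hgi j, condMean]
      rw [e3]
      have h5 := norm_integral_le_of_norm_le_const (μ := P) (C := 1 / (N : ℝ))
        (f := fun o : S.Obs => (1 / (N : ℝ)) * ∑ j ∈ Finset.Icc 1 N, g j f o - (f.1 o.1 : ℝ))
        (ae_of_all _ fun o => S.abs_gridMean_thr_sub_le hN f o.1)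
      simpa using h5
    rw [h2, h3]
    rw [abs_le] at h1 h4 ⊢
    constructor <;> linarith [h1.1, h1.2, h4.1, h4.2]

end Setting

/-! ### Sample size requirements and guarantees for the algorithm on a good sample. -/

open Filter Topology in
/-- All requirements on the sample size hold eventually. -/
theorem eventually_sample_size {φ κ₁ κB δ : ℝ} (hφ : 0 < φ) (hκ₁ : 0 < κ₁) (hκB : 0 < κB)
    (hδ : 0 < δ) (A₁ A₂ A₃ A₄ : ℝ) (r : ℕ) (c : ℝ) :
    ∃ n₀ : ℕ, ∀ n : ℕ, n₀ ≤ n → 1 ≤ n ∧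
      A₁ * (1 + Real.log n + c) ^ r * (n : ℝ) ^ (-φ) ≤ 1 ∧
      A₂ * (n : ℝ) ^ (-(1 / 2) : ℝ) ≤ 1 ∧ A₃ ≤ κB * (n : ℝ) ^ φ ∧
      A₄ ≤ √(2 * Real.log (8 * (κ₁ * (n : ℝ) ^ φ) / δ)) := by
  have hpow : Tendsto (fun x : ℝ => x ^ φ) atTop atTop := tendsto_rpow_atTop hφ
  have e1 : ∀ᶠ x : ℝ in atTop, A₁ * (1 + Real.log x + c) ^ r * x ^ (-φ) ≤ 1 := by
    have h1 : (fun x : ℝ => 1 + Real.log x + c) =O[atTop] Real.log :=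
      ((Real.isLittleO_const_log_atTop.isBigO.add (Asymptotics.isBigO_refl _ _))).add
        Real.isLittleO_const_log_atTop.isBigO
    have h2 : (fun x : ℝ => Real.log x ^ r) =o[atTop] fun x : ℝ => x ^ φ := by
      have := isLittleO_log_rpow_rpow_atTop (r : ℝ) hφ
      simpa only [Real.rpow_natCast] using this
    have h3 := ((h1.pow r).trans_isLittleO h2).const_mul_left A₁
    have h4 := h3.def one_pos
    filter_upwards [h4, eventually_gt_atTop 0] with x hx hx0
    rw [one_mul, Real.norm_eq_abs, Real.norm_eq_abs, abs_of_pos (Real.rpow_pos_of_pos hx0 φ)] at hx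
    rw [Real.rpow_neg hx0.le, ← div_eq_mul_inv, div_le_one (Real.rpow_pos_of_pos hx0 φ)]
    exact (le_abs_self _).trans hx
  have e2 : ∀ᶠ x : ℝ in atTop, A₂ * x ^ (-(1 / 2) : ℝ) ≤ 1 := by
    have h := (tendsto_rpow_neg_atTop (show (0 : ℝ) < 1 / 2 by norm_num)).const_mul A₂
    rw [mul_zero] at h
    exact h.eventually_le_const one_pos
  have e3 : ∀ᶠ x : ℝ in atTop, A₃ ≤ κB * x ^ φ :=
    (hpow.const_mul_atTop hκB).eventually_ge_atTop A₃
  have e4 : ∀ᶠ x : ℝ in atTop, A₄ ≤ √(2 * Real.log (8 * (κ₁ * x ^ φ) / δ)) := by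
    have h1 : Tendsto (fun x : ℝ => 8 * (κ₁ * x ^ φ) / δ) atTop atTop :=
      ((hpow.const_mul_atTop hκ₁).const_mul_atTop (by norm_num)).atTop_div_const hδ
    exact (Real.tendsto_sqrt_atTop.comp
      ((Real.tendsto_log_atTop.comp h1).const_mul_atTop two_pos)).eventually_ge_atTop A₄
  have hall := tendsto_natCast_atTop_atTop.eventually
    ((e1.and (e2.and (e3.and e4))) : ∀ᶠ x : ℝ in atTop, _)
  obtain ⟨n₀, hn₀⟩ := eventually_atTop.1 (hall.and (eventually_ge_atTop 1))
  exact ⟨n₀, fun n hn => ⟨(hn₀ n hn).2, (hn₀ n hn).1⟩⟩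

namespace Setting

variable {𝒳 : Type u} [MeasurableSpace 𝒳] {S : Setting 𝒳}

theorem abs_weighted_le {β : Fin 2 → ℝ} {Bξ : ℝ}
    (hβ : ∀ p ∈ Icc (0 : ℝ) 1, ∀ q ∈ Icc (0 : ℝ) 1, |β 0 * p + β 1 * q| ≤ Bξ) {v : Fin 2 → ℝ}
    (hv : ∀ a, v a ∈ Icc (0 : ℝ) 1) : |∑ a, β a * v a| ≤ Bξ := by
  rw [Fin.sum_univ_two]
  exact hβ _ (hv 0) _ (hv 1)

theorem abs_average_le {n : ℕ} {v : Fin n → ℝ} (hv : ∀ i, |v i| ≤ 1) :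
    |(1 / (n : ℝ)) * ∑ i, v i| ≤ 1 := by
  have h := abs_sum_le_card hv
  rw [Fintype.card_fin, mul_one] at h
  rw [abs_mul, abs_of_nonneg (by positivity), one_div, inv_mul_eq_div]
  exact div_le_one_of_le₀ h (Nat.cast_nonneg _)

theorem abs_empCost_le {n N : ℕ} (hN : 0 < N) (s : Fin n → S.Obs) (cover : Finset S.outcomes)
    (f : S.predictors) : |S.empCost s N cover f| ≤ 1 := by
  refine abs_average_le fun i => ?_
  rw [S.gridMean_cost hN]
  have h1 := S.lossExt_mem (S.roundOutcome N cover (s i).2.2)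
    (⌊(N : ℝ) * (f.1 (s i).1 : ℝ)⌋₊ / (N : ℝ) + 1 / (2 * (N : ℝ)))
  have h2 := S.lossExt_mem (S.roundOutcome N cover (s i).2.2) (1 / (2 * (N : ℝ)))
  rw [abs_le]
  constructor <;> linarith [h1.1, h1.2, h2.1, h2.2]

theorem abs_empConst_le {n : ℕ} (N : ℕ) (s : Fin n → S.Obs) (cover : Finset S.outcomes) :
    |S.empConst s N cover| ≤ 1 := by
  refine abs_average_le fun i => ?_
  have h := S.lossExt_mem (S.roundOutcome N cover (s i).2.2) (1 / (2 * (N : ℝ)))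
  rw [abs_of_nonneg h.1]
  exact h.2

theorem abs_loss_le (f : S.predictors) : |S.loss f| ≤ 1 := by
  have := S.law_prob
  have h := norm_integral_le_of_norm_le_const (μ := S.law) (C := 1)
    (f := fun o : S.Obs => (S.lossFn o.2.2 (f.1 o.1) : ℝ)) (ae_of_all _ fun o => by
      rw [Real.norm_eq_abs, abs_of_nonneg (S.lossFn o.2.2 (f.1 o.1)).2.1]
      exact (S.lossFn o.2.2 (f.1 o.1)).2.2)
  rwa [probReal_univ, mul_one] at h

theorem eventCount_le {n : ℕ} (s : Fin n → S.Obs) (a : Fin 2) : S.eventCount s a ≤ n := by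
  unfold eventCount
  exact (Finset.card_le_univ _).trans (by simp)

theorem abs_empDisp_sub_le {n N : ℕ} {s : Fin n → S.Obs} {β e : Fin 2 → ℝ} {f : S.predictors}
    (he : ∀ a, |S.empCondMean s N f a - S.condMean f a| ≤ e a) :
    |S.empDisp s β N f - S.disp β f| ≤ ∑ a, |β a| * e a := by
  rw [empDisp_eq, disp_eq, ← Finset.sum_sub_distrib]
  refine (Finset.abs_sum_le_sum_abs _ _).trans (Finset.sum_le_sum fun a _ => ?_)
  rw [← mul_sub, abs_mul]
  exact mul_le_mul_of_nonneg_left (he a) (abs_nonneg _)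

/-- Guarantees for the output on a sample on which sample and population quantities are close. -/
theorem output_spec {n N : ℕ} (hN : 0 < N) {s : Fin n → S.Obs} {cover : Finset S.outcomes}
    {β e : Fin 2 → ℝ} {Bξ Bl ν ε γ d : ℝ} (hBξ : 0 ≤ Bξ)
    (hβ : ∀ p ∈ Icc (0 : ℝ) 1, ∀ q ∈ Icc (0 : ℝ) 1, |β 0 * p + β 1 * q| ≤ Bξ) (hBl : 1 ≤ Bl)
    (hd : ∀ f, |S.empCost s N cover f + S.empConst s N cover - S.loss f| ≤ d) (hdγ : d ≤ γ)
    (he : ∀ f a, |S.empCondMean s N f a - S.condMean f a| ≤ e a)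
    {bestH : (Fin 3 → ℝ) → S.predictors} {g : AlgInput S.predictors}
    (hg : g = S.algInput s β N cover (ε - S.empConst s N cover + γ) Bξ Bl ν bestH)
    (hbest : g.IsBestResponse) {t : ℕ} (ht : g.StopsAt t) :
    (∃ (ξ : ℝ) (Q : PMF S.predictors) (lam : Fin 3 → ℝ),
      g.output t = some (ξ, Q, lam) ∧
      mean Q S.loss ≤ ε + γ + d + (Bξ + 2 * ν) / Bl ∧
      ∀ Q' : PMF S.predictors, S.Feasible ε Q' →
        |mean Q (S.disp β)| ≤ |mean Q' (S.disp β)| + (2 * ν + 2 * ∑ a, |β a| * e a)) ∨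
    (g.output t = none ∧ ¬ ∃ Q' : PMF S.predictors, S.Feasible ε Q') := by
  have hcost : ∀ f, |g.cost f| ≤ 1 := by
    rw [hg]; exact abs_empCost_le hN s cover
  have hdisp : ∀ f, |g.disp f| ≤ Bξ := by
    rw [hg]; exact fun f => abs_weighted_le hβ fun a => empCondMean_mem s N f a
  have hdisp' : ∀ f, |S.disp β f| ≤ Bξ := fun f => abs_weighted_le hβ fun a => condMean_mem f a
  have hclose : ∀ f, |g.disp f - S.disp β f| ≤ ∑ a, |β a| * e a := by
    rw [hg]; exact fun f => abs_empDisp_sub_le (he f)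
  have hd' : ∀ f, |g.cost f + S.empConst s N cover - S.loss f| ≤ d := by
    rw [hg]; exact hd
  have hε : g.epsHat = ε - S.empConst s N cover + γ := by rw [hg]; rfl
  have hgB : g.Bξ = Bξ := by rw [hg]; rfl
  have hgBl : g.Bl = Bl := by rw [hg]; rfl
  have hgν : g.ν = ν := by rw [hg]; rfl
  -- Since the deviation `d` does not exceed the relaxation `γ`, a feasible `Q'` meets the empirical
  -- cost constraint and can serve as competitor.
  have hopt : ∀ Q' : PMF S.predictors, S.Feasible ε Q' →
      mean (g.Qhat t) g.cost ≤ g.epsHat + (g.Bξ + 2 * g.ν) / g.Bl ∧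
      |mean (g.Qhat t) g.disp| ≤ |mean Q' g.disp| + 2 * g.ν := fun Q' hQ' => by
    refine AlgInput.abs_mean_disp_le hbest (by rwa [hgB]) hcost (by rwa [hgB]) (by rwa [hgBl])
      ht.1 ?_
    have h1 := mean_le_add Q' hcost (fun f => abs_loss_le f) (d := d - S.empConst s N cover)
      fun f => by linarith [(abs_le.1 (hd' f)).2]
    have h2 : mean Q' S.loss ≤ ε := hQ'
    rw [hε]
    linarith
  by_cases hout : mean (g.Qhat t) g.cost ≤ g.epsHat + (g.Bξ + 2 * g.ν) / g.Bl
  · left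
    refine ⟨g.xiHat t, g.Qhat t, g.lamHat t, if_pos hout, ?_, fun Q' hQ' => ?_⟩
    · have h1 := mean_le_add (g.Qhat t) (fun f => abs_loss_le f) hcost
        (d := d + S.empConst s N cover) fun f => by linarith [(abs_le.1 (hd' f)).1]
      rw [hε, hgB, hgBl, hgν] at hout
      linarith
    · have h1 := (hopt Q' hQ').2
      have h2 := abs_mean_sub_le (g.Qhat t) hdisp hdisp' hclose
      have h3 := abs_mean_sub_le Q' hdisp hdisp' hclose
      rw [hgν] at h1
      have h4 := abs_sub_abs_le_abs_sub (mean (g.Qhat t) (S.disp β)) (mean (g.Qhat t) g.disp)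
      have h5 := abs_sub_abs_le_abs_sub (mean Q' g.disp) (mean Q' (S.disp β))
      rw [abs_sub_comm] at h4
      linarith
  -- A feasible `Q'` would force the output test to succeed, so failure of the test rules out
  -- feasibility.
  · right
    exact ⟨if_neg hout, fun ⟨Q', hQ'⟩ => hout (hopt Q' hQ').1⟩

/-- The algorithm stops after at most `K n ^ (4 φ)` rounds. -/
theorem exists_stopsAt_le {n N : ℕ} (hn : 1 ≤ n) (hN : 0 < N) {s : Fin n → S.Obs}
    {cover : Finset S.outcomes} {β : Fin 2 → ℝ} {Bξ κν κB φ E epsHat : ℝ} (hBξ : 0 < Bξ)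
    (hφ : 0 < φ)
    (hβ : ∀ p ∈ Icc (0 : ℝ) 1, ∀ q ∈ Icc (0 : ℝ) 1, |β 0 * p + β 1 * q| ≤ Bξ)
    (hκν : 0 < κν) (hκB : 0 < κB) (hlarge : κν / Bξ ≤ κB * (n : ℝ) ^ φ) (hE : |epsHat| ≤ E)
    {bestH : (Fin 3 → ℝ) → S.predictors} {g : AlgInput S.predictors}
    (hg : g = S.algInput s β N cover epsHat Bξ (κB * (n : ℝ) ^ φ) (κν * (n : ℝ) ^ (-φ)) bestH)
    (hbest : g.IsBestResponse) :
    ∃ t : ℕ, g.StopsAt t ∧ ((t + 1 : ℕ) : ℝ) ≤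
      (4 * Real.log 4 * (2 * Bξ + 1 + E) ^ 2 * κB ^ 2 / κν ^ 2 + 1) * (n : ℝ) ^ (4 * φ) := by
  have hn1 : (1 : ℝ) ≤ n := by exact_mod_cast hn
  have hn0 : (0 : ℝ) < n := by linarith
  have hcost : ∀ f, |g.cost f| ≤ 1 := by
    rw [hg]; exact abs_empCost_le hN s cover
  have hdisp : ∀ f, |g.disp f| ≤ Bξ := by
    rw [hg]; exact fun f => abs_weighted_le hβ fun a => empCondMean_mem s N f a
  have hε : g.epsHat = epsHat := by rw [hg]; rfl
  have hgB : g.Bξ = Bξ := by rw [hg]; rfl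
  have hgBl : g.Bl = κB * (n : ℝ) ^ φ := by rw [hg]; rfl
  have hgν : g.ν = κν * (n : ℝ) ^ (-φ) := by rw [hg]; rfl
  have hη : g.η = g.ν / (2 * rho g.disp g.cost g.epsHat g.Bξ ^ 2 * g.Bl) := by rw [hg]; rfl
  have hcost' : ∀ f, |g.cost f - g.epsHat| ≤ 1 + E := fun f => by
    rw [hε]
    exact (abs_sub _ _).trans (add_le_add (hcost f) hE)
  have hpow0 : 0 < (n : ℝ) ^ φ := Real.rpow_pos_of_pos hn0 _
  have hneg : (n : ℝ) ^ (-φ) = ((n : ℝ) ^ φ)⁻¹ := Real.rpow_neg hn0.le φ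
  have hneg1 : (n : ℝ) ^ (-φ) ≤ 1 := Real.rpow_le_one_of_one_le_of_nonpos hn1 (by linarith)
  obtain ⟨t, ht, hle⟩ := AlgInput.exists_stopsAt hbest hdisp hcost (by rwa [hgB])
    (by rw [hgBl]; positivity) (by rw [hgν]; positivity) (by
      rw [hgν, hgB, hgBl]
      rw [div_le_iff₀ hBξ] at hlarge
      nlinarith) hη
  refine ⟨t, ht, hle.trans ?_⟩
  have hρ0 : 0 ≤ rho g.disp g.cost g.epsHat g.Bξ := Real.iSup_nonneg fun _ => norm_nonneg _
  have hρ : rho g.disp g.cost g.epsHat g.Bξ ≤ 2 * Bξ + 1 + E := by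
    have := (g.abs_con_pure_le_rho hdisp hcost' (ξ := 0) ⟨le_rfl, by rw [hgB]; exact hBξ.le⟩
      (g.bestH 0) 0).2
    rw [hgB] at this ⊢
    linarith
  have h4 : (n : ℝ) ^ (4 * φ) = ((n : ℝ) ^ φ) ^ 4 := by
    rw [mul_comm, Real.rpow_mul hn0.le]
    norm_cast
  have h41 : (1 : ℝ) ≤ ((n : ℝ) ^ φ) ^ 4 := one_le_pow₀ (Real.one_le_rpow hn1 hφ.le)
  have hlog : 0 ≤ Real.log 4 := Real.log_nonneg (by norm_num)
  rw [hgBl, hgν, hneg, h4, add_mul, one_mul]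
  refine add_le_add ?_ h41
  have e1 : 4 * Real.log 4 * rho g.disp g.cost g.epsHat g.Bξ ^ 2 * (κB * (n : ℝ) ^ φ) ^ 2 /
      (κν * ((n : ℝ) ^ φ)⁻¹) ^ 2 =
      4 * Real.log 4 * rho g.disp g.cost g.epsHat g.Bξ ^ 2 * κB ^ 2 / κν ^ 2 *
        ((n : ℝ) ^ φ) ^ 4 := by
    field_simp
  rw [e1]
  gcongr

/-- With high probability sample and population quantities are close. -/
theorem exists_good_event [Nonempty S.predictors] (hS : S.SupMeasurable) {φ C : ℝ} (hC : 0 ≤ C)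
    (hR : ∀ k : ℕ, 1 ≤ k → S.rademacher k ≤ C * (k : ℝ) ^ (-φ)) (hφ : φ ≤ 1 / 2)
    {n N : ℕ} (hn : 1 ≤ n) (hN : 0 < N) {cover : Finset S.outcomes} (hc : S.IsCover N cover)
    {δ : ℝ} (hδ : 0 < δ) {τ : ℝ} (hτ : 1 ≤ τ) (hτδ : τ ^ 2 = 8 * Real.log (8 / δ)) :
    ∃ G : Set (Fin n → S.Obs), MeasurableSet G ∧
      ENNReal.ofReal (1 - δ) ≤ Measure.pi (fun _ : Fin n => S.law) G ∧ ∀ s ∈ G,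
        (∀ f, |S.empCost s N cover f + S.empConst s N cover - S.loss f| ≤
          (2 * C + 2 * τ) * (n : ℝ) ^ (-φ) + 1 / N) ∧
        ∀ f a, |S.empCondMean s N f a - S.condMean f a| ≤
          (2 * C + τ) * (max 1 (S.eventCount s a) : ℝ) ^ (-φ) + 1 / N := by
  have := S.law_prob
  set μ := Measure.pi fun _ : Fin n => S.law with hμ
  have hb1 := measure_loss_deviation_le hS hR hφ hn hN hc (zero_le_one.trans hτ)
  have hb2 := fun a => measure_condMean_deviation_le (n := n) hS hR hC hφ hN a hτ
  set B₁ := {s : Fin n → S.Obs | ¬ ∀ f, |S.empCost s N cover f + S.empConst s N cover - S.loss f| ≤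
    (2 * C + 2 * τ) * (n : ℝ) ^ (-φ) + 1 / N}
  set B₂ := fun a => {s : Fin n → S.Obs | ¬ ∀ f, |S.empCondMean s N f a - S.condMean f a| ≤
    (2 * C + τ) * (max 1 (S.eventCount s a) : ℝ) ^ (-φ) + 1 / N}
  have hexp : Real.exp (-τ ^ 2 / 8) = δ / 8 := by
    rw [hτδ, show -(8 * Real.log (8 / δ)) / 8 = -Real.log (8 / δ) by ring, Real.exp_neg,
      Real.exp_log (by positivity), inv_div]
  have hexp2 : Real.exp (-2 * τ ^ 2) ≤ δ / 8 := by
    rw [← hexp, Real.exp_le_exp]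
    nlinarith [sq_nonneg τ]
  set B := B₁ ∪ (B₂ 0 ∪ B₂ 1)
  -- The budget is `δ/8` for the cost, at most `2δ/8` for the base loss and `δ/8` for each
  -- conditional mean, so at most `5δ/8` in total.
  have hB : μ B ≤ ENNReal.ofReal δ := by
    calc μ B ≤ μ B₁ + (μ (B₂ 0) + μ (B₂ 1)) :=
          (measure_union_le _ _).trans (add_le_add_right (measure_union_le _ _) _)
      _ ≤ (ENNReal.ofReal (Real.exp (-τ ^ 2 / 8)) + ENNReal.ofReal (2 * Real.exp (-2 * τ ^ 2))) +
          (ENNReal.ofReal (Real.exp (-τ ^ 2 / 8)) + ENNReal.ofReal (Real.exp (-τ ^ 2 / 8))) :=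
        add_le_add hb1 (add_le_add (hb2 0) (hb2 1))
      _ ≤ ENNReal.ofReal δ := by
        rw [← ENNReal.ofReal_add (Real.exp_pos _).le (by positivity),
          ← ENNReal.ofReal_add (Real.exp_pos _).le (Real.exp_pos _).le,
          ← ENNReal.ofReal_add (by positivity) (by positivity)]
        refine ENNReal.ofReal_le_ofReal ?_
        rw [hexp]
        linarith
  refine ⟨(toMeasurable μ B)ᶜ, (measurableSet_toMeasurable _ _).compl, ?_, fun s hs => ?_⟩
  · rw [prob_compl_eq_one_sub (measurableSet_toMeasurable _ _), measure_toMeasurable,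
      ENNReal.ofReal_sub _ hδ.le, ENNReal.ofReal_one]
    exact tsub_le_tsub_left hB _
  · have hs' : s ∉ B := fun h => hs (subset_toMeasurable _ _ h)
    simp only [B, mem_union, not_or] at hs'
    refine ⟨not_not.1 hs'.1, fun f a => ?_⟩
    fin_cases a
    · exact not_not.1 hs'.2.1 f
    · exact not_not.1 hs'.2.2 f

end Setting

end FairRashomon

/-! ### Choice of the constants and conclusion. -/

theorem theorem3
    (φ C εmax Bξ κν κB κ₁ κ₂ M : ℝ) (r : ℕ) (β : Fin 2 → ℝ)
    (hφ : 0 < φ) (hφ' : φ ≤ 1 / 2) (hC : 0 < C) (hBξ : 0 < Bξ)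
    (hβ : ∀ p ∈ Icc (0 : ℝ) 1, ∀ q ∈ Icc (0 : ℝ) 1, |β 0 * p + β 1 * q| ≤ Bξ)
    (hκν : 0 < κν) (hκB : 0 < κB) (hκ₁ : 0 < κ₁) :
    ∃ K : ℝ, 0 < K ∧ ∃ m : ℕ,
      ∀ δ : ℝ, 0 < δ → δ < 1 →
      ∀ C'' : ℝ, 0 < C'' → √(-Real.log (δ / 8) / 2) ≤ C'' →
      ∃ n₀ : ℕ,
      ∀ (𝒳 : Type u) [MeasurableSpace 𝒳] (S : Setting 𝒳), S.SupMeasurable →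
      (∀ k : ℕ, 1 ≤ k → S.rademacher k ≤ C * (k : ℝ) ^ (-φ)) →
      ∀ ε : ℝ, 0 ≤ ε → ε ≤ εmax →
      ∀ n : ℕ, n₀ ≤ n →
      ∀ N : ℕ, κ₁ * (n : ℝ) ^ φ ≤ N → (N : ℝ) ≤ κ₂ * (n : ℝ) ^ φ →
      ∀ cover : Finset S.outcomes, S.IsCover N cover →
      ∀ C' : ℝ, 2 * C + 2 + √(2 * Real.log (8 * N / δ)) ≤ C' → C' ≤ polylog M r n δ →
      -- termination, for every sample and every exact best-response procedure
      (∀ (s : Fin n → S.Obs) (bestH : (Fin 3 → ℝ) → S.predictors) (g : AlgInput S.predictors),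
        g = S.algInput s β N cover (S.epsHat s N cover φ ε C' C'') Bξ
          (κB * (n : ℝ) ^ φ) (κν * (n : ℝ) ^ (-φ)) bestH →
        g.IsBestResponse →
        ∃ t : ℕ, g.StopsAt t ∧ ((t + 1 : ℕ) : ℝ) ≤ K * (n : ℝ) ^ (4 * φ)) ∧
      -- quality of the output, for all samples in an event of probability at least `1 - δ`
      ∃ G : Set (Fin n → S.Obs), MeasurableSet G ∧
        ENNReal.ofReal (1 - δ) ≤ Measure.pi (fun _ : Fin n => S.law) G ∧
        ∀ s ∈ G, ∀ (bestH : (Fin 3 → ℝ) → S.predictors) (g : AlgInput S.predictors),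
          g = S.algInput s β N cover (S.epsHat s N cover φ ε C' C'') Bξ
            (κB * (n : ℝ) ^ φ) (κν * (n : ℝ) ^ (-φ)) bestH →
          g.IsBestResponse →
          ∀ t : ℕ, g.StopsAt t →
            (∃ (ξ : ℝ) (Q : PMF S.predictors) (lam : Fin 3 → ℝ),
              g.output t = some (ξ, Q, lam) ∧
              mean Q S.loss ≤ ε + polylog K m n δ * (n : ℝ) ^ (-φ) ∧
              ∀ Q' : PMF S.predictors, S.Feasible ε Q' →
                |mean Q (S.disp β)| ≤ |mean Q' (S.disp β)|
                  + polylog K m n δ * (max 1 (S.eventCount s 0) : ℝ) ^ (-φ)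
                  + polylog K m n δ * (max 1 (S.eventCount s 1) : ℝ) ^ (-φ)) ∨
            (g.output t = none ∧ ¬ ∃ Q' : PMF S.predictors, S.Feasible ε Q') := by
  set Cd : ℝ := 2 * C + 8 + 1 / κ₁ with hCd
  have hCd0 : 0 < Cd := by positivity
  set K₁ : ℝ := 2 * (|β 0| + |β 1|) * Cd + 2 * κν with hK₁
  set K₂ : ℝ := |M| + (2 * C + 16 + 1 / κ₁) + (Bξ + 2 * κν) / κB with hK₂
  set K₃ : ℝ := 4 * Real.log 4 * (2 * Bξ + 1 + (|εmax| + 3)) ^ 2 * κB ^ 2 / κν ^ 2 + 1 with hK₃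
  have hlog4 : 0 ≤ Real.log 4 := Real.log_nonneg (by norm_num)
  have hK₁0 : 0 < K₁ := by positivity
  have hK₂0 : 0 < K₂ := by positivity
  have hK₃0 : 0 < K₃ := by positivity
  -- `K₁` serves the disparity bound, `K₂` the loss bound and `K₃` the number of rounds. With `Λ = 1
  -- + ln n + ln(1/δ)`, `C'` contributes `Λ ^ r` and `τ` contributes `Λ`; the exponent `r + 1`
  -- covers both, also for `r = 0`.
  refine ⟨K₁ + K₂ + K₃, by positivity, r + 1, fun δ hδ hδ1 C'' hC'' _ => ?_⟩
  have hℓ : 0 ≤ Real.log (1 / δ) := Real.log_nonneg (by rw [le_div_iff₀ hδ]; linarith)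
  have hlog8 : Real.log (8 / δ) = Real.log 8 + Real.log (1 / δ) := by
    rw [← Real.log_mul (by norm_num) (by positivity)]
    congr 1
    ring
  have hlog8l : (7 / 8 : ℝ) ≤ Real.log 8 := by
    have := Real.one_sub_inv_le_log_of_pos (show (0 : ℝ) < 8 by norm_num)
    norm_num at this
    linarith
  have hlog8u : Real.log 8 ≤ 7 := by
    have := Real.log_le_sub_one_of_pos (show (0 : ℝ) < 8 by norm_num)
    linarith
  set τ : ℝ := √(8 * Real.log (8 / δ)) with hτdef
  have hτsq : τ ^ 2 = 8 * Real.log (8 / δ) := Real.sq_sqrt (by rw [hlog8]; linarith)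
  have hτ1 : 1 ≤ τ := by
    rw [hτdef, Real.one_le_sqrt, hlog8]
    linarith
  have hτu : τ ≤ 8 * (1 + Real.log (1 / δ)) := by
    refine abs_le_of_sq_le_sq' ?_ (by linarith) |>.2
    rw [hτsq, hlog8]
    nlinarith
  -- The four requirements make `C' n^(-φ)` and `C'' n^(-1/2)` at most `1`, give `B_λ ≥ 1` and `ν ≤
  -- B_ξ B_λ`, and let the square root in `C'` dominate the constants depending on `δ` and `C''`.
  obtain ⟨n₀, hn₀⟩ := eventually_sample_size hφ hκ₁ hκB hδ |M| C'' (1 + κν / Bξ)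
    (2 * τ + 1 / κ₁ + C'') r (Real.log (1 / δ))
  refine ⟨n₀, ?_⟩
  intro 𝒳 _ S hS hR ε hε hεmax n hn N hN₁ _ cover hcover C' hC' hC'M
  obtain ⟨hn1, hbig₁, hbig₂, hbig₃, hbig₄⟩ := hn₀ n hn
  have hn1' : (1 : ℝ) ≤ n := by exact_mod_cast hn1
  have hn0' : (0 : ℝ) < n := by linarith
  have hpow0 : 0 < (n : ℝ) ^ φ := Real.rpow_pos_of_pos hn0' _
  have hNpos' : (0 : ℝ) < N := lt_of_lt_of_le (by positivity) hN₁
  have hNpos : 0 < N := by exact_mod_cast hNpos'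
  set p : ℝ := (n : ℝ) ^ (-φ) with hp
  have hp0 : 0 < p := Real.rpow_pos_of_pos hn0' _
  have hpinv : p = ((n : ℝ) ^ φ)⁻¹ := Real.rpow_neg hn0'.le φ
  have hp1 : p ≤ 1 := Real.rpow_le_one_of_one_le_of_nonpos hn1' (by linarith)
  set q : ℝ := (n : ℝ) ^ (-(1 / 2) : ℝ) with hq
  have hq0 : 0 < q := Real.rpow_pos_of_pos hn0' _
  have hqp : q ≤ p := Real.rpow_le_rpow_of_exponent_le hn1' (by linarith)
  have hNinv : 1 / (N : ℝ) ≤ 1 / κ₁ * p := by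
    rw [hpinv, one_div, one_div, ← mul_inv]
    exact inv_anti₀ (by positivity) hN₁
  set Λ : ℝ := 1 + Real.log n + Real.log (1 / δ) with hΛ
  have hlogn : 0 ≤ Real.log n := Real.log_nonneg hn1'
  have hΛ1 : 1 ≤ Λ := by linarith
  have hΛr1 : Λ ≤ Λ ^ (r + 1) := le_self_pow₀ hΛ1 (by omega)
  have hΛr : Λ ^ r ≤ Λ ^ (r + 1) := pow_le_pow_right₀ hΛ1 (by omega)
  have hΛ0 : (1 : ℝ) ≤ Λ ^ (r + 1) := one_le_pow₀ hΛ1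
  have hτΛ : τ ≤ 8 * Λ := by linarith
  have hC'0 : 0 ≤ C' := by
    have := Real.sqrt_nonneg (2 * Real.log (8 * N / δ))
    linarith
  have hC'u : C' ≤ |M| * Λ ^ r := hC'M.trans
    (mul_le_mul_of_nonneg_right (le_abs_self M) (by positivity))
  have hC'p : C' * p ≤ 1 := (mul_le_mul_of_nonneg_right hC'u hp0.le).trans hbig₁
  -- `N ≥ κ₁ n^φ` makes the logarithmic part of `C'` grow, while the remaining terms on the left are
  -- fixed before `n`.
  have hC'l : 2 * C + 2 * τ + 1 / κ₁ + C'' ≤ C' := by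
    have h1 : √(2 * Real.log (8 * (κ₁ * (n : ℝ) ^ φ) / δ)) ≤ √(2 * Real.log (8 * N / δ)) := by
      refine Real.sqrt_le_sqrt (mul_le_mul_of_nonneg_left (Real.log_le_log (by positivity) ?_)
        (by norm_num))
      gcongr
    linarith
  set γ : ℝ := C' * p - C'' * q with hγ
  set d : ℝ := (2 * C + 2 * τ) * p + 1 / N with hd
  have hdu : d ≤ (2 * C + 2 * τ + 1 / κ₁) * p := by rw [hd, add_mul (2 * C + 2 * τ)]; linarith
  have hdγ : d ≤ γ := by
    have h1 := mul_le_mul_of_nonneg_right hC'l hp0.le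
    have h2 := mul_le_mul_of_nonneg_left hqp hC''.le
    rw [hγ]
    linarith
  have hepsHat : ∀ s : Fin n → S.Obs,
      S.epsHat s N cover φ ε C' C'' = ε - S.empConst s N cover + γ := fun s => by
    rw [Setting.epsHat, hγ, hp, hq]
    ring
  constructor
  · intro s bestH g hg hbest
    -- Both correction terms are at most `1` by the choice of `n₀`, which keeps the iteration
    -- constant independent of `δ` and `C''`.
    have hE : |S.epsHat s N cover φ ε C' C''| ≤ |εmax| + 3 := by
      have h1 := abs_le.1 (Setting.abs_empConst_le (S := S) N s cover)
      have h2 : 0 ≤ C'' * q := by positivity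
      have h3 : 0 ≤ C' * p := by positivity
      have h4 := le_abs_self εmax
      rw [hepsHat, hγ, abs_le]
      constructor <;> linarith [h1.1, h1.2]
    obtain ⟨t, ht, htle⟩ := Setting.exists_stopsAt_le hn1 hNpos hBξ hφ hβ hκν hκB
      (by linarith) hE hg hbest
    refine ⟨t, ht, htle.trans (mul_le_mul_of_nonneg_right ?_ (by positivity))⟩
    linarith
  -- For an empty class there is no best-response procedure, so the claim about the output is
  -- vacuous.
  rcases isEmpty_or_nonempty S.predictors with hemp | hne
  · have := S.law_prob
    refine ⟨univ, MeasurableSet.univ, ?_, fun s _ bestH => (hemp.false (bestH 0)).elim⟩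
    rw [measure_univ]
    exact ENNReal.ofReal_le_one.2 (by linarith)
  obtain ⟨G, hGm, hGp, hG⟩ :=
    Setting.exists_good_event hS hC.le hR hφ' hn1 hNpos hcover hδ hτ1 hτsq
  refine ⟨G, hGm, hGp, fun s hs bestH g hg hbest t ht => ?_⟩
  obtain ⟨hGd, hGe⟩ := hG s hs
  rw [hepsHat] at hg
  have hBl1 : 1 ≤ κB * (n : ℝ) ^ φ := by
    have : 0 < κν / Bξ := by positivity
    linarith
  rcases Setting.output_spec hNpos hBξ.le hβ hBl1 hGd hdγ hGe hg hbest ht with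
    ⟨ξ, Q, lam, hout, hloss, hdisp⟩ | hnull
  swap
  · exact Or.inr hnull
  refine Or.inl ⟨ξ, Q, lam, hout, hloss.trans ?_, fun Q' hQ' => (hdisp Q' hQ').trans ?_⟩
  · have h1 : (Bξ + 2 * (κν * p)) / (κB * (n : ℝ) ^ φ) ≤ (Bξ + 2 * κν) / κB * p := by
      have e : (Bξ + 2 * κν) / κB * p = (Bξ + 2 * κν) / (κB * (n : ℝ) ^ φ) := by
        rw [hpinv]
        field_simp
      have : κν * p ≤ κν := mul_le_of_le_one_right hκν.le hp1
      rw [e]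
      gcongr
    have h2 : γ ≤ |M| * Λ ^ r * p := by
      have := mul_le_mul_of_nonneg_right hC'u hp0.le
      have h3 : 0 ≤ C'' * q := by positivity
      rw [hγ]
      linarith
    have h3 : |M| * Λ ^ r + (2 * C + 2 * τ + 1 / κ₁) + (Bξ + 2 * κν) / κB ≤
        (K₁ + K₂ + K₃) * Λ ^ (r + 1) := by
      have a1 := mul_le_mul_of_nonneg_left hΛr (abs_nonneg M)
      have a2 : 2 * C + 2 * τ + 1 / κ₁ ≤ (2 * C + 16 + 1 / κ₁) * Λ ^ (r + 1) := by
        have b1 : 2 * C ≤ 2 * C * Λ ^ (r + 1) := le_mul_of_one_le_right (by positivity) hΛ0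
        have b2 : 1 / κ₁ ≤ 1 / κ₁ * Λ ^ (r + 1) := le_mul_of_one_le_right (by positivity) hΛ0
        linarith
      have a3 : (Bξ + 2 * κν) / κB ≤ (Bξ + 2 * κν) / κB * Λ ^ (r + 1) :=
        le_mul_of_one_le_right (by positivity) hΛ0
      have a4 : 0 ≤ (K₁ + K₃) * Λ ^ (r + 1) := by positivity
      have a5 : (K₁ + K₂ + K₃) * Λ ^ (r + 1) = (K₁ + K₃) * Λ ^ (r + 1) +
          (|M| * Λ ^ (r + 1) + (2 * C + 16 + 1 / κ₁) * Λ ^ (r + 1) +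
            (Bξ + 2 * κν) / κB * Λ ^ (r + 1)) := by rw [hK₂]; ring
      linarith
    have h4 := mul_le_mul_of_nonneg_right h3 hp0.le
    rw [polylog, ← hΛ]
    linarith
  · set m : Fin 2 → ℝ := fun a => (max 1 (S.eventCount s a) : ℝ) ^ (-φ) with hm
    have hm0 : ∀ a, 0 < m a := fun a =>
      Real.rpow_pos_of_pos (lt_of_lt_of_le one_pos (le_max_left _ _)) _
    -- As `max 1 n_a ≤ n`, the errors of order `n ^ (-φ)`, namely `1/N` and `ν`, are absorbed by the
    -- group rates; `ν` is charged to group `0`.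
    have hpm : ∀ a, p ≤ m a := fun a =>
      Real.rpow_le_rpow_of_nonpos (lt_of_lt_of_le one_pos (le_max_left _ _))
        (max_le hn1' (Nat.cast_le.2 (Setting.eventCount_le s a))) (by linarith)
    have he : ∀ a, (2 * C + τ) * m a + 1 / N ≤ Cd * Λ * m a := fun a => by
      have h1 : 1 / (N : ℝ) ≤ 1 / κ₁ * m a :=
        hNinv.trans (mul_le_mul_of_nonneg_left (hpm a) (by positivity))
      have h2 : 2 * C + τ + 1 / κ₁ ≤ Cd * Λ := by
        have b1 : 2 * C ≤ 2 * C * Λ := le_mul_of_one_le_right (by positivity) hΛ1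
        have b2 : 1 / κ₁ ≤ 1 / κ₁ * Λ := le_mul_of_one_le_right (by positivity) hΛ1
        rw [hCd]
        linarith
      have h3 := mul_le_mul_of_nonneg_right h2 (hm0 a).le
      linarith
    have hKm : ∀ a, K₁ * Λ * m a ≤ polylog (K₁ + K₂ + K₃) (r + 1) n δ * m a := fun a => by
      refine mul_le_mul_of_nonneg_right ?_ (hm0 a).le
      rw [polylog, ← hΛ]
      exact mul_le_mul (by linarith) hΛr1 (by linarith) (by positivity)
    have hβe : ∀ a, |β a| * ((2 * C + τ) * m a + 1 / N) ≤
        (|β 0| + |β 1|) * (Cd * Λ * m a) := fun a => by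
      refine mul_le_mul ?_ (he a) ?_ (by positivity)
      · fin_cases a
        · exact le_add_of_nonneg_right (abs_nonneg _)
        · exact le_add_of_nonneg_left (abs_nonneg _)
      · have := hm0 a
        positivity
    have hνm : 2 * (κν * p) ≤ 2 * κν * Λ * m 0 := by
      have h1 := mul_le_mul_of_nonneg_left (hpm 0) hκν.le
      have h2 : κν * m 0 ≤ κν * m 0 * Λ :=
        le_mul_of_one_le_right (mul_nonneg hκν.le (hm0 0).le) hΛ1
      linarith
    have hνm1 : 0 ≤ 2 * κν * Λ * m 1 := by
      have := hm0 1
      positivity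
    have h0 := hKm 0
    have h1 := hKm 1
    have h2 := hβe 0
    have h3 := hβe 1
    rw [hK₁] at h0 h1
    rw [Fin.sum_univ_two]
    change _ ≤ |mean Q' (S.disp β)| + polylog (K₁ + K₂ + K₃) (r + 1) n δ * m 0 +
      polylog (K₁ + K₂ + K₃) (r + 1) n δ * m 1
    linarith
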